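/- **Setting.** Let $p\ge 5$ be a prime, let $\mathcal O$ be the ring of integers of a finite extension of $\mathbb Q_p$, with uniformizer $\varpi$ and residue field $\mathbb F$, and let $v_p$ be the valuation with $v_p(p)=1$. Let $\mathrm K_p=\mathrm{GL}_2(\mathbb Z_p)\supset \mathrm{Iw}_p=\{\begin{pmatrix}\alpha&\beta\\ \gamma&\delta\end{pmatrix}\in \mathrm K_p : p\mid\gamma\}$, let $\omega:\mathbb F_p^\times\to\mathbb Z_p^\times\subset\mathcal O^\times$ be the Teichmüller character, $\Delta=\mathbb F_p^\times$, and for $m\in\mathbb Z$ let $\{m\}\in\{0,\dots,p-2\}$ be its residue modulo $p-1$. Fix an integer $1\le a\le p-4$. Let $\widetilde{\mathrm H}$ be a finitely generated projective right $\mathcal O[\![\mathrm K_p]\!]$-module such that $\widetilde{\mathrm H}/\widetilde{\mathrm H}\cdot(\varpi, \mathrm I_{1+p\mathrm M_2(\mathbb Z_p)})$ is isomorphic, as a right $\mathbb F[\mathrm{GL}_2(\mathbb F_p)]$-module, to the projective envelope of $\sigma_{a,0}=\mathrm{Sym}^a\mathbb F^{\oplus 2}$ (on which $\begin{pmatrix}\alpha&\beta\\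 \gamma&\delta\end{pmatrix}$ acts by $h(X,Y)\mapsto h(\alpha X+\beta Y,\gamma X+\delta Y)$). Here $\mathrm I_{1+p\mathrm M_2(\mathbb Z_p)}$ is the augmentation ideal of $\mathcal O[\![1+p\mathrm M_2(\mathbb Z_p)]\!]$. (For example, $\widetilde{\mathrm H}$ may be the module underlying a primitive $\mathcal O[\![\mathrm K_p]\!]$-projective augmented module of type $\bar\rho=\begin{pmatrix}\omega_1^{a+1}&*\neq 0\\0&1\end{pmatrix}$.) For $k\ge 2$ and characters $\psi:\Delta^2\to\mathcal O^\times$, $\eta:\Delta\to\mathcal O^\times$, let $$\mathrm S_k^{\mathrm{Iw}}(\psi)=\mathrm{Hom}_{\mathcal O[\![\mathrm{Iw}_p]\!]}(\widetilde{\mathrm H},\mathcal O[z]^{\le k-2}\otimes\psi),\qquad \mathrm S_k^{\mathrm{ur}}(\eta)=\mathrm{Hom}_{\mathcal O[\![\mathrm K_p]\!]}(\widetilde{\mathrm H},\mathcal O[z]^{\le k-2}\otimes\eta\circ\det)$$ (continuous homomorphisms), where $\begin{pmatrix}\alpha&\beta\\ \gamma&\delta\end{pmatrix}$ acts on $\mathcal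 O[z]^{\le k-2}$ from the right by $f(z)\mapsto(\gamma z+\delta)^{k-2}f\big(\tfrac{\alpha z+\beta}{\gamma z+\delta}\big)$, $\psi$ is evaluated at $(\bar\alpha,\bar\delta)$, and $\eta\circ\det$ means $\eta$ evaluated at $\det \bmod p$. Let $d_k^{\mathrm{Iw}}(\psi)$ and $d_k^{\mathrm{ur}}(\eta)$ be their ranks over $\mathcal O$, and put $d_k^{\mathrm{new}}(\eta)=d_k^{\mathrm{Iw}}(\eta\times\eta)-2d_k^{\mathrm{ur}}(\eta)$. Fix $s_\varepsilon\in\{0,\dots,p-2\}$, and let $\varepsilon=\omega^{-s_\varepsilon}\times\omega^{a+s_\varepsilon}$, $\varepsilon_1=\omega^{-s_\varepsilon}$, $\tilde\varepsilon_1=\varepsilon_1\times\varepsilon_1$, $k_\varepsilon=2+\{a+2s_\varepsilon\}$. For $k\in\mathbb Z$ put $w_k=\exp(p(k-2))-1$. For $n\ge 0$ and $k\ge2$ with $k\equiv k_\varepsilon\bmod (p-1)$, put $$m_n^{(\varepsilon)}(k)=\begin{cases}\min\{n-d_k^{\mathrm{ur}}(\varepsilon_1),\ d_k^{\mathrm{Iw}}(\tilde\varepsilon_1)-d_k^{\mathrm{ur}}(\varepsilon_1)-n\}&\text{if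 } d_k^{\mathrm{ur}}(\varepsilon_1)<n<d_k^{\mathrm{Iw}}(\tilde\varepsilon_1)-d_k^{\mathrm{ur}}(\varepsilon_1),\\0&\text{otherwise,}\end{cases}$$ $$g_n^{(\varepsilon)}(w)=\prod_{k\ge2,\ k\equiv k_\varepsilon\,(p-1)}(w-w_k)^{m_n^{(\varepsilon)}(k)},\qquad G^{(\varepsilon)}(w,t)=\sum_{n\ge0}g_n^{(\varepsilon)}(w)t^n,\qquad g_{n,\hat k}^{(\varepsilon)}(w)=\frac{g_n^{(\varepsilon)}(w)}{(w-w_k)^{m_n^{(\varepsilon)}(k)}}$$ (the ghost series; $g_0^{(\varepsilon)}=1$). For a power series $F=\sum f_nt^n$, $\mathrm{NP}(F)$ denotes its Newton polygon, i.e. the lower convex hull of the points $(n,v_p(f_n))$ with $f_n\neq0$, and its $n$th slope ($n\ge1$) is its slope over $[n-1,n]$. **Proposition.** Let $k_0\ge2$ and write $d=d_{k_0}^{\mathrm{Iw}}(\varepsilon\cdot(1\times\omega^{2-k_0}))$. 1. (Theta maps.) Let $\varepsilon'=\varepsilon\cdot(\omega^{k_0-1}\times\omega^{1-k_0})$, so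 that $s_{\varepsilon'}=\{s_\varepsilon+1-k_0\}$. For every $\ell\ge1$, the $(d+\ell)$th slope of $\mathrm{NP}(G^{(\varepsilon)}(w_{k_0},-))$ is $k_0-1$ plus the $\ell$th slope of $\mathrm{NP}(G^{(\varepsilon')}(w_{2-k_0},-))$. In particular, the $(d+\ell)$th slope of $\mathrm{NP}(G^{(\varepsilon)}(w_{k_0},-))$ is at least $k_0-1$. 2. (Atkin–Lehner.) Assume $k_0\not\equiv k_\varepsilon\bmod(p-1)$, and let $\varepsilon''=\omega^{-s_{\varepsilon''}}\times\omega^{a+s_{\varepsilon''}}$ with $s_{\varepsilon''}=\{k_0-2-a-s_\varepsilon\}$. For every $\ell\in\{1,\dots,d\}$, the sum of the $\ell$th slope of $\mathrm{NP}(G^{(\varepsilon)}(w_{k_0},-))$ and the $(d-\ell+1)$th slope of $\mathrm{NP}(G^{(\varepsilon'')}(w_{k_0},-))$ is exactly $k_0-1$. In particular, the $\ell$th slope of $\mathrm{NP}(G^{(\varepsilon)}(w_{k_0},-))$ is at most $k_0-1$. 3. ($p$-stabilization.) Assume $k_0\equiv k_\varepsilon\bmod(p-1)$. For every $\ell\in\{1,\dots,d_{k_0}^{\mathrm{ur}}(\varepsilon_1)\}$,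 the sum of the $\ell$th and the $(d-\ell+1)$th slopes of $\mathrm{NP}(G^{(\varepsilon)}(w_{k_0},-))$ is exactly $k_0-1$. In particular, the $\ell$th slope of $\mathrm{NP}(G^{(\varepsilon)}(w_{k_0},-))$ is at most $k_0-1$. 4. (Ghost duality.) Assume $k_0\equiv k_\varepsilon\bmod(p-1)$ and write $d^{\mathrm{ur}},d^{\mathrm{Iw}},d^{\mathrm{new}}$ for $d_{k_0}^{\mathrm{ur}}(\varepsilon_1),d_{k_0}^{\mathrm{Iw}}(\tilde\varepsilon_1),d_{k_0}^{\mathrm{new}}(\varepsilon_1)$. For each $\ell=0,\dots,\tfrac12d^{\mathrm{new}}-1$, both $g^{(\varepsilon)}_{d^{\mathrm{Iw}}-d^{\mathrm{ur}}-\ell,\hat k_0}(w_{k_0})$ and $g^{(\varepsilon)}_{d^{\mathrm{ur}}+\ell,\hat k_0}(w_{k_0})$ are nonzero, and $$v_p\big(g^{(\varepsilon)}_{d^{\mathrm{Iw}}-d^{\mathrm{ur}}-\ell,\hat k_0}(w_{k_0})\big)-v_p\big(g^{(\varepsilon)}_{d^{\mathrm{ur}}+\ell,\hat k_0}(w_{k_0})\big)=(k_0-2)\cdot\big(\tfrac12d^{\mathrm{new}}-\ell\big).$$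 In particular, the $(d^{\mathrm{ur}}+1)$th to the $(d^{\mathrm{Iw}}-d^{\mathrm{ur}})$th slopes of $\mathrm{NP}(G^{(\varepsilon)}(w_{k_0},-))$ are all equal to $\frac{k_0-2}2$. -/

import Mathlib

open Polynomial

noncomputable section

namespace Ghost

/-! ### The Iwasawa algebra of `GL₂(ℤ_p)` -/

section Iwasawa

variable (p : ℕ) [Fact p.Prime] (O : Type*) [CommRing O]

/-- The transition map `O[GL₂(ℤ/pⁿ)] → O[GL₂(ℤ/pᵐ)]` for `m ≤ n`. -/
def transition {m n : ℕ} (h : m ≤ n) :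
    MonoidAlgebra O (GL (Fin 2) (ZMod (p ^ n))) →ₐ[O]
      MonoidAlgebra O (GL (Fin 2) (ZMod (p ^ m))) :=
  MonoidAlgebra.mapDomainAlgHom O O
    (Matrix.GeneralLinearGroup.map (ZMod.castHom (pow_dvd_pow p h) (ZMod (p ^ m))))

/-- The Iwasawa algebra `O⟦K_p⟧` of `K_p = GL₂(ℤ_p)`, i.e. the projective limit of the group rings
`O[K_p / (1 + pⁿ M₂(ℤ_p))] = O[GL₂(ℤ/pⁿ)]`, as compatible families. -/
def IwasawaAlgebra :
    Subalgebra O (∀ n : ℕ, MonoidAlgebra O (GL (Fin 2) (ZMod (p ^ n)))) where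
  carrier := {x | ∀ (m n : ℕ) (h : m ≤ n), transition p O h (x n) = x m}
  mul_mem' hx hy m n h := by simp only [Pi.mul_apply, map_mul, hx m n h, hy m n h]
  add_mem' hx hy m n h := by simp only [Pi.add_apply, map_add, hx m n h, hy m n h]
  algebraMap_mem' r m n h := by
    simp only [Pi.algebraMap_apply]
    exact (transition p O h).commutes r

variable {p} in
/-- The group element `[g] ∈ O⟦K_p⟧` attached to `g ∈ K_p = GL₂(ℤ_p)`. -/
def groupElem (g : GL (Fin 2) ℤ_[p]) : IwasawaAlgebra p O :=
  ⟨fun n => MonoidAlgebra.single (Matrix.GeneralLinearGroup.map (PadicInt.toZModPow n) g) 1, by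
    intro m n h
    have key : Matrix.GeneralLinearGroup.map (ZMod.castHom (pow_dvd_pow p h) (ZMod (p ^ m)))
        (Matrix.GeneralLinearGroup.map (PadicInt.toZModPow n) g)
        = Matrix.GeneralLinearGroup.map (PadicInt.toZModPow m) g := by
      rw [← PadicInt.zmod_cast_comp_toZModPow m n h]; rfl
    simp only [transition, MonoidAlgebra.mapDomainAlgHom_apply, MonoidAlgebra.mapDomain_single]
    rw [key]⟩

variable {p O} in
/-- `x ∈ O⟦K_p⟧` lies in the kernel of `O⟦K_p⟧ → (O/pⁿ)[GL₂(ℤ/pⁿ)]`. These kernels form a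
neighbourhood basis of zero of the profinite topology of `O⟦K_p⟧`. -/
def InLevel (n : ℕ) (x : IwasawaAlgebra p O) : Prop :=
  ∀ g : GL (Fin 2) (ZMod (p ^ n)), (p : O) ^ n ∣ (x.1 n).coeff g

variable {p O} in
theorem InLevel.mono {m n : ℕ} (h : m ≤ n) {x : IwasawaAlgebra p O} (hx : InLevel n x) :
    InLevel m x := by
  intro g
  rw [← x.2 m n h]
  change (p : O) ^ m ∣ (Finsupp.mapDomain _ (x.1 n).coeff) g
  rw [Finsupp.mapDomain, Finsupp.sum_apply]
  refine Finset.dvd_sum fun i _ => ?_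
  dsimp only
  classical rw [Finsupp.single_apply]
  split_ifs
  · exact (pow_dvd_pow _ h).trans (hx i)
  · exact dvd_zero _

/-- The reduction map `O⟦K_p⟧ → 𝔽[GL₂(𝔽_p)]`, with `𝔽` the residue field of `O`. Its kernel is
the ideal generated by the maximal ideal of `O` and by the augmentation ideal of
`O⟦1 + p M₂(ℤ_p)⟧`. -/
def reduction [IsLocalRing O] :
    IwasawaAlgebra p O →+*
      MonoidAlgebra (IsLocalRing.ResidueField O) (GL (Fin 2) (ZMod p)) :=
  (MonoidAlgebra.mapRingHom _ (IsLocalRing.residue O)).comp <|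
    (MonoidAlgebra.mapDomainRingHom O (Matrix.GeneralLinearGroup.map
      (ZMod.castHom (dvd_of_eq (pow_one p).symm) (ZMod p)))).comp <|
    (Pi.evalRingHom (fun n : ℕ => MonoidAlgebra O (GL (Fin 2) (ZMod (p ^ n)))) 1).comp
      (IwasawaAlgebra p O).val.toRingHom

end Iwasawa

/-! ### Symmetric powers and Serre weights -/

section Sym

variable {R : Type*} [CommRing R]

/-- The right action of a matrix on polynomials in two variables,
`h|_(α β; γ δ) (X, Y) = h(α X + β Y, γ X + δ Y)`. On homogeneous polynomials of degree `n`, and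
with `Xⁱ Yⁿ⁻ⁱ` identified with `zⁱ`, this is `f|(z) = (γ z + δ)ⁿ f((α z + β) / (γ z + δ))`. -/
def symAct (M : Matrix (Fin 2) (Fin 2) R) :
    MvPolynomial (Fin 2) R →ₐ[R] MvPolynomial (Fin 2) R :=
  MvPolynomial.aeval fun i => ∑ j, MvPolynomial.C (M i j) * MvPolynomial.X j

theorem symAct_one : symAct (1 : Matrix (Fin 2) (Fin 2) R) = AlgHom.id R _ := by
  ext i : 1
  fin_cases i <;> simp [symAct]

theorem symAct_mul (M N : Matrix (Fin 2) (Fin 2) R) :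
    symAct (M * N) = (symAct N).comp (symAct M) := by
  ext i : 1
  simp only [symAct, MvPolynomial.aeval_X, AlgHom.comp_apply, map_mul,
    MvPolynomial.algHom_C, Matrix.mul_apply, Fin.sum_univ_two, MvPolynomial.algebraMap_eq, map_add]
  ring

theorem symAct_isHomogeneous (M : Matrix (Fin 2) (Fin 2) R) {n : ℕ} {f : MvPolynomial (Fin 2) R}
    (hf : f.IsHomogeneous n) : (symAct M f).IsHomogeneous n := by
  have h := hf.aeval (φ := f) (n := 1)
    (fun i => ∑ j, MvPolynomial.C (M i j) * MvPolynomial.X j) (fun i => by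
      refine MvPolynomial.IsHomogeneous.sum _ _ _ fun j _ => ?_
      simpa using (MvPolynomial.isHomogeneous_C (Fin 2) (M i j)).mul
        (MvPolynomial.isHomogeneous_X R j))
  simpa [symAct] using h

end Sym

section SerreWeight

variable (p : ℕ) [Fact p.Prime] (F : Type*) [Field F] [CharP F p]

/-- The space underlying `σ_{a,b} = Sym^a F² ⊗ det^b`: homogeneous polynomials of degree `a`. -/
def SerreWeight (_p : ℕ) (F : Type*) [Field F] (a _b : ℕ) : Type _ :=
  MvPolynomial.homogeneousSubmodule (Fin 2) F a

instance (a b : ℕ) : AddCommGroup (SerreWeight p F a b) :=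
  inferInstanceAs (AddCommGroup (MvPolynomial.homogeneousSubmodule (Fin 2) F a))

instance (a b : ℕ) : Module F (SerreWeight p F a b) :=
  inferInstanceAs (Module F (MvPolynomial.homogeneousSubmodule (Fin 2) F a))

variable {p} in
/-- The matrix over `F` of an element of `GL₂(𝔽_p)`. -/
def toMat (g : GL (Fin 2) (ZMod p)) : Matrix (Fin 2) (Fin 2) F :=
  (ZMod.castHom (dvd_refl p) F).mapMatrix g.1

/-- The right action of `g ∈ GL₂(𝔽_p)` on `σ_{a,b}`, `h ↦ det(g)^b · h|_g`. -/
def serreAct (a b : ℕ) (g : GL (Fin 2) (ZMod p)) : Module.End F (SerreWeight p F a b) :=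
  (toMat F g).det ^ b •
    ((symAct (toMat F g)).toLinearMap.restrict
      (p := MvPolynomial.homogeneousSubmodule (Fin 2) F a)
      (q := MvPolynomial.homogeneousSubmodule (Fin 2) F a)
      fun _ hf => symAct_isHomogeneous _ hf)

theorem serreAct_one (a b : ℕ) : serreAct p F a b 1 = 1 := by
  apply LinearMap.ext
  intro f
  apply Subtype.ext
  simp [serreAct, toMat, symAct_one]
  rfl

theorem serreAct_mul (a b : ℕ) (g h : GL (Fin 2) (ZMod p)) :
    serreAct p F a b (g * h) = serreAct p F a b h * serreAct p F a b g := by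
  have hm : toMat F (g * h) = toMat F g * toMat F h := by
    simp only [toMat, Units.val_mul, map_mul]
  apply LinearMap.ext
  intro f
  apply Subtype.ext
  change (toMat F (g * h)).det ^ b • symAct (toMat F (g * h)) f.1
    = (toMat F h).det ^ b • symAct (toMat F h) ((toMat F g).det ^ b • symAct (toMat F g) f.1)
  rw [hm, symAct_mul, Matrix.det_mul, map_smul, smul_smul, mul_pow, mul_comm]
  rfl

/-- The right `F[GL₂(𝔽_p)]`-module structure of the Serre weight `σ_{a,b}`. -/
instance (a b : ℕ) :
    Module (MonoidAlgebra F (GL (Fin 2) (ZMod p)))ᵐᵒᵖ (SerreWeight p F a b) :=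
  Module.compHom _ <|
    (RingEquiv.opOp (Module.End F (SerreWeight p F a b))).symm.toRingHom.comp <|
      RingHom.op (MonoidAlgebra.lift F (Module.End F (SerreWeight p F a b))ᵐᵒᵖ
        (GL (Fin 2) (ZMod p))
        { toFun := fun g => MulOpposite.op (serreAct p F a b g)
          map_one' := by rw [serreAct_one]; rfl
          map_mul' := fun g h => by rw [serreAct_mul]; rfl }).toRingHom

theorem op_single_smul (a b : ℕ) (g : GL (Fin 2) (ZMod p)) (c : F) (v : SerreWeight p F a b) :
    MulOpposite.op (MonoidAlgebra.single g c) • v = c • serreAct p F a b g v := by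
  change (MonoidAlgebra.lift F (Module.End F (SerreWeight p F a b))ᵐᵒᵖ (GL (Fin 2) (ZMod p)) _
    (MonoidAlgebra.single g c)).unop v = _
  rw [MonoidAlgebra.lift_single]
  rfl

end SerreWeight

/-- `P` is a projective envelope of the `R`-module `S`: it is projective, and it has a surjection
onto `S` such that no proper submodule of `P` maps onto `S`. -/
def IsProjectiveEnvelope (R P S : Type*) [Ring R] [AddCommGroup P] [Module R P]
    [AddCommGroup S] [Module R S] : Prop :=
  Module.Projective R P ∧ ∃ π : P →ₗ[R] S, Function.Surjective π ∧
    ∀ N : Submodule R P, N.map π = ⊤ → N = ⊤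

section Local

variable (p : ℕ) [Fact p.Prime] (O : Type*) [CommRing O] [IsLocalRing O]
  [Algebra ℤ_[p] O] [Module.Finite ℤ_[p] O] [FaithfulSMul ℤ_[p] O]

theorem residue_charP : CharP (IsLocalRing.ResidueField O) p := by
  have hp : Nat.Prime p := Fact.out
  have h0 : ((p : ℕ) : IsLocalRing.ResidueField O) = 0 := by
    have h1 : ¬ IsUnit (algebraMap ℤ_[p] O (p : ℤ_[p])) := fun h =>
      PadicInt.p_nonunit (isUnit_of_map_unit (algebraMap ℤ_[p] O) _ h)
    rw [map_natCast] at h1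
    rw [← map_natCast (IsLocalRing.residue O) p, IsLocalRing.residue_eq_zero_iff]
    exact h1
  have h2 : ringChar (IsLocalRing.ResidueField O) = p :=
    CharP.ringChar_of_prime_eq_zero hp h0
  rw [← h2]
  exact ringChar.charP _

variable (H : Type*) [AddCommGroup H] [Module (IwasawaAlgebra p O)ᵐᵒᵖ H]

/-- The submodule `H · (ϖ, I_{1 + p M₂(ℤ_p)})` of the right `O⟦K_p⟧`-module `H`. -/
def augSubmodule : Submodule (IwasawaAlgebra p O)ᵐᵒᵖ H :=
  Submodule.span _ {y | ∃ x : IwasawaAlgebra p O, reduction p O x = 0 ∧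
    ∃ h : H, y = MulOpposite.op x • h}

/-- The quotient `H̄ = H / H · (ϖ, I_{1 + p M₂(ℤ_p)})`, as a right `𝔽[GL₂(𝔽_p)]`-module, is
isomorphic to the projective envelope `Proj_{a,0}` of the Serre weight `σ_{a,0}`: there is a
projective envelope `P` of `σ_{a,0}` and a surjection `H → P`, semilinear with respect to
`O⟦K_p⟧ → 𝔽[GL₂(𝔽_p)]`, whose kernel is `H · (ϖ, I_{1 + p M₂(ℤ_p)})`. -/
def IsPrimitiveOfType.{u} (H : Type u) [AddCommGroup H] [Module (IwasawaAlgebra p O)ᵐᵒᵖ H]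
    (a : ℕ) : Prop :=
  haveI := residue_charP p O
  ∃ (P : Type u) (_ : AddCommGroup P)
    (_ : Module (MonoidAlgebra (IsLocalRing.ResidueField O) (GL (Fin 2) (ZMod p)))ᵐᵒᵖ P),
    IsProjectiveEnvelope
      (MonoidAlgebra (IsLocalRing.ResidueField O) (GL (Fin 2) (ZMod p)))ᵐᵒᵖ P
      (SerreWeight p (IsLocalRing.ResidueField O) a 0) ∧
    ∃ q : H →ₛₗ[RingHom.op (reduction p O)] P,
      Function.Surjective q ∧ LinearMap.ker q = augSubmodule p O H

end Local

/-! ### Characters and abstract classical forms -/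

section Forms

variable (p : ℕ) [Fact p.Prime] (O : Type*) [CommRing O] [Algebra ℤ_[p] O]

/-- The `m`-th power `ω^m` of the Teichmüller character `ω : 𝔽_pˣ → ℤ_pˣ`, with values in `Oˣ`. -/
def omega (m : ℤ) : (ZMod p)ˣ →* Oˣ :=
  ((Units.map (algebraMap ℤ_[p] O : ℤ_[p] →* O)).comp
    (Units.map ((WittVector.equiv p : WittVector p (ZMod p) →* ℤ_[p]).comp
      (WittVector.teichmuller p)))) ^ m

/-- The character `χ₁ × χ₂` of `Δ² = 𝔽_pˣ × 𝔽_pˣ`. -/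
abbrev prodChar {p : ℕ} {O : Type*} [CommRing O] (χ₁ χ₂ : (ZMod p)ˣ →* Oˣ) :
    (ZMod p)ˣ × (ZMod p)ˣ →* Oˣ :=
  χ₁.coprod χ₂

variable {p O}

/-- The matrix over `O` of an element of `K_p = GL₂(ℤ_p)`. -/
def toMatO (O : Type*) [CommRing O] [Algebra ℤ_[p] O] (g : GL (Fin 2) ℤ_[p]) :
    Matrix (Fin 2) (Fin 2) O :=
  (algebraMap ℤ_[p] O).mapMatrix g.1

variable (O) (H : Type*) [AddCommGroup H] [Module O H] [Module (IwasawaAlgebra p O)ᵐᵒᵖ H]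

/-- Continuity of an `O`-linear map from `H`, with its canonical topology as a finitely generated
`O⟦K_p⟧`-module (a neighbourhood basis of zero is given by the `H · J` with `J` in the neighbourhood
basis `InLevel n` of ideals of `O⟦K_p⟧`), to polynomials of bounded degree, with the `p`-adic
topology. -/
def IsContinuousForm (φ : H →ₗ[O] MvPolynomial (Fin 2) O) : Prop :=
  ∀ m : ℕ, ∃ n : ℕ, ∀ x : IwasawaAlgebra p O, InLevel n x → ∀ h : H,
    ∀ e, (p : O) ^ m ∣ MvPolynomial.coeff e (φ (MulOpposite.op x • h))

/-- Continuous `O`-linear maps `H → O[z]^{≤ k-2}` (homogeneous polynomials of degree `k - 2`). -/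
def contForms (k : ℕ) : Submodule O (H →ₗ[O] MvPolynomial (Fin 2) O) where
  carrier := {φ | (∀ h, (φ h).IsHomogeneous (k - 2)) ∧ IsContinuousForm (p := p) O H φ}
  add_mem' := by
    rintro φ φ' ⟨h1, h2⟩ ⟨h1', h2'⟩
    refine ⟨fun h => (h1 h).add (h1' h), fun m => ?_⟩
    obtain ⟨n, hn⟩ := h2 m
    obtain ⟨n', hn'⟩ := h2' m
    refine ⟨max n n', fun x hx h e => ?_⟩
    simp only [LinearMap.add_apply, MvPolynomial.coeff_add]
    exact dvd_add (hn x (hx.mono (le_max_left n n')) h e)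
      (hn' x (hx.mono (le_max_right n n')) h e)
  zero_mem' := ⟨fun _ => MvPolynomial.isHomogeneous_zero _ _ _, fun _ => ⟨0, by simp⟩⟩
  smul_mem' := by
    rintro c φ ⟨h1, h2⟩
    refine ⟨fun h => ?_, fun m => ?_⟩
    · exact (MvPolynomial.homogeneousSubmodule (Fin 2) O (k - 2)).smul_mem c (h1 h)
    · obtain ⟨n, hn⟩ := h2 m
      refine ⟨n, fun x hx h e => ?_⟩
      simpa using (hn x hx h e).mul_left c

/-- Abstract classical forms `S_k^Iw(ψ) = Hom_{O[Iw_p]}(H, O[z]^{≤ k-2} ⊗ ψ)` of weight `k` and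
character `ψ`: here `Iw_p` consists of the `g = (α β; γ δ) ∈ K_p` with `p ∣ γ`, and
`ψ(g) = ψ(ᾱ, δ̄)`. -/
def formsIw (k : ℕ) (ψ : (ZMod p)ˣ × (ZMod p)ˣ →* Oˣ) :
    Submodule O (H →ₗ[O] MvPolynomial (Fin 2) O) where
  carrier := {φ | φ ∈ contForms (p := p) O H k ∧
    ∀ g : GL (Fin 2) ℤ_[p], (p : ℤ_[p]) ∣ g 1 0 →
    ∀ u v : (ZMod p)ˣ, (u : ZMod p) = PadicInt.toZMod (g 0 0) →
      (v : ZMod p) = PadicInt.toZMod (g 1 1) →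
    ∀ h : H, φ (MulOpposite.op (groupElem O g) • h)
      = (ψ (u, v) : O) • symAct (toMatO O g) (φ h)}
  add_mem' := by
    rintro φ φ' ⟨h1, h2⟩ ⟨h1', h2'⟩
    refine ⟨add_mem h1 h1', fun g hg u v hu hv h => ?_⟩
    simp only [LinearMap.add_apply, map_add, smul_add, h2 g hg u v hu hv, h2' g hg u v hu hv]
  zero_mem' := ⟨zero_mem _, by simp⟩
  smul_mem' := by
    rintro c φ ⟨h1, h2⟩
    refine ⟨Submodule.smul_mem _ c h1, fun g hg u v hu hv h => ?_⟩
    simp only [LinearMap.smul_apply, map_smul, h2 g hg u v hu hv]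
    rw [smul_comm]

/-- Abstract classical forms with full level structure,
`S_k^ur(η) = Hom_{O[K_p]}(H, O[z]^{≤ k-2} ⊗ η ∘ det)`. -/
def formsUr (k : ℕ) (η : (ZMod p)ˣ →* Oˣ) :
    Submodule O (H →ₗ[O] MvPolynomial (Fin 2) O) where
  carrier := {φ | φ ∈ contForms (p := p) O H k ∧
    ∀ g : GL (Fin 2) ℤ_[p], ∀ h : H, φ (MulOpposite.op (groupElem O g) • h)
      = (η (Units.map (PadicInt.toZMod (p := p) : ℤ_[p] →* ZMod p)
          (Matrix.GeneralLinearGroup.det g)) : O) • symAct (toMatO O g) (φ h)}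
  add_mem' := by
    rintro φ φ' ⟨h1, h2⟩ ⟨h1', h2'⟩
    refine ⟨add_mem h1 h1', fun g h => ?_⟩
    simp only [LinearMap.add_apply, map_add, smul_add, h2 g, h2' g]
  zero_mem' := ⟨zero_mem _, by simp⟩
  smul_mem' := by
    rintro c φ ⟨h1, h2⟩
    refine ⟨Submodule.smul_mem _ c h1, fun g h => ?_⟩
    simp only [LinearMap.smul_apply, map_smul, h2 g]
    rw [smul_comm]

/-- `d_k^Iw(ψ)`, the rank of `S_k^Iw(ψ)`. -/
def dIw (k : ℕ) (ψ : (ZMod p)ˣ × (ZMod p)ˣ →* Oˣ) : ℕ :=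
  Module.finrank O (formsIw O H k ψ)

/-- `d_k^ur(η)`, the rank of `S_k^ur(η)`. -/
def dUr (k : ℕ) (η : (ZMod p)ˣ →* Oˣ) : ℕ :=
  Module.finrank O (formsUr O H k η)

/-- `d_k^new(η) = d_k^Iw(η × η) - 2 d_k^ur(η)`. -/
def dNew (k : ℕ) (η : (ZMod p)ˣ →* Oˣ) : ℤ :=
  (dIw O H k (prodChar η η) : ℤ) - 2 * dUr O H k η

end Forms

/-! ### The ghost series -/

section Series

variable (p : ℕ) [Fact p.Prime]

/-- The weight point `w_k = exp(p (k - 2)) - 1`. -/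
def weightPoint (k : ℤ) : ℚ_[p] :=
  NormedSpace.exp ((p : ℚ_[p]) * ((k : ℚ_[p]) - 2)) - 1

/-- The residue `{m} ∈ {0, …, p - 2}` of `m` modulo `p - 1`. -/
def res (m : ℤ) : ℤ := m % ((p : ℤ) - 1)

/-- `k_ε = 2 + {a + 2 s}` for `ε = ω^{-s} × ω^{a+s}`. -/
def kEps (a s : ℤ) : ℤ := 2 + res p (a + 2 * s)

variable (O : Type*) [CommRing O] [Algebra ℤ_[p] O]
  (H : Type*) [AddCommGroup H] [Module O H] [Module (IwasawaAlgebra p O)ᵐᵒᵖ H]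

/-- The ghost multiplicity `m_n^{(ε)}(k)` for `ε = ω^{-s} × ω^{a+s}`. It depends on `ε` only through
`ε₁ = ω^{-s}`. -/
def ghostMult (s : ℤ) (n k : ℕ) : ℕ :=
  let du := dUr O H k (omega p O (-s))
  let di := dIw O H k (prodChar (omega p O (-s)) (omega p O (-s)))
  if du < n ∧ n < di - du then min (n - du) (di - du - n) else 0

/-- The coefficient `g_n^{(ε)}(w) = ∏ (w - w_k)^{m_n^{(ε)}(k)}` of the ghost series, the product
being over the `k ≥ 2` with `k ≡ k_ε mod (p - 1)`. -/
def ghostCoeff (a s : ℤ) (n : ℕ) : ℚ_[p][X] :=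
  ∏ᶠ (k : ℕ) (_ : 2 ≤ k ∧ (k : ℤ) ≡ kEps p a s [ZMOD ((p : ℤ) - 1)]),
    (X - C (weightPoint p k)) ^ ghostMult p O H s n k

/-- `g_{n,k̂}^{(ε)}(w) = g_n^{(ε)}(w) / (w - w_k)^{m_n^{(ε)}(k)}`. -/
def ghostCoeffHat (a s : ℤ) (n k : ℕ) : ℚ_[p][X] :=
  ghostCoeff p O H a s n /ₘ (X - C (weightPoint p k)) ^ ghostMult p O H s n k

/-- The specialization `G^{(ε)}(w⋆, t) = ∑ g_n^{(ε)}(w⋆) tⁿ` of the ghost series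
(note that `g_0^{(ε)} = 1`). -/
def ghostSeries (a s : ℤ) (w : ℚ_[p]) : PowerSeries ℚ_[p] :=
  PowerSeries.mk fun n => (ghostCoeff p O H a s n).eval w

variable {p}

/-- The points `(n, v_p(f_n))` with `f_n ≠ 0` attached to `F = ∑ f_n tⁿ`. -/
def newtonPoints (F : PowerSeries ℚ_[p]) : Set (ℝ × ℝ) :=
  {P | ∃ n : ℕ, PowerSeries.coeff n F ≠ 0 ∧ P = ((n : ℝ), ((PowerSeries.coeff n F).valuation : ℝ))}

/-- The Newton polygon of `F`, as the function whose graph is the lower boundary of the convex hull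
of the points `(n, v_p(f_n))`. -/
def newtonPolygon (F : PowerSeries ℚ_[p]) (x : ℝ) : ℝ :=
  sInf {y : ℝ | (x, y) ∈ convexHull ℝ (newtonPoints F)}

/-- The `n`-th slope (`n ≥ 1`) of the Newton polygon of `F`, i.e. its slope over `[n - 1, n]`. -/
def newtonSlope (F : PowerSeries ℚ_[p]) (n : ℕ) : ℝ :=
  newtonPolygon F n - newtonPolygon F ((n : ℝ) - 1)

/-- The `n`-th slope of `NP(G^{(ε)}(w_k, -))` for `ε = ω^{-s} × ω^{a+s}`. -/
def ghostSlope (p : ℕ) [Fact p.Prime] (O : Type*) [CommRing O] [Algebra ℤ_[p] O]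
    (H : Type*) [AddCommGroup H] [Module O H] [Module (IwasawaAlgebra p O)ᵐᵒᵖ H]
    (a s : ℤ) (k : ℤ) (n : ℕ) : ℝ :=
  newtonSlope (ghostSeries p O H a s (weightPoint p k)) n

end Series

end Ghost

end

/-!
The theorem is reduced to elementary combinatorics of the exponents in the power basis of the
spaces of forms, and then to convex geometry in the plane.

*Ranks.* Since `H` is projective over `O⟦K_p⟧`, equivariant maps modulo the maximal ideal lift, by
integration against the elements of `O⟦K_p⟧`. The rank of a space of forms is therefore the
dimension of a space of equivariant maps from the projective envelope of `Sym^a` over the residue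
field (`finrank_charForms`), and such dimensions are additive in exact sequences
(`finrank_homSpace_add`). Division by the Dickson invariant, Frobenius reciprocity for principal
series and the filtration of `Symⁿ` by monomials over the Borel subgroup reduce everything to the
multiplicities in irreducible representations. With `N = k - 2`, the rank at Iwahori level is the
number of *degrees* `0 ≤ i ≤ N`, that is, of `i` congruent to `s` or `a + s` modulo `p - 1`; the
rank at level `K_p` is the number of degrees whose *threshold*, an explicit number of size about
`(p + 1) i`, is at most `N` (`IsPrimitiveOfType.finrank_forms`).

*Valuations.* One has `v_p(w_k - w_l) = 1 + v_p(k - l)` (`valuation_weightPoint_sub`), so that the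
valuation of a ghost coefficient at a weight is a weighted sum of multiplicities. The increment from
`n` to `n + 1` of the multiplicity at a given weight is a combination of three indicator functions
of the `n`-th degree (`intMult_succ_sub`). Theta maps shift the degrees by `N + 1`, and
Atkin-Lehner involutions reflect them by `i ↦ N - i`. Under either operation two increments combine
into a step function `f(x) - f(p x)` of the difference `x` of the weights (`multStep_sub_shift`,
`multStep_add_reflect`). Its weighted sum involves no valuations any more: a point `V` contributes
`1 + v_p(V)` through `f(x)` and `v_p(V)` through `f(p x)`, so the sum just counts points
(`weightedSum_steps`). There are `N + 1` of them, except that the point `0` has to be left out when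
it occurs. The resulting relations between the points of the Newton polygons are `ghostVal_theta`,
`ghostVal_reflect`, `ghostVal_reflect_self` and `ghostVal_duality`.

*Newton polygons.* The relations between points give relations between slopes once the polygons are
known to have vertices, or at least supporting lines, at the ends of the ranges concerned. A line of
slope `N + 1` supports the points at the Iwahori rank (`le_ghostVal_degCount`), because the
increments before it are at most `N + 1` and those after it at least `N + 1`, in the mean. In the
congruence class of the weights of the ghost series, a line of slope `N / 2` passes through the two
ends of the range in which the coefficients vanish (ghost duality), and it supports the other points
because the increments before that range are at most `N / 2` (`two_mul_ghostVal_step_le`,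
`le_two_mul_ghostVal`). At points with a supporting line the polygon can be cut (`lowerHull_inter`),
and shears and reflections carry the pieces to each other (`lowerHull_image`).
-/

open Polynomial

noncomputable section

set_option linter.unusedSectionVars false

namespace Ghost

/-! ### Binary forms and one-variable polynomials -/

section Dehomogenization

variable {R : Type*} [CommRing R]

/-- Dehomogenization `h(X, Y) ↦ h(z, 1)` of polynomials in two variables. -/
def dehom : MvPolynomial (Fin 2) R →ₐ[R] R[X] := MvPolynomial.aeval ![X, 1]

/-- Homogenization in degree `n`: `∑ uᵢ zⁱ ↦ ∑_{i ≤ n} uᵢ Xⁱ Yⁿ⁻ⁱ`. -/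
def homog (n : ℕ) : R[X] →ₗ[R] MvPolynomial (Fin 2) R :=
  ∑ i ∈ Finset.range (n + 1),
    (LinearMap.toSpanSingleton R _ (MvPolynomial.X 0 ^ i * MvPolynomial.X 1 ^ (n - i))).comp
      (Polynomial.lcoeff R i)

theorem homog_apply (n : ℕ) (u : R[X]) :
    homog n u = ∑ i ∈ Finset.range (n + 1),
      u.coeff i • (MvPolynomial.X 0 ^ i * MvPolynomial.X 1 ^ (n - i)) := by
  simp [homog, LinearMap.sum_apply]

theorem homog_isHomogeneous (n : ℕ) (u : R[X]) : (homog n u).IsHomogeneous n := by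
  rw [homog_apply]
  refine MvPolynomial.IsHomogeneous.sum _ _ _ fun i hi => ?_
  have h : i + (n - i) = n := by have := Finset.mem_range.1 hi; omega
  have h2 : (MvPolynomial.X 0 ^ i * MvPolynomial.X 1 ^ (n - i) :
      MvPolynomial (Fin 2) R).IsHomogeneous n := by
    have := ((MvPolynomial.isHomogeneous_X R (0 : Fin 2)).pow i).mul
      ((MvPolynomial.isHomogeneous_X R (1 : Fin 2)).pow (n - i))
    simpa [h] using this
  exact (MvPolynomial.homogeneousSubmodule (Fin 2) R n).smul_mem _ h2

theorem dehom_X_zero : dehom (MvPolynomial.X 0 : MvPolynomial (Fin 2) R) = X := by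
  simp [dehom]

theorem dehom_X_one : dehom (MvPolynomial.X 1 : MvPolynomial (Fin 2) R) = 1 := by
  simp [dehom]

theorem dehom_homog {n : ℕ} {u : R[X]} (hu : u.natDegree ≤ n) : dehom (homog n u) = u := by
  rw [homog_apply, map_sum]
  conv_rhs => rw [u.as_sum_range_C_mul_X_pow' (Nat.lt_succ_of_le hu)]
  refine Finset.sum_congr rfl fun i _ => ?_
  rw [map_smul, map_mul, map_pow, map_pow, dehom_X_zero, dehom_X_one, one_pow, mul_one,
    Polynomial.smul_eq_C_mul]

theorem dehom_monomial (d : Fin 2 →₀ ℕ) (c : R) :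
    dehom (MvPolynomial.monomial d c) = C c * X ^ d 0 := by
  rw [MvPolynomial.monomial_eq, Finsupp.prod_fintype _ _ (by simp), Fin.prod_univ_two, map_mul,
    map_mul, map_pow, map_pow, dehom_X_zero, dehom_X_one, one_pow, mul_one]
  simp [dehom]

theorem homog_dehom {n : ℕ} {h : MvPolynomial (Fin 2) R} (hh : h.IsHomogeneous n) :
    homog n (dehom h) = h := by
  conv_lhs => rw [h.as_sum]
  conv_rhs => rw [h.as_sum]
  rw [map_sum, map_sum]
  refine Finset.sum_congr rfl fun d hd => ?_
  have hdeg : d 0 + d 1 = n := by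
    have := hh (MvPolynomial.mem_support_iff.1 hd)
    simpa [Finsupp.weight_apply, Finsupp.sum_fintype, Fin.sum_univ_two] using this
  rw [dehom_monomial, homog_apply, Finset.sum_eq_single (d 0)]
  · rw [Polynomial.coeff_C_mul_X_pow, if_pos rfl, MvPolynomial.monomial_eq,
      Finsupp.prod_fintype _ _ (by simp), Fin.prod_univ_two, MvPolynomial.smul_eq_C_mul,
      show n - d 0 = d 1 by omega]
  · intro i _ hi
    rw [Polynomial.coeff_C_mul_X_pow, if_neg hi, zero_smul]
  · intro hi
    exact absurd (Finset.mem_range.2 (by omega)) hi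

theorem natDegree_dehom_le {n : ℕ} {h : MvPolynomial (Fin 2) R} (hh : h.IsHomogeneous n) :
    (dehom h).natDegree ≤ n := by
  rw [h.as_sum, map_sum]
  refine Polynomial.natDegree_sum_le_of_forall_le _ _ fun d hd => ?_
  have hdeg : d 0 + d 1 = n := by
    have := hh (MvPolynomial.mem_support_iff.1 hd)
    simpa [Finsupp.weight_apply, Finsupp.sum_fintype, Fin.sum_univ_two] using this
  rw [dehom_monomial]
  exact (Polynomial.natDegree_C_mul_X_pow_le _ _).trans (by omega)

theorem eq_of_dehom_eq {n : ℕ} {h h' : MvPolynomial (Fin 2) R} (hh : h.IsHomogeneous n)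
    (hh' : h'.IsHomogeneous n) (e : dehom h = dehom h') : h = h' := by
  rw [← homog_dehom hh, e, homog_dehom hh']

/-- Binary forms of degree `n` correspond to polynomials of degree at most `n`. -/
def formsEquiv (n : ℕ) :
    MvPolynomial.homogeneousSubmodule (Fin 2) R n ≃ₗ[R] Polynomial.degreeLT R (n + 1) where
  toFun h := ⟨dehom h.1, Polynomial.mem_degreeLT.2 (by
    exact (Polynomial.degree_le_natDegree).trans_lt
      (by exact_mod_cast Nat.lt_succ_of_le (natDegree_dehom_le h.2)))⟩
  map_add' _ _ := by ext; simp
  map_smul' _ _ := by ext; simp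
  invFun u := ⟨homog n u.1, homog_isHomogeneous n u.1⟩
  left_inv h := Subtype.ext (homog_dehom h.2)
  right_inv u := Subtype.ext (dehom_homog (by
    have := Polynomial.mem_degreeLT.1 u.2
    by_cases h0 : u.1 = 0
    · simp [h0]
    · exact Nat.lt_succ_iff.1 ((Polynomial.natDegree_lt_iff_degree_lt h0).2
        (by exact_mod_cast this))))

instance (n : ℕ) : Module.Finite R (MvPolynomial.homogeneousSubmodule (Fin 2) R n) :=
  Module.Finite.equiv
    ((formsEquiv (R := R) n).trans (Polynomial.degreeLTEquiv R (n + 1))).symm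

theorem finrank_forms [Nontrivial R] (n : ℕ) :
    Module.finrank R (MvPolynomial.homogeneousSubmodule (Fin 2) R n) = n + 1 := by
  rw [((formsEquiv (R := R) n).trans (Polynomial.degreeLTEquiv R (n + 1))).finrank_eq]
  simp

theorem eval_one_eq_eval_dehom (h : MvPolynomial (Fin 2) R) (x : R) :
    MvPolynomial.eval ![x, 1] h = (dehom h).eval x := by
  have : (MvPolynomial.aeval (R := R) ![x, 1]) = (Polynomial.aeval x).comp dehom := by
    ext i
    fin_cases i <;> simp [dehom]
  have h2 := congrArg (fun f => f h) this
  simpa [MvPolynomial.aeval_eq_eval, Polynomial.coe_aeval_eq_eval] using h2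

theorem eval_homog (n : ℕ) (u : R[X]) (v : Fin 2 → R) :
    MvPolynomial.eval v (homog n u) =
      ∑ i ∈ Finset.range (n + 1), u.coeff i * (v 0 ^ i * v 1 ^ (n - i)) := by
  rw [homog_apply, map_sum]
  exact Finset.sum_congr rfl fun i _ => by simp [MvPolynomial.smul_eval]

theorem eval_homog_one_zero (n : ℕ) (u : R[X]) :
    MvPolynomial.eval ![1, 0] (homog n u) = u.coeff n := by
  rw [eval_homog, Finset.sum_eq_single n]
  · simp
  · intro i hi hn
    have : n - i ≠ 0 := by have := Finset.mem_range.1 hi; omega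
    simp [this]
  · simp

theorem eval_one_zero_eq_coeff {n : ℕ} {h : MvPolynomial (Fin 2) R} (hh : h.IsHomogeneous n) :
    MvPolynomial.eval ![1, 0] h = (dehom h).coeff n := by
  rw [← eval_homog_one_zero, homog_dehom hh]

theorem eval_smul_vec {n : ℕ} {h : MvPolynomial (Fin 2) R} (hh : h.IsHomogeneous n) (c : R)
    (v : Fin 2 → R) : MvPolynomial.eval (c • v) h = c ^ n * MvPolynomial.eval v h := by
  rw [← homog_dehom hh, eval_homog, eval_homog, Finset.mul_sum]
  refine Finset.sum_congr rfl fun i hi => ?_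
  have h : n = i + (n - i) := by have := Finset.mem_range.1 hi; omega
  simp only [Pi.smul_apply, smul_eq_mul, mul_pow]
  conv_rhs => rw [h, pow_add]
  rw [← h]
  ring

theorem eval_symAct (M : Matrix (Fin 2) (Fin 2) R) (h : MvPolynomial (Fin 2) R) (v : Fin 2 → R) :
    MvPolynomial.eval v (symAct M h) = MvPolynomial.eval (M.mulVec v) h := by
  have : (MvPolynomial.aeval (R := R) v).comp (symAct M) = MvPolynomial.aeval (M.mulVec v) := by
    ext i
    fin_cases i <;> simp [symAct, Fin.sum_univ_two]
  have h2 := congrArg (fun f => f h) this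
  simpa [MvPolynomial.aeval_eq_eval] using h2

end Dehomogenization

/-! ### Equivariant maps out of a projective module over a group ring -/

/-- A function `w` on a group that is equivariant for right translation by a subgroup `C` lifts
along a `C`-equivariant surjection to an equivariant function: lift it on coset representatives. -/
theorem exists_equivariant_lift {Γ : Type*} [Group Γ] (C : Subgroup Γ) {E E'' : Type*}
    (ρ : Γ → E → E) (ρ'' : Γ → E'' → E'') (f : E → E'') (X : Set E)
    (hX : ∀ c ∈ C, ∀ x ∈ X, ρ c x ∈ X)
    (hρ : ∀ c ∈ C, ∀ c' ∈ C, ∀ x ∈ X, ρ (c * c') x = ρ c' (ρ c x))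
    (hf : ∀ c ∈ C, ∀ x ∈ X, f (ρ c x) = ρ'' c (f x))
    (w : Γ → E'') (hw : ∀ γ, ∃ x ∈ X, f x = w γ) (hwc : ∀ γ, ∀ c ∈ C, w (γ * c) = ρ'' c (w γ)) :
    ∃ v : Γ → E, (∀ γ, v γ ∈ X) ∧ (∀ γ, f (v γ) = w γ) ∧
      ∀ γ, ∀ c ∈ C, v (γ * c) = ρ c (v γ) := by
  choose v₀ hv₀ hfv₀ using hw
  let r : Γ → Γ := fun γ => (QuotientGroup.mk (s := C) γ).out
  have hr : ∀ γ, (r γ)⁻¹ * γ ∈ C := fun γ =>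
    QuotientGroup.eq.1 (QuotientGroup.out_eq' (QuotientGroup.mk (s := C) γ))
  have hrc : ∀ γ, ∀ c ∈ C, r (γ * c) = r γ := fun γ c hc => by
    simp only [r, QuotientGroup.mk_mul_of_mem γ hc]
  refine ⟨fun γ => ρ ((r γ)⁻¹ * γ) (v₀ (r γ)), fun γ => hX _ (hr γ) _ (hv₀ _), fun γ => ?_,
    fun γ c hc => ?_⟩
  · rw [hf _ (hr γ) _ (hv₀ _), hfv₀, ← hwc _ _ (hr γ), mul_inv_cancel_left]
  · simp only [hrc γ c hc, ← mul_assoc]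
    exact hρ _ (hr γ) _ hc _ (hv₀ _)

theorem exists_dual_basis (R M : Type*) [Ring R] [AddCommGroup M] [Module R M] [Module.Finite R M]
    [Module.Projective R M] :
    ∃ (n : ℕ) (b : Fin n → M) (ι : M →ₗ[R] Fin n → R), ∀ x, ∑ j, ι x j • b j = x := by
  obtain ⟨n, π, ι, -, -, hπι⟩ := Module.Finite.exists_comp_eq_id_of_projective R M
  refine ⟨n, fun j => π (Pi.single j 1), ι, fun x => ?_⟩
  have h : π (ι x) = x := by rw [← LinearMap.comp_apply, hπι, LinearMap.id_apply]
  conv_rhs => rw [← h, LinearMap.pi_apply_eq_sum_univ π (ι x)]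
  refine Finset.sum_congr rfl fun j _ => ?_
  have : (Pi.single j 1 : Fin n → R) = fun i => if j = i then 1 else 0 := by
    ext i
    simp [Pi.single_apply, eq_comm]
  simp only [this]

section Pairing

variable {R Γ E : Type*} [CommRing R] [AddCommGroup E] [Module R E]

/-- The linear map `R[Γ] → E` with `[γ] ↦ v γ`. -/
def pairing (v : Γ → E) : MonoidAlgebra R Γ →ₗ[R] E :=
  (Finsupp.linearCombination R v).comp (MonoidAlgebra.coeffLinearEquiv R).toLinearMap

@[simp] theorem pairing_single (v : Γ → E) (γ : Γ) (c : R) :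
    pairing v (MonoidAlgebra.single γ c) = c • v γ := by
  simp [pairing]

theorem pairing_mul_single [Group Γ] (v : Γ → E) (f : E →ₗ[R] E) (g : Γ)
    (h : ∀ γ, v (γ * g) = f (v γ)) (x : MonoidAlgebra R Γ) :
    pairing v (x * MonoidAlgebra.single g 1) = f (pairing v x) := by
  induction x using MonoidAlgebra.induction_linear with
  | zero => simp
  | add x y hx hy => simp [add_mul, hx, hy]
  | single γ c => simp [h]

end Pairing

section HomSpace

variable {F Γ : Type*} [Field F] [Group Γ] {P : Type*} [AddCommGroup P]
  [Module (MonoidAlgebra F Γ)ᵐᵒᵖ P] [Module F P] [IsScalarTower F (MonoidAlgebra F Γ)ᵐᵒᵖ P]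
variable {E : Type*} [AddCommGroup E] [Module F E]

variable (F) in
/-- The right action of a group element on a right module over the group ring. -/
def act (g : Γ) (x : P) : P := MulOpposite.op (MonoidAlgebra.single g (1 : F)) • x

theorem act_add (g : Γ) (x y : P) : act F g (x + y) = act F g x + act F g y := smul_add _ _ _

theorem act_mul (g h : Γ) (x : P) : act F (g * h) x = act F h (act F g x) := by
  simp only [act, smul_smul, ← MulOpposite.op_mul, MonoidAlgebra.single_mul_single, mul_one]

theorem act_one (x : P) : act F (1 : Γ) x = x := by
  simp only [act, ← MonoidAlgebra.one_def, MulOpposite.op_one, one_smul]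

theorem act_smul (g : Γ) (c : F) (x : P) : act F g (c • x) = c • act F g x := by
  have h : ∀ y : P, c • y = (c • (1 : (MonoidAlgebra F Γ)ᵐᵒᵖ)) • y := fun y => by
    rw [smul_assoc, one_smul]
  simp only [act]
  rw [h x, h, smul_smul, smul_smul]
  simp

theorem op_single_smul_eq (g : Γ) (c : F) (x : P) :
    MulOpposite.op (MonoidAlgebra.single g c) • x = c • act F g x := by
  rw [act, ← smul_assoc]
  congr 1
  rw [← MulOpposite.op_smul, MonoidAlgebra.smul_single, smul_eq_mul, mul_one]

variable (P) in
/-- The space `Hom_C(P, X)` of linear maps from `P` to the subspace `X` of `E` that are equivariant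
for the subgroup `C`, where `C` acts on `X` (from the right) through `ρ`. -/
def homSpace (C : Subgroup Γ) (ρ : Γ → E →ₗ[F] E) (X : Submodule F E) :
    Submodule F (P →ₗ[F] E) where
  carrier := {β | (∀ x, β x ∈ X) ∧ ∀ c ∈ C, ∀ x, β (act F c x) = ρ c (β x)}
  add_mem' := by
    rintro β β' ⟨h1, h2⟩ ⟨h1', h2'⟩
    refine ⟨fun x => X.add_mem (h1 x) (h1' x), fun c hc x => ?_⟩
    simp [h2 c hc, h2' c hc]
  zero_mem' := ⟨fun _ => X.zero_mem, by simp⟩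
  smul_mem' := by
    rintro a β ⟨h1, h2⟩
    refine ⟨fun x => X.smul_mem a (h1 x), fun c hc x => ?_⟩
    simp [h2 c hc]

variable (F Γ P) in
theorem finite_of_finite_groupRing [Finite Γ] [Module.Finite (MonoidAlgebra F Γ)ᵐᵒᵖ P] :
    Module.Finite F P := by
  have : Module.Finite F (MonoidAlgebra F Γ)ᵐᵒᵖ :=
    Module.Finite.equiv (MulOpposite.opLinearEquiv F)
  exact Module.Finite.trans (MonoidAlgebra F Γ)ᵐᵒᵖ P

/-- Projectivity of `P` over the group ring lifts `C`-equivariant maps for every subgroup `C`. -/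
theorem exists_homSpace_lift [Module.Finite (MonoidAlgebra F Γ)ᵐᵒᵖ P]
    [Module.Projective (MonoidAlgebra F Γ)ᵐᵒᵖ P] {E'' : Type*} [AddCommGroup E''] [Module F E'']
    (C : Subgroup Γ) (ρ : Γ → E →ₗ[F] E) (ρ'' : Γ → E'' →ₗ[F] E'') (X : Submodule F E)
    (X'' : Submodule F E'') (f : E →ₗ[F] E'')
    (hX : ∀ c ∈ C, ∀ x ∈ X, ρ c x ∈ X)
    (hρ : ∀ c ∈ C, ∀ c' ∈ C, ∀ x ∈ X, ρ (c * c') x = ρ c' (ρ c x))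
    (hf : ∀ c ∈ C, ∀ x ∈ X, f (ρ c x) = ρ'' c (f x))
    (hsurj : ∀ y ∈ X'', ∃ x ∈ X, f x = y) {β'' : P →ₗ[F] E''} (hβ : β'' ∈ homSpace P C ρ'' X'') :
    ∃ β ∈ homSpace P C ρ X, f ∘ₗ β = β'' := by
  obtain ⟨n, b, ι, hsum⟩ := exists_dual_basis (MonoidAlgebra F Γ)ᵐᵒᵖ P
  have key : ∀ j, ∃ v : Γ → E, (∀ γ, v γ ∈ (X : Set E)) ∧ (∀ γ, f (v γ) = β'' (act F γ (b j))) ∧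
      ∀ γ, ∀ c ∈ C, v (γ * c) = ρ c (v γ) := fun j =>
    exists_equivariant_lift C (fun c => ρ c) (fun c => ρ'' c) f X hX hρ hf _
      (fun γ => hsurj _ (hβ.1 _)) (fun γ c hc => by rw [act_mul]; exact hβ.2 c hc _)
  choose v hvX hvf hvc using key
  let ιj : Fin n → P →ₗ[F] MonoidAlgebra F Γ := fun j =>
    (MulOpposite.opLinearEquiv F).symm.toLinearMap ∘ₗ
      (LinearMap.proj j : (Fin n → (MonoidAlgebra F Γ)ᵐᵒᵖ) →ₗ[F] _) ∘ₗ
      (ι.restrictScalars F)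
  have hpX : ∀ j (x : MonoidAlgebra F Γ), pairing (v j) x ∈ X := fun j x => by
    induction x using MonoidAlgebra.induction_linear with
    | zero => simp
    | add x y hx hy => rw [map_add]; exact X.add_mem hx hy
    | single γ c => rw [pairing_single]; exact X.smul_mem _ (hvX j γ)
  have hpf : ∀ j (x : MonoidAlgebra F Γ), f (pairing (v j) x) = β'' (MulOpposite.op x • b j) :=
    fun j x => by
    induction x using MonoidAlgebra.induction_linear with
    | zero => simp
    | add x y hx hy => rw [map_add, map_add, hx, hy, MulOpposite.op_add, add_smul, map_add]
    | single γ c => rw [pairing_single, map_smul, hvf, op_single_smul_eq, map_smul]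
  refine ⟨∑ j, (pairing (v j)).comp (ιj j), ⟨fun x => ?_, fun c hc x => ?_⟩, ?_⟩
  · rw [LinearMap.sum_apply]
    exact X.sum_mem fun j _ => hpX _ _
  · rw [LinearMap.sum_apply, LinearMap.sum_apply, map_sum]
    refine Finset.sum_congr rfl fun j _ => ?_
    change pairing (v j) (ιj j (act F c x)) = ρ c (pairing (v j) (ιj j x))
    rw [← pairing_mul_single (v j) (ρ c) c (fun γ => hvc j γ c hc)]
    congr 1
    simp [ιj, act]
  · ext x
    rw [LinearMap.comp_apply, LinearMap.sum_apply, map_sum]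
    conv_rhs => rw [← hsum x, map_sum]
    exact Finset.sum_congr rfl fun j _ => hpf j _

/-- `Hom_C(P, -)` is additive on short exact sequences `0 → X' → X → X'' → 0` of `C`-modules. -/
theorem finrank_homSpace_add [Finite Γ] [Module.Finite (MonoidAlgebra F Γ)ᵐᵒᵖ P]
    [Module.Projective (MonoidAlgebra F Γ)ᵐᵒᵖ P] {E' E'' : Type*} [AddCommGroup E'] [Module F E']
    [AddCommGroup E''] [Module F E''] (C : Subgroup Γ) (ρ' : Γ → E' →ₗ[F] E')
    (ρ : Γ → E →ₗ[F] E) (ρ'' : Γ → E'' →ₗ[F] E'') (X' : Submodule F E') (X : Submodule F E)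
    (X'' : Submodule F E'') [Module.Finite F X] (i : E' →ₗ[F] E) (f : E →ₗ[F] E'')
    (hX : ∀ c ∈ C, ∀ x ∈ X, ρ c x ∈ X)
    (hρ : ∀ c ∈ C, ∀ c' ∈ C, ∀ x ∈ X, ρ (c * c') x = ρ c' (ρ c x))
    (hρ' : ∀ c ∈ C, ∀ x ∈ X', ρ' c x ∈ X')
    (hi : ∀ c ∈ C, ∀ x ∈ X', i (ρ' c x) = ρ c (i x))
    (hf : ∀ c ∈ C, ∀ x ∈ X, f (ρ c x) = ρ'' c (f x))
    (hinj : ∀ x ∈ X', i x = 0 → x = 0) (hiX : ∀ x ∈ X', i x ∈ X)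
    (hfX : ∀ x ∈ X, f x ∈ X'')
    (hfi : ∀ x ∈ X', f (i x) = 0) (hker : ∀ x ∈ X, f x = 0 → ∃ x' ∈ X', i x' = x)
    (hsurj : ∀ y ∈ X'', ∃ x ∈ X, f x = y) :
    Module.finrank F (homSpace P C ρ X) =
      Module.finrank F (homSpace P C ρ' X') + Module.finrank F (homSpace P C ρ'' X'') := by
  have hP : Module.Finite F P := finite_of_finite_groupRing F Γ P
  have hfinX : Module.Finite F (homSpace P C ρ X) := by
    let T : homSpace P C ρ X →ₗ[F] (P →ₗ[F] X) :=
      { toFun := fun β => β.1.codRestrict X β.2.1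
        map_add' := fun _ _ => by ext; rfl
        map_smul' := fun _ _ => by ext; rfl }
    refine Module.Finite.of_injective T fun β β' h => ?_
    ext x
    exact congrArg (fun g => (g x).1) h
  let Φ : homSpace P C ρ X →ₗ[F] homSpace P C ρ'' X'' :=
    { toFun := fun β => ⟨f ∘ₗ β.1, fun x => hfX _ (β.2.1 x), fun c hc x => by
        simp only [LinearMap.comp_apply]
        rw [β.2.2 c hc, hf c hc _ (β.2.1 x)]⟩
      map_add' := fun _ _ => by ext; simp
      map_smul' := fun _ _ => by ext; simp }
  let Ψ : homSpace P C ρ' X' →ₗ[F] homSpace P C ρ X :=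
    { toFun := fun β => ⟨i ∘ₗ β.1, fun x => hiX _ (β.2.1 x), fun c hc x => by
        simp only [LinearMap.comp_apply]
        rw [β.2.2 c hc, hi c hc _ (β.2.1 x)]⟩
      map_add' := fun _ _ => by ext; simp
      map_smul' := fun _ _ => by ext; simp }
  have hΦ : Function.Surjective Φ := fun β'' => by
    obtain ⟨β, hβ, h⟩ := exists_homSpace_lift C ρ ρ'' X X'' f hX hρ hf hsurj β''.2
    exact ⟨⟨β, hβ⟩, Subtype.ext h⟩
  have hinj' : ∀ x ∈ X', ∀ y ∈ X', i x = i y → x = y := fun x hx y hy h =>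
    sub_eq_zero.1 (hinj _ (X'.sub_mem hx hy) (by rw [map_sub, h, sub_self]))
  have hΨ : Function.Injective Ψ := fun β β' h => by
    ext x
    exact hinj' _ (β.2.1 x) _ (β'.2.1 x) (congrArg (fun g => g.1 x) h)
  have hrange : LinearMap.range Ψ = LinearMap.ker Φ := by
    apply le_antisymm
    · rintro _ ⟨β, rfl⟩
      rw [LinearMap.mem_ker]
      ext x
      exact hfi _ (β.2.1 x)
    · intro β hβ
      have h0 : ∀ x, f (β.1 x) = 0 := fun x =>
        congrArg (fun g : homSpace P C ρ'' X'' => g.1 x) (LinearMap.mem_ker.1 hβ)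
      choose β' hβ'X hβ' using fun x => hker _ (β.2.1 x) (h0 x)
      refine ⟨⟨{ toFun := β'
                 map_add' := fun x y => hinj' _ (hβ'X _) _ (X'.add_mem (hβ'X x) (hβ'X y))
                   (by simp [hβ'])
                 map_smul' := fun c x => hinj' _ (hβ'X _) _ (X'.smul_mem c (hβ'X x))
                   (by simp [hβ']) }, hβ'X, fun c hc x => ?_⟩, ?_⟩
      · refine hinj' _ (hβ'X _) _ (hρ' c hc _ (hβ'X x)) ?_
        change i (β' _) = i (ρ' c (β' x))
        rw [hi c hc _ (hβ'X x), hβ', hβ', β.2.2 c hc]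
      · ext x
        exact hβ' x
  rw [← LinearMap.finrank_range_add_finrank_ker Φ, LinearMap.range_eq_top.2 hΦ, finrank_top,
    ← hrange, LinearMap.finrank_range_of_inj hΨ, add_comm]

end HomSpace

/-! ### Irreducibility of small symmetric powers -/

section Difference

variable {F : Type*} [Field F]

/-- The difference operator `u(z) ↦ u(z + 1) - u(z)` lowers the degree `d` by exactly one as long as
`d` is nonzero in the field. -/
theorem natDegree_taylor_sub {u : F[X]} {d : ℕ} (hd : u.natDegree = d + 1)
    (hp : ((d + 1 : ℕ) : F) ≠ 0) :
    (taylor 1 u - u).natDegree = d ∧ taylor 1 u - u ≠ 0 := by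
  have hu : u ≠ 0 := by rintro rfl; simp at hd
  have hc : (taylor 1 u - u).coeff d = (d + 1 : ℕ) * u.coeff (d + 1) := by
    have h1 : (hasseDeriv d u).natDegree < 2 := by
      have := natDegree_hasseDeriv_le u d
      omega
    rw [coeff_sub, taylor_coeff, eval_eq_sum_range' h1]
    simp only [hasseDeriv_coeff, Finset.sum_range_succ, Finset.sum_range_zero, one_pow, mul_one,
      zero_add, Nat.choose_self, Nat.cast_one, one_mul, add_comm 1 d, Nat.choose_succ_self_right]
    ring
  have hne : (taylor 1 u - u).coeff d ≠ 0 := by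
    rw [hc]
    refine mul_ne_zero hp ?_
    rw [← hd]
    exact leadingCoeff_ne_zero.2 hu
  refine ⟨le_antisymm ?_ (le_natDegree_of_ne_zero hne), fun h => hne (by rw [h, coeff_zero])⟩
  have hlt : (taylor 1 u - u).degree < u.degree := by
    have h1 : (taylor 1 u).degree = u.degree := degree_taylor u 1
    rw [← h1]
    refine degree_sub_lt_left h1 ?_ ?_
    · intro h0
      rw [h0, degree_zero] at h1
      exact hu (degree_eq_bot.1 h1.symm)
    · rw [leadingCoeff_taylor]
  by_cases h0 : taylor 1 u - u = 0
  · simp [h0]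
  · have := natDegree_lt_natDegree h0 hlt
    omega

/-- A space of polynomials that is stable under `u(z) ↦ u(z + 1)` and contains a polynomial of
degree `d` contains all polynomials of degree at most `d`, if `1, …, d` are nonzero in the field. -/
theorem mem_of_taylor_stable (V : Submodule F F[X]) (hV : ∀ u ∈ V, taylor 1 u ∈ V) (d : ℕ)
    (hd : ∀ i, 1 ≤ i → i ≤ d → (i : F) ≠ 0) {u : F[X]} (hu : u ∈ V) (hu0 : u ≠ 0)
    (hud : u.natDegree = d) {w : F[X]} (hw : w.natDegree ≤ d) : w ∈ V := by
  induction d generalizing u w with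
  | zero =>
    rw [eq_C_of_natDegree_eq_zero hud] at hu hu0
    rw [eq_C_of_natDegree_le_zero hw]
    have h0 : u.coeff 0 ≠ 0 := fun h => hu0 (by rw [h, C_0])
    have := V.smul_mem (w.coeff 0 / u.coeff 0) hu
    rwa [smul_C, smul_eq_mul, div_mul_cancel₀ _ h0] at this
  | succ d ih =>
    obtain ⟨h1, h2⟩ := natDegree_taylor_sub hud (hd (d + 1) (by omega) le_rfl)
    have hlow : ∀ {w : F[X]}, w.natDegree ≤ d → w ∈ V := fun hw =>
      ih (fun i hi hi' => hd i hi (by omega)) (V.sub_mem (hV u hu) hu) h2 h1 hw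
    have hlc : u.coeff (d + 1) ≠ 0 := by rw [← hud]; exact leadingCoeff_ne_zero.2 hu0
    have h3 : (w - (w.coeff (d + 1) / u.coeff (d + 1)) • u).natDegree ≤ d := by
      refine natDegree_le_iff_coeff_eq_zero.2 fun N hN => ?_
      rw [coeff_sub, coeff_smul, smul_eq_mul]
      rcases Nat.lt_or_ge (d + 1) N with h | h
      · rw [coeff_eq_zero_of_natDegree_lt (show w.natDegree < N by omega),
          coeff_eq_zero_of_natDegree_lt (show u.natDegree < N by omega)]
        simp
      · obtain rfl : N = d + 1 := by omega
        rw [div_mul_cancel₀ _ hlc, sub_self]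
    have := V.add_mem (hlow h3) (V.smul_mem (w.coeff (d + 1) / u.coeff (d + 1)) hu)
    rwa [sub_add_cancel] at this

end Difference

section Elements

variable {p : ℕ} [Fact p.Prime]

/-- The upper triangular unipotent matrix with entry `x`. -/
def unip (x : ZMod p) : GL (Fin 2) (ZMod p) :=
  Matrix.GeneralLinearGroup.mkOfDetNeZero !![1, x; 0, 1] (by simp)

/-- The permutation matrix that exchanges the two coordinates. -/
def swapMat : GL (Fin 2) (ZMod p) :=
  Matrix.GeneralLinearGroup.mkOfDetNeZero !![0, 1; 1, 0] (by simp)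

/-- The diagonal matrix with entries `x` and `y`. -/
def diagMat (x y : (ZMod p)ˣ) : GL (Fin 2) (ZMod p) :=
  Matrix.GeneralLinearGroup.mkOfDetNeZero !![(x : ZMod p), 0; 0, y] (by simp)

end Elements

section Weights

variable {p : ℕ} [Fact p.Prime] {F : Type*} [Field F] [CharP F p]

theorem natCast_ne_zero_of_lt {i : ℕ} (h1 : 1 ≤ i) (h2 : i < p) : (i : F) ≠ 0 := fun h =>
  absurd (Nat.le_of_dvd (by omega) ((CharP.cast_eq_zero_iff F p i).1 h)) (by omega)

theorem toMat_mul (g h : GL (Fin 2) (ZMod p)) : toMat F (g * h) = toMat F g * toMat F h := by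
  simp only [toMat, Units.val_mul, map_mul]

variable (F) in
/-- The embedding of the prime field. -/
def emb : ZMod p →+* F := ZMod.castHom (dvd_refl p) F

theorem emb_injective : Function.Injective (emb F : ZMod p →+* F) := (emb F).injective

theorem toMat_apply (g : GL (Fin 2) (ZMod p)) (i j : Fin 2) : toMat F g i j = emb F (g i j) := rfl

theorem dehom_symAct_unip (h : MvPolynomial (Fin 2) F) :
    dehom (symAct (toMat F (unip (1 : ZMod p))) h) = taylor 1 (dehom h) := by
  have : (dehom (R := F)).comp (symAct (toMat F (unip (1 : ZMod p)))) =
      (Polynomial.aeval (X + C 1 : F[X])).comp dehom := by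
    ext i
    fin_cases i <;> simp [dehom, symAct, toMat, unip, Fin.sum_univ_two]
  have h2 := congrArg (fun f => f h) this
  simpa [taylor_apply, comp, aeval_def] using h2

theorem symAct_swap_X_one_pow (n : ℕ) :
    symAct (toMat F (swapMat : GL (Fin 2) (ZMod p))) (MvPolynomial.X 1 ^ n) =
      MvPolynomial.X 0 ^ n := by
  simp [symAct, toMat, swapMat, Fin.sum_univ_two]

theorem symAct_unip_X_one_pow (x : ZMod p) (n : ℕ) :
    symAct (toMat F (unip x)) (MvPolynomial.X 1 ^ n) = MvPolynomial.X 1 ^ n := by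
  simp [symAct, toMat, unip, Fin.sum_univ_two]

theorem symAct_diag_X_one_pow (x y : (ZMod p)ˣ) (n : ℕ) :
    symAct (toMat F (diagMat x y)) (MvPolynomial.X 1 ^ n) =
      (emb F (y : ZMod p)) ^ n • MvPolynomial.X 1 ^ n := by
  simp [symAct, toMat, diagMat, Fin.sum_univ_two, mul_pow, emb, MvPolynomial.smul_eq_C_mul]

theorem homog_C (n : ℕ) (c : F) : homog n (C c) = c • MvPolynomial.X 1 ^ n := by
  rw [homog_apply, Finset.sum_eq_single 0] <;> simp +contextual [coeff_C]

/-- For `n < p`, the symmetric power `Symⁿ F²` is an irreducible representation of `GL₂(𝔽_p)`. -/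
theorem forms_irreducible {n : ℕ} (hn : n < p) (V : Submodule F (MvPolynomial (Fin 2) F))
    (hV : V ≤ MvPolynomial.homogeneousSubmodule (Fin 2) F n)
    (hst : ∀ g : GL (Fin 2) (ZMod p), ∀ h ∈ V, symAct (toMat F g) h ∈ V) (hne : V ≠ ⊥) :
    V = MvPolynomial.homogeneousSubmodule (Fin 2) F n := by
  let V' : Submodule F F[X] := V.map (dehom (R := F)).toLinearMap
  have hV' : ∀ u ∈ V', taylor 1 u ∈ V' := by
    rintro _ ⟨h, hh, rfl⟩
    exact ⟨_, hst (unip 1) h hh, dehom_symAct_unip h⟩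
  have hmem : ∀ {u : F[X]}, u ∈ V' → homog n u ∈ V := by
    rintro _ ⟨h, hh, rfl⟩
    change homog n (dehom h) ∈ V
    rwa [homog_dehom (hV hh)]
  obtain ⟨h, hh, h0⟩ := V.ne_bot_iff.1 hne
  have hd0 : dehom h ≠ 0 := fun h1 => h0 (by rw [← homog_dehom (hV hh), h1, map_zero])
  have h1 : (1 : F[X]) ∈ V' := by
    refine mem_of_taylor_stable V' hV' _ (fun i hi hi' => ?_) ⟨h, hh, rfl⟩ hd0 rfl (by simp)
    exact natCast_ne_zero_of_lt hi
      (lt_of_le_of_lt (hi'.trans (natDegree_dehom_le (hV hh))) hn)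
  have hY : (MvPolynomial.X 1 ^ n : MvPolynomial (Fin 2) F) ∈ V := by
    have := hmem h1
    rwa [← C_1, homog_C, one_smul] at this
  have hX : (X ^ n : F[X]) ∈ V' := by
    refine ⟨MvPolynomial.X 0 ^ n, ?_, by simp [dehom]⟩
    rw [← symAct_swap_X_one_pow (p := p)]
    exact hst _ _ hY
  refine le_antisymm hV fun f hf => ?_
  rw [← homog_dehom hf]
  refine hmem (mem_of_taylor_stable V' hV' n (fun i hi hi' => ?_) hX (by simp) (by simp)
    (natDegree_dehom_le hf))
  exact natCast_ne_zero_of_lt hi (by omega)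

variable (F) in
/-- The right action of `g ∈ GL₂(𝔽_p)` on polynomials, twisted by the function `χ`. -/
def formAct (χ : GL (Fin 2) (ZMod p) → F) (g : GL (Fin 2) (ZMod p)) :
    MvPolynomial (Fin 2) F →ₗ[F] MvPolynomial (Fin 2) F :=
  χ g • (symAct (toMat F g)).toLinearMap

theorem formAct_apply (χ : GL (Fin 2) (ZMod p) → F) (g : GL (Fin 2) (ZMod p))
    (h : MvPolynomial (Fin 2) F) : formAct F χ g h = χ g • symAct (toMat F g) h := rfl

theorem formAct_mul (χ : GL (Fin 2) (ZMod p) → F) {g g' : GL (Fin 2) (ZMod p)}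
    (hχ : χ (g * g') = χ g * χ g') (h : MvPolynomial (Fin 2) F) :
    formAct F χ (g * g') h = formAct F χ g' (formAct F χ g h) := by
  simp only [formAct_apply, hχ, toMat_mul, symAct_mul, AlgHom.comp_apply, map_smul, smul_smul]

theorem formAct_mem (χ : GL (Fin 2) (ZMod p) → F) (g : GL (Fin 2) (ZMod p)) {n : ℕ}
    {h : MvPolynomial (Fin 2) F} (hh : h ∈ MvPolynomial.homogeneousSubmodule (Fin 2) F n) :
    formAct F χ g h ∈ MvPolynomial.homogeneousSubmodule (Fin 2) F n :=
  Submodule.smul_mem _ _ (symAct_isHomogeneous _ hh)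

variable (F) in
/-- The character `det^c` of `GL₂(𝔽_p)`. -/
def detPow (c : ℤ) (g : GL (Fin 2) (ZMod p)) : F := emb F g.1.det ^ c

theorem detPow_mul (c : ℤ) (g g' : GL (Fin 2) (ZMod p)) :
    detPow F c (g * g') = detPow F c g * detPow F c g' := by
  simp [detPow, mul_zpow]

theorem emb_zpow_eq_one_of_dvd {c : ℤ} (hc : ((p : ℤ) - 1) ∣ c) {x : ZMod p} (hx : x ≠ 0) :
    emb F x ^ c = 1 := by
  obtain ⟨m, rfl⟩ := hc
  have h1 : (emb F x) ^ ((p : ℤ) - 1) = 1 := by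
    have hp : 1 ≤ p := (Fact.out : p.Prime).one_lt.le
    rw [show (p : ℤ) - 1 = ((p - 1 : ℕ) : ℤ) by push_cast [hp]; ring, zpow_natCast, ← map_pow,
      ZMod.pow_card_sub_one_eq_one hx, map_one]
  rw [zpow_mul, h1, one_zpow]

theorem dvd_of_emb_zpow_eq_one {c : ℤ} (h : ∀ x : (ZMod p)ˣ, emb F (x : ZMod p) ^ c = 1) :
    ((p : ℤ) - 1) ∣ c := by
  obtain ⟨g, hg⟩ := IsCyclic.exists_generator (α := (ZMod p)ˣ)
  have h1 : g ^ c = 1 := by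
    have := h g
    apply Units.ext
    apply emb_injective (F := F)
    rw [Units.val_zpow_eq_zpow_val, map_zpow₀, this, Units.val_one, map_one]
  have h2 : orderOf g = p - 1 := by
    rw [orderOf_eq_card_of_forall_mem_zpowers hg, Nat.card_eq_fintype_card, ZMod.card_units]
  have h3 := orderOf_dvd_iff_zpow_eq_one.2 h1
  have hp : 1 ≤ p := (Fact.out : p.Prime).one_lt.le
  rw [h2] at h3
  simpa [hp] using h3

theorem emb_zpow_congr {c c' : ℤ} (hc : ((p : ℤ) - 1) ∣ c - c') {x : ZMod p} (hx : x ≠ 0) :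
    emb F x ^ c = emb F x ^ c' := by
  have hx' : emb F x ≠ 0 := (_root_.map_ne_zero _).2 hx
  rw [show c = (c - c') + c' by ring, zpow_add₀ hx', emb_zpow_eq_one_of_dvd hc hx, one_mul]

end Weights

/-! ### Multiplicities of irreducible representations -/

section Cover

variable {p : ℕ} [Fact p.Prime] {F : Type*} [Field F] [CharP F p]
  {P : Type*} [AddCommGroup P] [Module (MonoidAlgebra F (GL (Fin 2) (ZMod p)))ᵐᵒᵖ P]
  [Module F P] [IsScalarTower F (MonoidAlgebra F (GL (Fin 2) (ZMod p)))ᵐᵒᵖ P]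

/-- `π` exhibits `P` as an essential cover of `Sym^a F²`: it is equivariant, it maps onto the binary
forms of degree `a`, and no proper subrepresentation of `P` does. -/
structure IsCover (a : ℕ) (π : P →ₗ[F] MvPolynomial (Fin 2) F) : Prop where
  mem : ∀ x, π x ∈ MvPolynomial.homogeneousSubmodule (Fin 2) F a
  map_act : ∀ (g : GL (Fin 2) (ZMod p)) x, π (act F g x) = symAct (toMat F g) (π x)
  surj : ∀ y ∈ MvPolynomial.homogeneousSubmodule (Fin 2) F a, ∃ x, π x = y
  essential : ∀ N : Submodule F P, (∀ (g : GL (Fin 2) (ZMod p)), ∀ x ∈ N, act F g x ∈ N) →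
    MvPolynomial.homogeneousSubmodule (Fin 2) F a ≤ N.map π → N = ⊤

theorem coe_serreAct (a : ℕ) (g : GL (Fin 2) (ZMod p)) (v : SerreWeight p F a 0) :
    ((serreAct p F a 0 g v : SerreWeight p F a 0) :
      MvPolynomial.homogeneousSubmodule (Fin 2) F a).1 =
      symAct (toMat F g) (v : MvPolynomial.homogeneousSubmodule (Fin 2) F a).1 := by
  simp only [serreAct, pow_zero, one_smul]
  rfl

theorem IsProjectiveEnvelope.exists_isCover {a : ℕ}
    (h : IsProjectiveEnvelope (MonoidAlgebra F (GL (Fin 2) (ZMod p)))ᵐᵒᵖ P (SerreWeight p F a 0)) :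
    ∃ π : P →ₗ[F] MvPolynomial (Fin 2) F, IsCover (p := p) a π := by
  obtain ⟨-, π, hπ, hess⟩ := h
  let j : SerreWeight p F a 0 → MvPolynomial (Fin 2) F :=
    fun v => (v : MvPolynomial.homogeneousSubmodule (Fin 2) F a).1
  have hsmul : ∀ (c : F) (x : P), c • x =
      MulOpposite.op (MonoidAlgebra.single (1 : GL (Fin 2) (ZMod p)) c) • x := fun c x => by
    rw [op_single_smul_eq, act_one]
  let π' : P →ₗ[F] MvPolynomial (Fin 2) F :=
    { toFun := fun x => j (π x)
      map_add' := fun x y => by rw [map_add]; rfl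
      map_smul' := fun c x => by
        rw [hsmul, map_smul, op_single_smul, serreAct_one]; rfl }
  refine ⟨π', ⟨fun x => (π x : MvPolynomial.homogeneousSubmodule (Fin 2) F a).2, fun g x => ?_,
    fun y hy => ?_, fun N hN hmap => ?_⟩⟩
  · change j (π (act F g x)) = symAct (toMat F g) (j (π x))
    rw [act, map_smul, op_single_smul, one_smul]
    exact coe_serreAct a g (π x)
  · obtain ⟨x, hx⟩ := hπ (⟨y, hy⟩ : MvPolynomial.homogeneousSubmodule (Fin 2) F a)
    exact ⟨x, congrArg j hx⟩
  · let N' : Submodule (MonoidAlgebra F (GL (Fin 2) (ZMod p)))ᵐᵒᵖ P :=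
      { N.toAddSubmonoid with
        smul_mem' := fun r x hx => by
          induction r using MulOpposite.rec' with | _ r => ?_
          induction r using MonoidAlgebra.induction_linear with
          | zero => simp
          | add r r' h h' => rw [MulOpposite.op_add, add_smul]; exact N.add_mem h h'
          | single g c => rw [op_single_smul_eq]; exact N.smul_mem c (hN g x hx) }
    have htop : N' = ⊤ := hess N' (by
      rw [eq_top_iff]
      rintro v -
      obtain ⟨x, hx, hxv⟩ := hmap (v : MvPolynomial.homogeneousSubmodule (Fin 2) F a).2
      exact ⟨x, hx, Subtype.ext hxv⟩)
    rw [eq_top_iff]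
    rintro x -
    have : x ∈ N' := htop ▸ Submodule.mem_top
    exact this

theorem X_pow_mem_forms (i : Fin 2) (n : ℕ) :
    (MvPolynomial.X i ^ n : MvPolynomial (Fin 2) F) ∈
      MvPolynomial.homogeneousSubmodule (Fin 2) F n :=
  MvPolynomial.isHomogeneous_X_pow i n

variable {a : ℕ} {π : P →ₗ[F] MvPolynomial (Fin 2) F}

/-- A nonzero equivariant map from an essential cover of `Sym^a` to another irreducible
representation has the same kernel as the cover. -/
theorem IsCover.ker_eq (hπ : IsCover (p := p) a π) (ha : a < p) {b : ℕ} (hb : b < p)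
    {χ : GL (Fin 2) (ZMod p) → F} (hχ : ∀ g, χ g ≠ 0) {β : P →ₗ[F] MvPolynomial (Fin 2) F}
    (hβ : β ∈ homSpace P ⊤ (formAct F χ) (MvPolynomial.homogeneousSubmodule (Fin 2) F b))
    (hβ0 : β ≠ 0) : LinearMap.ker β = LinearMap.ker π := by
  have hact : ∀ g x, β (act F g x) = χ g • symAct (toMat F g) (β x) := fun g x =>
    hβ.2 g (Subgroup.mem_top g) x
  have h1 : LinearMap.ker β ≤ LinearMap.ker π := by
    by_contra hle
    have hst : ∀ g : GL (Fin 2) (ZMod p), ∀ x ∈ LinearMap.ker β, act F g x ∈ LinearMap.ker β :=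
      fun g x hx => by
        rw [LinearMap.mem_ker] at hx ⊢
        rw [hact, hx, map_zero, smul_zero]
    have hV := forms_irreducible (p := p) ha ((LinearMap.ker β).map π) (by
        rintro _ ⟨x, -, rfl⟩; exact hπ.mem x) (by
        rintro g _ ⟨x, hx, rfl⟩
        exact ⟨act F g x, hst g x hx, hπ.map_act g x⟩) (by
        intro h0
        refine hle fun x hx => ?_
        have : π x ∈ (LinearMap.ker β).map π := ⟨x, hx, rfl⟩
        rwa [h0, Submodule.mem_bot] at this)
    exact hβ0 (LinearMap.ker_eq_top.1 (hπ.essential _ hst hV.ge))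
  refine le_antisymm h1 ?_
  by_contra hle
  have hV := forms_irreducible (p := p) hb ((LinearMap.ker π).map β) (by
      rintro _ ⟨x, -, rfl⟩; exact hβ.1 x) (by
      rintro g _ ⟨x, hx, rfl⟩
      refine ⟨(χ g)⁻¹ • act F g x, ?_, ?_⟩
      · refine Submodule.smul_mem _ _ ?_
        rw [LinearMap.mem_ker, hπ.map_act,
          LinearMap.mem_ker.1 hx, map_zero]
      · rw [map_smul, hact, smul_smul, inv_mul_cancel₀ (hχ g), one_smul]) (by
      intro h0
      refine hle fun x hx => ?_
      have : β x ∈ (LinearMap.ker π).map β := ⟨x, hx, rfl⟩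
      rwa [h0, Submodule.mem_bot] at this)
  obtain ⟨x, hx⟩ := hπ.surj _ (X_pow_mem_forms 1 a)
  have : β x ∈ (LinearMap.ker π).map β := hV ▸ hβ.1 x
  obtain ⟨k, hk, hkx⟩ := this
  have h2 : x - k ∈ LinearMap.ker π := h1 (by rw [LinearMap.mem_ker, map_sub, hkx, sub_self])
  rw [LinearMap.mem_ker, map_sub, LinearMap.mem_ker.1 hk, sub_zero, hx] at h2
  exact pow_ne_zero a (MvPolynomial.X_ne_zero 1) h2

/-- A polynomial of degree less than `p` that is invariant under `z ↦ z + 1` is constant. -/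
theorem natDegree_eq_zero_of_taylor_eq {u : F[X]} (hu : taylor 1 u = u) (hd : u.natDegree < p) :
    u.natDegree = 0 := by
  rcases h : u.natDegree with _ | d
  · rfl
  · exact absurd (by rw [hu, sub_self])
      (natDegree_taylor_sub h (natCast_ne_zero_of_lt (by omega) (by omega))).2

/-- Among the irreducible representations `Sym^b ⊗ det^c` with `b < p`, an essential cover of
`Sym^a` maps nontrivially to `Sym^a` only, and it does so in a unique way up to scalars. -/
theorem IsCover.finrank_forms_small (hπ : IsCover (p := p) a π) (ha1 : 1 ≤ a) (ha2 : a + 1 < p)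
    {b : ℕ} (hb : b < p) (c : ℤ) :
    Module.finrank F (homSpace P ⊤ (formAct F (detPow F c))
      (MvPolynomial.homogeneousSubmodule (Fin 2) F b)) =
      if b = a ∧ ((p : ℤ) - 1) ∣ c then 1 else 0 := by
  set W := homSpace P ⊤ (formAct F (detPow (p := p) F c))
      (MvPolynomial.homogeneousSubmodule (Fin 2) F b) with hW
  have hdet0 : ∀ g : GL (Fin 2) (ZMod p), g.1.det ≠ 0 := fun g =>
    (Matrix.GeneralLinearGroup.det g).ne_zero
  have hχ : ∀ g : GL (Fin 2) (ZMod p), detPow F c g ≠ 0 := fun g =>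
    zpow_ne_zero _ ((_root_.map_ne_zero (emb F)).2 (hdet0 g))
  obtain ⟨x₀, hx₀⟩ := hπ.surj _ (X_pow_mem_forms 1 a)
  have hker : ∀ β ∈ W, LinearMap.ker π ≤ LinearMap.ker β := fun β hβ => by
    by_cases h0 : β = 0
    · simp [h0]
    · exact (hπ.ker_eq (by omega) hb hχ hβ h0).ge
  have hact : ∀ β ∈ W, ∀ (g : GL (Fin 2) (ZMod p)) (e : F),
      symAct (toMat F g) (MvPolynomial.X 1 ^ a) = e • MvPolynomial.X 1 ^ a →
      detPow F c g • symAct (toMat F g) (β x₀) = e • β x₀ := fun β hβ g e h => by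
    have h1 : act F g x₀ - e • x₀ ∈ LinearMap.ker β := hker β hβ (by
      rw [LinearMap.mem_ker, map_sub, map_smul, hπ.map_act, hx₀, h, sub_self])
    rw [LinearMap.mem_ker, map_sub, map_smul, hβ.2 g (Subgroup.mem_top g), sub_eq_zero] at h1
    exact h1
  -- the image of the highest weight vector is a multiple of the highest weight vector
  have hval : ∀ β ∈ W, β x₀ = (dehom (β x₀)).coeff 0 • MvPolynomial.X 1 ^ b := fun β hβ => by
    have h1 := hact β hβ (unip 1) 1 (by rw [symAct_unip_X_one_pow, one_smul])
    have h2 : detPow F c (unip (1 : ZMod p)) = 1 := by simp [detPow, unip]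
    rw [h2, one_smul, one_smul] at h1
    have h3 := congrArg dehom h1
    rw [dehom_symAct_unip] at h3
    have h4 := natDegree_eq_zero_of_taylor_eq (p := p) h3
      (lt_of_le_of_lt (natDegree_dehom_le (hβ.1 x₀)) hb)
    conv_lhs => rw [← homog_dehom (hβ.1 x₀), eq_C_of_natDegree_eq_zero h4, homog_C]
  have hne : ∀ β ∈ W, (dehom (β x₀)).coeff 0 = 0 → β = 0 := fun β hβ h0 => by
    by_contra hβ0
    have h1 : x₀ ∈ LinearMap.ker π := by
      rw [← hπ.ker_eq (by omega) hb hχ hβ hβ0, LinearMap.mem_ker, hval β hβ, h0, zero_smul]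
    rw [LinearMap.mem_ker, hx₀] at h1
    exact pow_ne_zero a (MvPolynomial.X_ne_zero 1) h1
  let L : W →ₗ[F] F := (lcoeff F 0) ∘ₗ dehom.toLinearMap ∘ₗ
    (LinearMap.applyₗ x₀ : (P →ₗ[F] MvPolynomial (Fin 2) F) →ₗ[F] _) ∘ₗ W.subtype
  have hL : Function.Injective L := LinearMap.ker_eq_bot.1 (LinearMap.ker_eq_bot'.2 fun β h =>
    Subtype.ext (hne β.1 β.2 h))
  have hle : Module.finrank F W ≤ 1 := by
    simpa using LinearMap.finrank_le_finrank_of_injective hL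
  split_ifs with hcond
  · obtain ⟨rfl, hc⟩ := hcond
    have hmem : π ∈ W := ⟨hπ.mem, fun g _ x => by
      rw [formAct_apply, hπ.map_act, detPow, emb_zpow_eq_one_of_dvd hc (hdet0 g), one_smul]⟩
    refine le_antisymm hle (Nat.one_le_iff_ne_zero.2 fun h0 => ?_)
    have hfin : Module.Finite F W := Module.Finite.of_injective L hL
    have : Subsingleton W := Module.finrank_zero_iff.1 h0
    have h1 : π = 0 := congrArg Subtype.val (Subsingleton.elim (⟨π, hmem⟩ : W) 0)
    rw [h1] at hx₀
    exact pow_ne_zero b (MvPolynomial.X_ne_zero 1) hx₀.symm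
  · have hzero : ∀ β ∈ W, β = 0 := fun β hβ => by
      by_contra hβ0
      have hk : (dehom (β x₀)).coeff 0 ≠ 0 := fun h => hβ0 (hne β hβ h)
      have htorus : ∀ x y : (ZMod p)ˣ,
          emb F (x * y : ZMod p) ^ c * emb F (y : ZMod p) ^ b = emb F (y : ZMod p) ^ a :=
        fun x y => by
        have h1 := hact β hβ (diagMat x y) _ (symAct_diag_X_one_pow x y a)
        rw [hval β hβ, map_smul, symAct_diag_X_one_pow] at h1
        have h2 := congrArg (fun f => (dehom f).coeff 0) h1
        have h3 : detPow F c (diagMat x y) = emb F (x * y : ZMod p) ^ c := by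
          simp [detPow, diagMat]
        simp only [h3, map_smul, map_pow, dehom_X_one, one_pow, coeff_smul, smul_eq_mul,
          coeff_one_zero, mul_one] at h2
        refine mul_right_cancel₀ hk ?_
        linear_combination h2
      have hc : ((p : ℤ) - 1) ∣ c := dvd_of_emb_zpow_eq_one (F := F) fun x => by
        simpa using htorus x 1
      refine hcond ⟨?_, hc⟩
      have hba : ((p : ℤ) - 1) ∣ (b : ℤ) - a := dvd_of_emb_zpow_eq_one (F := F) fun y => by
        have hy : emb F (y : ZMod p) ≠ 0 := (_root_.map_ne_zero _).2 y.ne_zero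
        have h1 := htorus 1 y
        rw [emb_zpow_eq_one_of_dvd hc (by simp), one_mul] at h1
        rw [zpow_sub₀ hy, zpow_natCast, zpow_natCast, h1, div_self (pow_ne_zero _ hy)]
      have := Int.eq_zero_of_abs_lt_dvd hba (by rw [abs_lt]; omega)
      omega
    have : Subsingleton W := ⟨fun β β' => Subtype.ext (by
      rw [hzero _ β.2, hzero _ β'.2])⟩
    exact Module.finrank_zero_of_subsingleton

end Cover

/-! ### Homogeneous functions on the plane over the prime field -/

section Functions

variable {p : ℕ} [Fact p.Prime] {F : Type*} [Field F] [CharP F p]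

variable (p F) in
/-- The functions `f` on `𝔽_p²` with `f(0) = 0` that are homogeneous of degree `n` under scaling. As
a representation of `GL₂(𝔽_p)` this is the principal series attached to `n`. -/
def funSpace (n : ℤ) : Submodule F ((Fin 2 → ZMod p) → F) where
  carrier := {f | f 0 = 0 ∧ ∀ (c : ZMod p), c ≠ 0 → ∀ v, f (c • v) = emb F c ^ n * f v}
  add_mem' := by
    rintro f f' ⟨h1, h2⟩ ⟨h1', h2'⟩
    refine ⟨by simp [h1, h1'], fun c hc v => ?_⟩
    simp only [Pi.add_apply, h2 c hc, h2' c hc, mul_add]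
  zero_mem' := ⟨rfl, by simp⟩
  smul_mem' := by
    rintro a f ⟨h1, h2⟩
    refine ⟨by simp [h1], fun c hc v => ?_⟩
    simp only [Pi.smul_apply, h2 c hc, smul_eq_mul]
    ring

variable (F) in
/-- The right action of `g ∈ GL₂(𝔽_p)` on functions on `𝔽_p²`, twisted by the function `χ`. -/
def funAct (χ : GL (Fin 2) (ZMod p) → F) (g : GL (Fin 2) (ZMod p)) :
    ((Fin 2 → ZMod p) → F) →ₗ[F] ((Fin 2 → ZMod p) → F) :=
  χ g • LinearMap.funLeft F F (g.1.mulVec)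

theorem funAct_apply (χ : GL (Fin 2) (ZMod p) → F) (g : GL (Fin 2) (ZMod p))
    (f : (Fin 2 → ZMod p) → F) (v : Fin 2 → ZMod p) :
    funAct F χ g f v = χ g * f (g.1.mulVec v) := rfl

theorem funAct_mul (χ : GL (Fin 2) (ZMod p) → F) {g g' : GL (Fin 2) (ZMod p)}
    (hχ : χ (g * g') = χ g * χ g') (f : (Fin 2 → ZMod p) → F) :
    funAct F χ (g * g') f = funAct F χ g' (funAct F χ g f) := by
  ext v
  simp only [funAct_apply, hχ, Units.val_mul, Matrix.mulVec_mulVec]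
  ring

theorem funAct_mem (χ : GL (Fin 2) (ZMod p) → F) (g : GL (Fin 2) (ZMod p)) {n : ℤ}
    {f : (Fin 2 → ZMod p) → F} (hf : f ∈ funSpace p F n) : funAct F χ g f ∈ funSpace p F n := by
  refine ⟨by simp [funAct_apply, hf.1], fun c hc v => ?_⟩
  rw [funAct_apply, funAct_apply, Matrix.mulVec_smul, hf.2 c hc]
  ring

theorem funSpace_congr {n n' : ℤ} (h : ((p : ℤ) - 1) ∣ n - n') :
    funSpace p F n = funSpace p F n' := by
  have key : ∀ {n n' : ℤ}, ((p : ℤ) - 1) ∣ n - n' → funSpace p F n ≤ funSpace p F n' :=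
    fun h f hf => ⟨hf.1, fun c hc v => by rw [hf.2 c hc, emb_zpow_congr h hc]⟩
  exact le_antisymm (key h) (key (dvd_sub_comm.1 h))

/-- A homogeneous function is determined by its values at `(x, 1)` and `(1, 0)`. -/
theorem eq_zero_of_mem_funSpace {n : ℤ} {f : (Fin 2 → ZMod p) → F} (hf : f ∈ funSpace p F n)
    (h1 : ∀ x, f ![x, 1] = 0) (h2 : f ![1, 0] = 0) : f = 0 := by
  ext v
  by_cases hy : v 1 = 0
  · by_cases hx : v 0 = 0
    · have : v = 0 := by ext i; fin_cases i <;> simp [hx, hy]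
      rw [this, hf.1]; rfl
    · have : v = v 0 • ![1, 0] := by ext i; fin_cases i <;> simp [hy]
      rw [this, hf.2 _ hx, h2, mul_zero]; rfl
  · have : v = v 1 • ![v 0 / v 1, 1] := by
      ext i
      fin_cases i <;> simp [mul_div_cancel₀, hy]
    rw [this, hf.2 _ hy, h1, mul_zero]; rfl

theorem finrank_funSpace_le (n : ℤ) : Module.finrank F (funSpace p F n) ≤ p + 1 := by
  let L : funSpace p F n →ₗ[F] (Option (ZMod p) → F) :=
    (LinearMap.funLeft F F (fun o : Option (ZMod p) => o.elim ![1, 0] fun x => ![x, 1])) ∘ₗ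
      (funSpace p F n).subtype
  have hL : Function.Injective L := LinearMap.ker_eq_bot.1 (LinearMap.ker_eq_bot'.2 fun f h =>
    Subtype.ext (eq_zero_of_mem_funSpace f.2 (fun x => congrFun h (some x)) (congrFun h none)))
  simpa [ZMod.card] using LinearMap.finrank_le_finrank_of_injective hL

variable (p F) in
/-- The function on `𝔽_p²` attached to a polynomial in two variables. -/
def evalFun : MvPolynomial (Fin 2) F →ₗ[F] ((Fin 2 → ZMod p) → F) :=
  LinearMap.pi fun v => (MvPolynomial.aeval (fun i => emb F (v i))).toLinearMap

theorem evalFun_apply (h : MvPolynomial (Fin 2) F) (v : Fin 2 → ZMod p) :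
    evalFun p F h v = MvPolynomial.eval (fun i => emb F (v i)) h := by
  simp [evalFun, MvPolynomial.aeval_eq_eval]

theorem evalFun_mul (h h' : MvPolynomial (Fin 2) F) (v : Fin 2 → ZMod p) :
    evalFun p F (h * h') v = evalFun p F h v * evalFun p F h' v := by
  simp only [evalFun_apply, map_mul]

theorem evalFun_formAct (χ : GL (Fin 2) (ZMod p) → F) (g : GL (Fin 2) (ZMod p))
    (h : MvPolynomial (Fin 2) F) :
    evalFun p F (formAct F χ g h) = funAct F χ g (evalFun p F h) := by
  ext v
  rw [funAct_apply, evalFun_apply, evalFun_apply, formAct_apply, MvPolynomial.smul_eval,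
    eval_symAct]
  congr 3
  ext i
  exact (RingHom.map_mulVec (emb F) g.1 v i).symm

theorem evalFun_mem {n : ℕ} (hn : 1 ≤ n) {h : MvPolynomial (Fin 2) F} (hh : h.IsHomogeneous n) :
    evalFun p F h ∈ funSpace p F n := by
  have key : ∀ (c : ZMod p) v, evalFun p F h (c • v) = emb F c ^ n * evalFun p F h v :=
      fun c v => by
    rw [evalFun_apply, evalFun_apply, ← eval_smul_vec hh]
    congr 2
    ext i
    simp
  refine ⟨?_, fun c _ v => by rw [key, zpow_natCast]⟩
  have := key 0 0
  rwa [smul_zero, map_zero, zero_pow (by omega), zero_mul] at this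

theorem evalFun_one (h : MvPolynomial (Fin 2) F) (x : ZMod p) :
    evalFun p F h ![x, 1] = (dehom h).eval (emb F x) := by
  rw [evalFun_apply, ← eval_one_eq_eval_dehom]
  congr 2
  ext i
  fin_cases i <;> simp

theorem evalFun_one_zero {n : ℕ} {h : MvPolynomial (Fin 2) F} (hh : h.IsHomogeneous n) :
    evalFun p F h ![1, 0] = (dehom h).coeff n := by
  rw [evalFun_apply, ← eval_one_zero_eq_coeff hh]
  congr 2
  ext i
  fin_cases i <;> simp

theorem eq_zero_of_eval_emb {u : F[X]} (hu : u.natDegree < p)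
    (h : ∀ x, u.eval (emb F (x : ZMod p)) = 0) :
    u = 0 :=
  eq_zero_of_natDegree_lt_card_of_eval_eq_zero u (emb_injective (p := p)) h (by rwa [ZMod.card])

variable (p F) in
/-- The Dickson invariant `X^p Y - X Y^p`. -/
def dickson : MvPolynomial (Fin 2) F :=
  MvPolynomial.X 0 ^ p * MvPolynomial.X 1 - MvPolynomial.X 0 * MvPolynomial.X 1 ^ p

theorem dickson_isHomogeneous : (dickson p F).IsHomogeneous (p + 1) := by
  have h0 : ∀ i : Fin 2, (MvPolynomial.X i : MvPolynomial (Fin 2) F).IsHomogeneous 1 :=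
    MvPolynomial.isHomogeneous_X F
  refine ((MvPolynomial.isHomogeneous_X_pow _ p).mul (h0 1)).sub ?_
  rw [add_comm]
  exact (h0 0).mul (MvPolynomial.isHomogeneous_X_pow _ p)

theorem dehom_dickson : dehom (dickson p F) = X ^ p - X := by
  simp [dickson, dehom]

theorem dickson_ne_zero : dickson p F ≠ 0 := fun h => by
  have h1 := dehom_dickson (p := p) (F := F)
  rw [h, map_zero] at h1
  exact FiniteField.X_pow_card_sub_X_ne_zero F (Fact.out : p.Prime).one_lt h1.symm

theorem emb_pow_card (x : ZMod p) : emb F x ^ p = emb F x := by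
  rw [← map_pow, ZMod.pow_card]

theorem symAct_dickson (g : GL (Fin 2) (ZMod p)) :
    symAct (toMat F g) (dickson p F) = emb F g.1.det • dickson p F := by
  have hC : ∀ x : ZMod p, (MvPolynomial.C (emb F x) : MvPolynomial (Fin 2) F) ^ p =
      MvPolynomial.C (emb F x) := fun x => by rw [← map_pow, emb_pow_card]
  simp only [dickson, symAct, map_sub, map_mul, map_pow, MvPolynomial.aeval_X, Fin.sum_univ_two,
    toMat_apply, add_pow_char, mul_pow, hC, MvPolynomial.smul_eq_C_mul, Matrix.det_fin_two]
  ring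

theorem evalFun_dickson : evalFun p F (dickson p F) = 0 := by
  ext v
  simp [evalFun_apply, dickson, emb_pow_card]

/-- A binary form of degree `n` that vanishes on `𝔽_p²` is divisible by the Dickson invariant. -/
theorem exists_dickson_mul {n : ℕ} {h : MvPolynomial (Fin 2) F} (hh : h.IsHomogeneous n)
    (h0 : evalFun p F h = 0) :
    h = 0 ∨ (p + 1 ≤ n ∧ ∃ h', h'.IsHomogeneous (n - (p + 1)) ∧ dickson p F * h' = h) := by
  have hp : 1 < p := (Fact.out : p.Prime).one_lt
  set u := dehom h with hu
  have hroot : ∀ x : ZMod p, u.eval (emb F x) = 0 := fun x => by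
    rw [hu, ← evalFun_one, h0]; rfl
  have hcoef : u.coeff n = 0 := by rw [hu, ← evalFun_one_zero (p := p) hh, h0]; rfl
  have hmon : (X ^ p - X : F[X]).Monic := monic_X_pow_sub (by simpa using hp)
  have hmod : u %ₘ (X ^ p - X) = 0 := by
    refine eq_zero_of_eval_emb (p := p) ?_ fun x => ?_
    · have := natDegree_modByMonic_lt u hmon (by
        intro h1
        have := congrArg natDegree h1
        rw [FiniteField.X_pow_card_sub_X_natDegree_eq F hp, natDegree_one] at this
        omega)
      rwa [FiniteField.X_pow_card_sub_X_natDegree_eq F hp] at this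
    · have := congrArg (eval (emb F x)) (modByMonic_add_div u (X ^ p - X))
      simpa [hroot, emb_pow_card] using this
  have hfac : u = (X ^ p - X) * (u /ₘ (X ^ p - X)) := by
    conv_lhs => rw [← modByMonic_add_div u (X ^ p - X), hmod, zero_add]
  by_cases hu0 : u = 0
  · left
    rw [← homog_dehom hh, ← hu, hu0, map_zero]
  right
  have hq0 : u /ₘ (X ^ p - X) ≠ 0 := fun h1 => hu0 (by rw [hfac, h1, mul_zero])
  have hdeg : u.natDegree = p + (u /ₘ (X ^ p - X)).natDegree := by
    conv_lhs => rw [hfac]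
    rw [natDegree_mul hmon.ne_zero hq0, FiniteField.X_pow_card_sub_X_natDegree_eq F hp]
  have hlt : u.natDegree < n := by
    refine lt_of_le_of_ne (natDegree_dehom_le hh) fun h1 => ?_
    rw [← h1] at hcoef
    exact hu0 (leadingCoeff_eq_zero.1 hcoef)
  refine ⟨by omega, homog (n - (p + 1)) (u /ₘ (X ^ p - X)), homog_isHomogeneous _ _, ?_⟩
  have hhom : (dickson p F * homog (n - (p + 1)) (u /ₘ (X ^ p - X))).IsHomogeneous n := by
    have := dickson_isHomogeneous.mul (homog_isHomogeneous (n - (p + 1)) (u /ₘ (X ^ p - X)))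
    rwa [show p + 1 + (n - (p + 1)) = n by omega] at this
  refine eq_of_dehom_eq hhom hh ?_
  rw [map_mul, dehom_dickson, dehom_homog (by omega), ← hfac]

/-- Every homogeneous function of degree `n ≥ p` is given by a binary form of degree `n`. -/
theorem exists_evalFun_eq {n : ℕ} (hn : p ≤ n) {f : (Fin 2 → ZMod p) → F}
    (hf : f ∈ funSpace p F n) :
    ∃ h : MvPolynomial (Fin 2) F, h.IsHomogeneous n ∧ evalFun p F h = f := by
  have hp : 1 < p := (Fact.out : p.Prime).one_lt
  -- `r ≡ n` modulo `p - 1` with `1 ≤ r ≤ p - 1`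
  set r := (n - 1) % (p - 1) + 1 with hr
  have hrp : r < p := by have := Nat.mod_lt (n - 1) (show p - 1 > 0 by omega); omega
  have hrn : ∀ x : ZMod p, emb F x ^ n = emb F x ^ r := fun x => by
    by_cases hx : x = 0
    · rw [hx, map_zero, zero_pow (by omega), zero_pow (by omega)]
    · rw [← zpow_natCast, ← zpow_natCast]
      refine emb_zpow_congr ⟨(((n - 1) / (p - 1) : ℕ) : ℤ), ?_⟩ hx
      have h1 := Nat.mod_add_div (n - 1) (p - 1)
      have h2 : ((n - 1 : ℕ) : ℤ) = (n : ℤ) - 1 := by push_cast [show 1 ≤ n by omega]; ring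
      have h3 : ((p - 1 : ℕ) : ℤ) = (p : ℤ) - 1 := by push_cast [hp.le]; ring
      have h4 : (((n - 1) % (p - 1) : ℕ) : ℤ) = (r : ℤ) - 1 := by rw [hr]; push_cast; ring
      have h5 : (((n - 1) % (p - 1) : ℕ) : ℤ) + ((p - 1 : ℕ) : ℤ) * (((n - 1) / (p - 1) : ℕ) : ℤ) =
        ((n - 1 : ℕ) : ℤ) := by exact_mod_cast h1
      rw [h2, h3, h4] at h5
      linarith
  set L := Lagrange.interpolate Finset.univ (fun x : ZMod p => emb F x) (fun x => f ![x, 1]) with hL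
  have hinj : Set.InjOn (fun x : ZMod p => emb F x) (Finset.univ : Finset (ZMod p)) :=
    (emb_injective (p := p)).injOn
  have hLdeg : L.degree < p := by
    have := Lagrange.degree_interpolate_lt (fun x => f ![x, 1]) hinj
    rwa [Finset.card_univ, ZMod.card] at this
  set u := L + C (f ![1, 0]) * (X ^ n - X ^ r) with hu
  have hLn : L.coeff n = 0 := coeff_eq_zero_of_degree_lt (hLdeg.trans_le (by exact_mod_cast hn))
  have hun : u.coeff n = f ![1, 0] := by
    rw [hu, coeff_add, hLn, coeff_C_mul, coeff_sub, coeff_X_pow, coeff_X_pow, if_pos rfl,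
      if_neg (by omega)]
    ring
  have hud : u.natDegree ≤ n := by
    refine natDegree_add_le_of_degree_le ?_ ((natDegree_C_mul_le _ _).trans
      ((natDegree_sub_le _ _).trans ?_))
    · exact natDegree_le_of_degree_le (hLdeg.le.trans (by exact_mod_cast hn))
    · simp only [natDegree_X_pow]; omega
  refine ⟨homog n u, homog_isHomogeneous n u, sub_eq_zero.1 (eq_zero_of_mem_funSpace
    (Submodule.sub_mem _ (evalFun_mem (by omega) (homog_isHomogeneous n u)) hf) (fun x => ?_) ?_)⟩
  · rw [Pi.sub_apply, evalFun_one, dehom_homog hud, sub_eq_zero, hu]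
    simp only [eval_add, eval_mul, eval_C, eval_sub, eval_pow, eval_X, hrn, sub_self, mul_zero,
      add_zero]
    exact Lagrange.eval_interpolate_at_node _ hinj (Finset.mem_univ x)
  · rw [Pi.sub_apply, evalFun_one_zero (homog_isHomogeneous n u), dehom_homog hud, hun, sub_self]

end Functions

/-! ### Multiplicities in symmetric powers and principal series -/

section Sequences

variable {p : ℕ} [Fact p.Prime] {F : Type*} [Field F] [CharP F p]
  {P : Type*} [AddCommGroup P] [Module (MonoidAlgebra F (GL (Fin 2) (ZMod p)))ᵐᵒᵖ P]
  [Module F P] [IsScalarTower F (MonoidAlgebra F (GL (Fin 2) (ZMod p)))ᵐᵒᵖ P]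
  [Module.Finite (MonoidAlgebra F (GL (Fin 2) (ZMod p)))ᵐᵒᵖ P]
  [Module.Projective (MonoidAlgebra F (GL (Fin 2) (ZMod p)))ᵐᵒᵖ P]

theorem finrank_homSpace_bot {Γ E : Type*} [Group Γ] [AddCommGroup E] [Module F E]
    {P : Type*} [AddCommGroup P] [Module (MonoidAlgebra F Γ)ᵐᵒᵖ P] [Module F P]
    [IsScalarTower F (MonoidAlgebra F Γ)ᵐᵒᵖ P]
    (C : Subgroup Γ) (ρ : Γ → E →ₗ[F] E) : Module.finrank F (homSpace P C ρ ⊥) = 0 := by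
  have : Subsingleton (homSpace P C ρ ⊥) := ⟨fun β β' => by
    ext x
    rw [(Submodule.mem_bot F).1 (β.2.1 x), (Submodule.mem_bot F).1 (β'.2.1 x)]⟩
  exact Module.finrank_zero_of_subsingleton

theorem det_val_ne_zero (g : GL (Fin 2) (ZMod p)) : g.1.det ≠ 0 :=
  (Matrix.GeneralLinearGroup.det g).ne_zero

theorem emb_det_ne_zero (g : GL (Fin 2) (ZMod p)) : emb F g.1.det ≠ 0 :=
  (_root_.map_ne_zero (emb F)).2 (det_val_ne_zero g)

/-- The exact sequence `0 → Sym^{n-p-1} ⊗ det → Symⁿ → Fun_n → 0` given by multiplication by the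
Dickson invariant and evaluation, for `n ≥ p`; the first term is zero for `n = p`. -/
theorem finrank_homSpace_forms (n : ℕ) (hn : p ≤ n) (c : ℤ) :
    Module.finrank F (homSpace P ⊤ (formAct F (detPow F c))
      (MvPolynomial.homogeneousSubmodule (Fin 2) F n)) =
    (if n = p then 0 else Module.finrank F (homSpace P ⊤ (formAct F (detPow F (c + 1)))
      (MvPolynomial.homogeneousSubmodule (Fin 2) F (n - (p + 1))))) +
    Module.finrank F (homSpace P ⊤ (funAct F (detPow F c)) (funSpace p F n)) := by
  have hp : 1 < p := (Fact.out : p.Prime).one_lt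
  have key : ∀ X' : Submodule F (MvPolynomial (Fin 2) F),
      (∀ g : GL (Fin 2) (ZMod p), ∀ x ∈ X', formAct F (detPow F (c + 1)) g x ∈ X') →
      (∀ x ∈ X', dickson p F * x ∈ MvPolynomial.homogeneousSubmodule (Fin 2) F n) →
      (∀ x ∈ MvPolynomial.homogeneousSubmodule (Fin 2) F n, evalFun p F x = 0 →
        ∃ x' ∈ X', dickson p F * x' = x) →
      Module.finrank F (homSpace P ⊤ (formAct F (detPow F c))
        (MvPolynomial.homogeneousSubmodule (Fin 2) F n)) =
      Module.finrank F (homSpace P ⊤ (formAct F (detPow F (c + 1))) X') +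
      Module.finrank F (homSpace P ⊤ (funAct F (detPow F c)) (funSpace p F n)) :=
    fun X' h0 h1 h2 =>
    finrank_homSpace_add ⊤ (formAct F (detPow F (c + 1))) (formAct F (detPow F c))
      (funAct F (detPow F c)) X' _ (funSpace p F n) (LinearMap.mulLeft F (dickson p F))
      (evalFun p F) (fun g _ x hx => formAct_mem _ g hx)
      (fun g _ g' _ x _ => formAct_mul _ (detPow_mul c g g') x)
      (fun g _ x hx => h0 g x hx)
      (fun g _ x _ => by
        simp only [LinearMap.mulLeft_apply, formAct_apply, map_mul, symAct_dickson, detPow,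
          zpow_add_one₀ (emb_det_ne_zero (F := F) g)]
        simp only [smul_mul_assoc, mul_smul_comm, smul_smul])
      (fun g _ x _ => evalFun_formAct _ g x)
      (fun x _ h => (mul_eq_zero.1 h).resolve_left dickson_ne_zero) h1
      (fun x hx => evalFun_mem (by omega) hx)
      (fun x _ => by
        ext v
        rw [LinearMap.mulLeft_apply, evalFun_mul, evalFun_dickson, Pi.zero_apply, zero_mul])
      h2
      (fun y hy => exists_evalFun_eq hn hy)
  split_ifs with hnp
  · rw [key ⊥ (fun g x hx => by
      rw [(Submodule.mem_bot F).1 hx, map_zero]; exact Submodule.zero_mem _)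
      (fun x hx => by rw [(Submodule.mem_bot F).1 hx, mul_zero]; exact Submodule.zero_mem _)
      (fun x hx h0 => ?_), finrank_homSpace_bot]
    rcases exists_dickson_mul hx h0 with h | ⟨h, -⟩
    · exact ⟨0, Submodule.zero_mem _, by rw [h, mul_zero]⟩
    · omega
  · refine key _ (fun g x hx => formAct_mem _ g hx) (fun x hx => ?_) (fun x hx h0 => ?_)
    · have := (dickson_isHomogeneous (p := p)).mul hx
      rwa [show p + 1 + (n - (p + 1)) = n by omega] at this
    · rcases exists_dickson_mul hx h0 with h | ⟨-, h', hh', h⟩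
      · exact ⟨0, Submodule.zero_mem _, by rw [h, mul_zero]⟩
      · exact ⟨h', hh', h⟩

variable (p F) in
/-- The intertwining operator `f ↦ ∑_v f(v) (v₀ Y - v₁ X)^m` from functions on `𝔽_p²` to binary
forms of degree `m`. -/
def intertwiner (m : ℕ) : ((Fin 2 → ZMod p) → F) →ₗ[F] MvPolynomial (Fin 2) F :=
  Fintype.linearCombination F fun v : Fin 2 → ZMod p =>
    (emb F (v 0) • MvPolynomial.X 1 - emb F (v 1) • MvPolynomial.X 0) ^ m

theorem intertwiner_apply (m : ℕ) (f : (Fin 2 → ZMod p) → F) :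
    intertwiner p F m f = ∑ v, f v •
      (emb F (v 0) • MvPolynomial.X 1 - emb F (v 1) • MvPolynomial.X 0) ^ m := rfl

theorem intertwiner_mem (m : ℕ) (f : (Fin 2 → ZMod p) → F) :
    intertwiner p F m f ∈ MvPolynomial.homogeneousSubmodule (Fin 2) F m := by
  rw [intertwiner_apply]
  refine Submodule.sum_mem _ fun v _ => Submodule.smul_mem _ _ ?_
  have h0 : ∀ i : Fin 2, (MvPolynomial.X i : MvPolynomial (Fin 2) F) ∈
      MvPolynomial.homogeneousSubmodule (Fin 2) F 1 := MvPolynomial.isHomogeneous_X F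
  have h1 : (emb F (v 0) • MvPolynomial.X 1 - emb F (v 1) • MvPolynomial.X 0 :
      MvPolynomial (Fin 2) F).IsHomogeneous 1 :=
    Submodule.sub_mem _ (Submodule.smul_mem _ _ (h0 1)) (Submodule.smul_mem _ _ (h0 0))
  simpa using h1.pow m

theorem mulVec_bijective (g : GL (Fin 2) (ZMod p)) : Function.Bijective g.1.mulVec :=
  Finite.injective_iff_bijective.1 (Matrix.mulVec_injective_of_isUnit g.isUnit)

/-- The matrix `g` carries the linear form `u₀ Y - u₁ X` for `u = g v` to `det g` times the one for
`v`, and `det⁻ᵐ = det^b`. -/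
theorem intertwiner_funAct {b m : ℕ} (hbm : b + m = p - 1) (c : ℤ) (g : GL (Fin 2) (ZMod p))
    (f : (Fin 2 → ZMod p) → F) :
    intertwiner p F m (funAct F (detPow F c) g f) =
      formAct F (detPow F (c + b)) g (intertwiner p F m f) := by
  have hp : 1 < p := (Fact.out : p.Prime).one_lt
  have hdet := emb_det_ne_zero (F := F) g
  have h1 : detPow F (c + b) g * emb F g.1.det ^ m = detPow F c g := by
    rw [detPow, detPow, ← zpow_natCast, ← zpow_add₀ hdet]
    refine emb_zpow_congr ⟨1, ?_⟩ (det_val_ne_zero g)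
    have : (b : ℤ) + m = p - 1 := by have : ((p - 1 : ℕ) : ℤ) = p - 1 := by push_cast [hp.le]; ring
                                     rw [← this, ← hbm]; push_cast; ring
    linarith
  have hre := (mulVec_bijective g).sum_comp fun w => symAct (toMat F g) (f w •
    (emb F (w 0) • MvPolynomial.X 1 - emb F (w 1) • MvPolynomial.X 0) ^ m)
  rw [formAct_apply, intertwiner_apply, intertwiner_apply, map_sum, ← hre, Finset.smul_sum]
  refine Finset.sum_congr rfl fun v _ => ?_
  rw [funAct_apply, map_smul, smul_comm, ← h1, mul_comm, mul_smul, mul_smul]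
  congr 2
  rw [map_pow, ← _root_.smul_pow]
  congr 1
  simp only [symAct, map_sub, MvPolynomial.aeval_X, Fin.sum_univ_two, toMat_apply,
    MvPolynomial.algHom_C, MvPolynomial.algebraMap_eq, Matrix.mulVec, dotProduct, map_add, map_mul,
    MvPolynomial.smul_eq_C_mul, Matrix.det_fin_two]
  ring

/-- A monomial on the affine plane over `𝔽_p` sums to zero when its degree is too small for both
exponents to reach `p - 1`, as in the Chevalley-Warning theorem. -/
theorem sum_pow_mul_pow_eq_zero {i j : ℕ} (h : i + j < 2 * (p - 1)) :
    ∑ v : Fin 2 → ZMod p, v 0 ^ i * v 1 ^ j = 0 := by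
  have := MvPolynomial.sum_eval_eq_zero (σ := Fin 2) (K := ZMod p)
    (MvPolynomial.X 0 ^ i * MvPolynomial.X 1 ^ j) (by
      refine (MvPolynomial.totalDegree_mul _ _).trans_lt ?_
      rw [MvPolynomial.totalDegree_X_pow, MvPolynomial.totalDegree_X_pow, ZMod.card,
        Fintype.card_fin]
      omega)
  simpa using this

/-- The intertwining operator vanishes on the functions given by forms of complementary degree: in
the expansion every coefficient is a power sum of total degree `b + m = p - 1 < 2 (p - 1)`. -/
theorem intertwiner_evalFun {b m : ℕ} (hbm : b + m = p - 1) {h : MvPolynomial (Fin 2) F}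
    (hh : h.IsHomogeneous b) : intertwiner p F m (evalFun p F h) = 0 := by
  have hp : 1 < p := (Fact.out : p.Prime).one_lt
  rw [← homog_dehom hh, homog_apply, map_sum, map_sum]
  refine Finset.sum_eq_zero fun i hi => ?_
  have hib : i ≤ b := Nat.lt_succ_iff.1 (Finset.mem_range.1 hi)
  suffices hz : intertwiner p F m (evalFun p F
      (MvPolynomial.X 0 ^ i * MvPolynomial.X 1 ^ (b - i))) = 0 by
    rw [map_smul, map_smul, hz, smul_zero]
  rw [intertwiner_apply]
  simp only [sub_eq_add_neg, add_pow, Finset.smul_sum]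
  rw [Finset.sum_comm]
  refine Finset.sum_eq_zero fun j hj => ?_
  have hjm : j ≤ m := Nat.lt_succ_iff.1 (Finset.mem_range.1 hj)
  have h1 := congrArg (emb F) (sum_pow_mul_pow_eq_zero (p := p) (i := i + j)
    (j := (b - i) + (m - j)) (by omega))
  rw [map_sum, map_zero] at h1
  refine Eq.trans ?_ (zero_smul F (MvPolynomial.X 1 ^ j * (-MvPolynomial.X 0) ^ (m - j) *
    ((m.choose j : ℕ) : MvPolynomial (Fin 2) F)))
  rw [← h1, Finset.sum_smul]
  refine Finset.sum_congr rfl fun v _ => ?_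
  rw [evalFun_apply]
  simp only [map_mul, map_pow, MvPolynomial.eval_X, MvPolynomial.smul_eq_C_mul, pow_add]
  ring

/-- The function supported on the line `v₁ = 0` has a nonzero image, since `∑ x ^ (p - 1) = -1` over
`𝔽_p`. -/
theorem intertwiner_ne_zero {b m : ℕ} (hb : 1 ≤ b) (hbm : b + m = p - 1) :
    ∃ f ∈ funSpace p F b, intertwiner p F m f ≠ 0 := by
  have hp : 1 < p := (Fact.out : p.Prime).one_lt
  refine ⟨fun v => if v 1 = 0 then emb F (v 0) ^ b else 0, ⟨by simp; omega, fun c hc v => ?_⟩, ?_⟩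
  · simp [hc, mul_pow]
  · have hre := Fintype.sum_equiv (finTwoArrowEquiv (ZMod p))
      (fun v : Fin 2 → ZMod p => (if v 1 = 0 then emb F (v 0) ^ b else 0) •
        (emb F (v 0) • MvPolynomial.X 1 - emb F (v 1) • MvPolynomial.X 0 :
          MvPolynomial (Fin 2) F) ^ m)
      (fun w => (if w.2 = 0 then emb F w.1 ^ b else 0) •
        (emb F w.1 • MvPolynomial.X 1 - emb F w.2 • MvPolynomial.X 0) ^ m) (fun v => rfl)
    rw [intertwiner_apply, hre, Fintype.sum_prod_type]
    have h1 : ∀ x : ZMod p, ∑ y : ZMod p, (if y = 0 then emb F x ^ b else 0) •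
      (emb F x • MvPolynomial.X 1 - emb F y • MvPolynomial.X 0 :
        MvPolynomial (Fin 2) F) ^ m = emb F (x ^ (p - 1)) • MvPolynomial.X 1 ^ m := fun x => by
      rw [Finset.sum_eq_single 0]
      · simp [_root_.smul_pow, smul_smul, ← pow_add, hbm]
      · intro y _ hy
        simp [hy]
      · simp
    simp only [h1]
    rw [← Finset.sum_smul, ← map_sum]
    refine smul_ne_zero ((_root_.map_ne_zero _).2 ?_) (pow_ne_zero m (MvPolynomial.X_ne_zero 1))
    have h2 : ∑ x : ZMod p, x ^ (p - 1) = -1 := by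
      simp only [ZMod.pow_card_sub_one]
      rw [Finset.sum_ite, Finset.sum_const_zero, add_zero, Finset.sum_const, Finset.filter_ne',
        Finset.card_erase_of_mem (Finset.mem_univ _), Finset.card_univ, ZMod.card, nsmul_one,
        Nat.cast_sub hp.le]
      simp
    rw [h2]
    simp

/-- The exact sequence `0 → Sym^b → Fun_b → Sym^{p-1-b} ⊗ det^b → 0` for `1 ≤ b ≤ p - 1`. -/
theorem finrank_homSpace_fun {b m : ℕ} (hb : 1 ≤ b) (hbm : b + m = p - 1) (c : ℤ) :
    Module.finrank F (homSpace P ⊤ (funAct F (detPow F c)) (funSpace p F b)) =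
    Module.finrank F (homSpace P ⊤ (formAct F (detPow F c))
      (MvPolynomial.homogeneousSubmodule (Fin 2) F b)) +
    Module.finrank F (homSpace P ⊤ (formAct F (detPow F (c + b)))
      (MvPolynomial.homogeneousSubmodule (Fin 2) F m)) := by
  have hp : 1 < p := (Fact.out : p.Prime).one_lt
  have hinj : ∀ h ∈ MvPolynomial.homogeneousSubmodule (Fin 2) F b, evalFun p F h = 0 → h = 0 :=
    fun h hh h0 => (exists_dickson_mul hh h0).elim id fun h1 => by omega
  have himage : (funSpace p F b).map (intertwiner p F m) =
      MvPolynomial.homogeneousSubmodule (Fin 2) F m := by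
    refine forms_irreducible (p := p) (by omega) _ ?_ ?_ ?_
    · rintro _ ⟨f, -, rfl⟩
      exact intertwiner_mem m f
    · rintro g _ ⟨f, hf, rfl⟩
      refine ⟨funAct F (detPow F (-b)) g f, funAct_mem _ g hf, ?_⟩
      rw [intertwiner_funAct hbm, formAct_apply]
      simp [detPow]
    · obtain ⟨f, hf, h0⟩ := intertwiner_ne_zero (F := F) hb hbm
      intro h1
      have : intertwiner p F m f ∈ (funSpace p F b).map (intertwiner p F m) := ⟨f, hf, rfl⟩
      rw [h1, Submodule.mem_bot] at this
      exact h0 this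
  have hker : ∀ f ∈ funSpace p F b, intertwiner p F m f = 0 →
      ∃ h ∈ MvPolynomial.homogeneousSubmodule (Fin 2) F b, evalFun p F h = f := by
    let T : funSpace p F b →ₗ[F] MvPolynomial (Fin 2) F := (intertwiner p F m).domRestrict _
    let S : MvPolynomial.homogeneousSubmodule (Fin 2) F b →ₗ[F] funSpace p F b :=
      ((evalFun p F).domRestrict _).codRestrict _ fun h => evalFun_mem hb h.2
    have hS : Function.Injective S := LinearMap.ker_eq_bot.1 (LinearMap.ker_eq_bot'.2 fun h h0 =>
      Subtype.ext (hinj h.1 h.2 (congrArg Subtype.val h0)))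
    have hle : LinearMap.range S ≤ LinearMap.ker T := by
      rintro _ ⟨h, rfl⟩
      exact intertwiner_evalFun hbm h.2
    have hT : LinearMap.range T = MvPolynomial.homogeneousSubmodule (Fin 2) F m := by
      rw [← himage]
      ext y
      constructor
      · rintro ⟨f, rfl⟩; exact ⟨f.1, f.2, rfl⟩
      · rintro ⟨f, hf, rfl⟩; exact ⟨⟨f, hf⟩, rfl⟩
    have h1 := LinearMap.finrank_range_add_finrank_ker T
    rw [hT, finrank_forms] at h1
    have h2 := finrank_funSpace_le (p := p) (F := F) b
    have h3 : Module.finrank F (LinearMap.range S) = b + 1 := by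
      rw [LinearMap.finrank_range_of_inj hS, finrank_forms]
    have h4 := Submodule.eq_of_le_of_finrank_le hle (by omega)
    intro f hf hf0
    have h5 : (⟨f, hf⟩ : funSpace p F b) ∈ LinearMap.ker T := hf0
    rw [← h4] at h5
    obtain ⟨h, hh⟩ := h5
    exact ⟨h.1, h.2, congrArg Subtype.val hh⟩
  exact finrank_homSpace_add ⊤ (formAct F (detPow F c)) (funAct F (detPow F c))
    (formAct F (detPow F (c + b))) _ (funSpace p F b) _ (evalFun p F) (intertwiner p F m)
    (fun g _ x hx => funAct_mem _ g hx)
    (fun g _ g' _ x _ => funAct_mul _ (detPow_mul c g g') x)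
    (fun g _ x hx => formAct_mem _ g hx)
    (fun g _ x _ => evalFun_formAct _ g x)
    (fun g _ x _ => intertwiner_funAct hbm c g x)
    hinj
    (fun x hx => evalFun_mem hb hx)
    (fun x _ => intertwiner_mem m x)
    (fun x hx => intertwiner_evalFun hbm hx)
    hker
    (fun y hy => by
      rw [← himage] at hy
      exact hy)

end Sequences

/-! ### Restriction to the Borel subgroup -/

section Borel

variable {p : ℕ} [Fact p.Prime] {F : Type*} [Field F] [CharP F p]
  {P : Type*} [AddCommGroup P] [Module (MonoidAlgebra F (GL (Fin 2) (ZMod p)))ᵐᵒᵖ P]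
  [Module F P] [IsScalarTower F (MonoidAlgebra F (GL (Fin 2) (ZMod p)))ᵐᵒᵖ P]

variable (p) in
/-- The Borel subgroup of upper triangular matrices in `GL₂(𝔽_p)`. -/
def borel : Subgroup (GL (Fin 2) (ZMod p)) where
  carrier := {g | g 1 0 = 0}
  mul_mem' := by
    intro g h hg hh
    simp only [Set.mem_ofPred_eq] at hg hh ⊢
    simp [Matrix.mul_apply, Fin.sum_univ_two, hg, hh]
  one_mem' := by simp
  inv_mem' := by
    intro g hg
    simp only [Set.mem_ofPred_eq] at hg ⊢
    rw [Matrix.coe_units_inv, Matrix.inv_def, Matrix.adjugate_fin_two]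
    simp [hg]

theorem mem_borel {g : GL (Fin 2) (ZMod p)} : g ∈ borel p ↔ g 1 0 = 0 := Iff.rfl

theorem det_of_mem_borel {g : GL (Fin 2) (ZMod p)} (hg : g ∈ borel p) :
    g.1.det = g 0 0 * g 1 1 := by
  rw [Matrix.det_fin_two, mem_borel.1 hg, mul_zero, sub_zero]

theorem diag_ne_zero_of_mem_borel {g : GL (Fin 2) (ZMod p)} (hg : g ∈ borel p) :
    g 0 0 ≠ 0 ∧ g 1 1 ≠ 0 := by
  have h := (Matrix.GeneralLinearGroup.det g).ne_zero
  change g.1.det ≠ 0 at h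
  rw [det_of_mem_borel hg] at h
  exact mul_ne_zero_iff.1 h

variable (F) in
/-- The character `(α β; 0 δ) ↦ αⁱ δʲ` of the Borel subgroup. -/
def torusPow (i j : ℤ) (g : GL (Fin 2) (ZMod p)) : F := emb F (g 0 0) ^ i * emb F (g 1 1) ^ j

theorem torusPow_mul (i j : ℤ) {g h : GL (Fin 2) (ZMod p)} (hg : g ∈ borel p) (hh : h ∈ borel p) :
    torusPow F i j (g * h) = torusPow F i j g * torusPow F i j h := by
  have h0 : (g * h) 0 0 = g 0 0 * h 0 0 := by
    simp [Matrix.mul_apply, Fin.sum_univ_two, mem_borel.1 hh]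
  have h1 : (g * h) 1 1 = g 1 1 * h 1 1 := by
    simp [Matrix.mul_apply, Fin.sum_univ_two, mem_borel.1 hg]
  rw [torusPow, torusPow, torusPow, h0, h1, map_mul, map_mul, mul_zpow, mul_zpow]
  ring

variable (F) in
/-- The scalar action of the Borel subgroup on a line through the character `αⁱ δʲ`. -/
def lineAct (i j : ℤ) (g : GL (Fin 2) (ZMod p)) : F →ₗ[F] F := torusPow F i j g • LinearMap.id

theorem lineAct_apply (i j : ℤ) (g : GL (Fin 2) (ZMod p)) (x : F) :
    lineAct F i j g x = torusPow F i j g * x := rfl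

theorem mulVec_one_zero (g : GL (Fin 2) (ZMod p)) : g.1.mulVec ![1, 0] = ![g 0 0, g 1 0] := by
  ext i
  fin_cases i <;> simp [Matrix.mulVec, dotProduct]

theorem exists_mulVec_eq {v : Fin 2 → ZMod p} (hv : v ≠ 0) :
    ∃ g : GL (Fin 2) (ZMod p), g.1.mulVec ![1, 0] = v := by
  by_cases h0 : v 0 = 0
  · have h1 : v 1 ≠ 0 := fun h1 => hv (by ext i; fin_cases i <;> simp [h0, h1])
    refine ⟨Matrix.GeneralLinearGroup.mkOfDetNeZero !![v 0, 1; v 1, 0] (by simpa using h1), ?_⟩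
    rw [mulVec_one_zero]
    ext i
    fin_cases i <;> rfl
  · refine ⟨Matrix.GeneralLinearGroup.mkOfDetNeZero !![v 0, 0; v 1, 1] (by simpa using h0), ?_⟩
    rw [mulVec_one_zero]
    ext i
    fin_cases i <;> rfl

/-- If two group elements have the same first column, they differ by an upper triangular matrix
with first entry `1`. -/
theorem mem_borel_of_mulVec_eq {g h : GL (Fin 2) (ZMod p)} {c : ZMod p}
    (e : h.1.mulVec ![1, 0] = c • g.1.mulVec ![1, 0]) :
    g⁻¹ * h ∈ borel p ∧ (g⁻¹ * h) 0 0 = c := by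
  have h1 : (g⁻¹ * h).1.mulVec ![1, 0] = c • ![1, 0] := by
    rw [Units.val_mul, ← Matrix.mulVec_mulVec, e, Matrix.mulVec_smul, Matrix.mulVec_mulVec,
      ← Units.val_mul, inv_mul_cancel, Units.val_one, Matrix.one_mulVec]
  rw [mulVec_one_zero] at h1
  exact ⟨mem_borel.2 (by simpa using congrFun h1 1), by simpa using congrFun h1 0⟩

/-- Frobenius reciprocity: evaluation at the vector `(1, 0)` identifies equivariant maps to the
principal series `Fun_n ⊗ det^c` with Borel-equivariant maps to the line `α^{n+c} δ^c`. -/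
theorem finrank_homSpace_frobenius (n c : ℤ) :
    Module.finrank F (homSpace P ⊤ (funAct F (detPow F c)) (funSpace p F n)) =
      Module.finrank F (homSpace P (borel p) (lineAct F (n + c) c) ⊤) := by
  have hcol : ∀ (β : P →ₗ[F] ((Fin 2 → ZMod p) → F)),
      β ∈ homSpace P ⊤ (funAct F (detPow F c)) (funSpace p F n) → ∀ g x,
      β (act F g x) ![1, 0] = detPow F c g * β x (g.1.mulVec ![1, 0]) := fun β hβ g x => by
    rw [hβ.2 g (Subgroup.mem_top g), funAct_apply]
  let Φ : homSpace P ⊤ (funAct F (detPow F c)) (funSpace p F n) →ₗ[F]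
      homSpace P (borel p) (lineAct F (n + c) c) ⊤ :=
    { toFun := fun β => ⟨(LinearMap.proj ![1, 0]) ∘ₗ β.1, fun _ => Submodule.mem_top,
        fun g hg x => by
          change β.1 (act F g x) ![1, 0] = lineAct F (n + c) c g (β.1 x ![1, 0])
          have h0 := diag_ne_zero_of_mem_borel hg
          have h1 : g.1.mulVec ![1, 0] = g 0 0 • ![1, 0] := by
            rw [mulVec_one_zero, mem_borel.1 hg]
            ext i
            fin_cases i <;> simp
          rw [hcol β.1 β.2, h1, (β.2.1 x).2 _ h0.1, lineAct_apply, torusPow, detPow,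
            det_of_mem_borel hg, map_mul, mul_zpow,
            zpow_add₀ ((_root_.map_ne_zero (emb F)).2 h0.1)]
          ring⟩
      map_add' := fun _ _ => by ext; rfl
      map_smul' := fun _ _ => by ext; rfl }
  have hker : ∀ β, Φ β = 0 → β = 0 := fun β h0 => by
    ext x v
    have h1 : ∀ y, β.1 y ![1, 0] = 0 := fun y =>
      congrArg (fun l : homSpace P (borel p) (lineAct F (n + c) c) ⊤ => l.1 y) h0
    by_cases hv : v = 0
    · rw [hv, (β.2.1 x).1]; rfl
    · obtain ⟨g, rfl⟩ := exists_mulVec_eq hv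
      have h2 := hcol β.1 β.2 g x
      rw [h1] at h2
      exact (mul_eq_zero.1 h2.symm).resolve_left (zpow_ne_zero _ (emb_det_ne_zero g))
  have hsurj : Function.Surjective Φ := fun l => by
    choose! γ hγ using fun v (hv : v ≠ 0) => exists_mulVec_eq (p := p) hv
    have hdet0 : ∀ g : GL (Fin 2) (ZMod p), detPow F c g ≠ 0 := fun g =>
      zpow_ne_zero _ (emb_det_ne_zero g)
    -- the value at `e · v` computed from a representative of `v`
    have key : ∀ (g h : GL (Fin 2) (ZMod p)) (e : ZMod p),
        h.1.mulVec ![1, 0] = e • g.1.mulVec ![1, 0] → ∀ x,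
        (detPow F c h)⁻¹ * l.1 (act F h x) =
          emb F e ^ n * ((detPow F c g)⁻¹ * l.1 (act F g x)) := fun g h e hgh x => by
      obtain ⟨hb, hbe⟩ := mem_borel_of_mulVec_eq hgh
      have h0 := diag_ne_zero_of_mem_borel hb
      have h1 := l.2.2 _ hb (act F g x)
      rw [← act_mul, mul_inv_cancel_left, lineAct_apply] at h1
      have h2 : detPow F c h = detPow F c g * detPow F c (g⁻¹ * h) := by
        rw [← detPow_mul, mul_inv_cancel_left]
      have h3 : torusPow F (n + c) c (g⁻¹ * h) = emb F e ^ n * detPow F c (g⁻¹ * h) := by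
        rw [torusPow, detPow, det_of_mem_borel hb, map_mul, mul_zpow,
          zpow_add₀ ((_root_.map_ne_zero (emb F)).2 h0.1), hbe]
        ring
      rw [h1, h2, h3, mul_inv]
      have := hdet0 (g⁻¹ * h)
      field_simp
    let β : P →ₗ[F] ((Fin 2 → ZMod p) → F) :=
      { toFun := fun x v => if v = 0 then 0 else (detPow F c (γ v))⁻¹ * l.1 (act F (γ v) x)
        map_add' := fun x y => by
          ext v
          by_cases hv : v = 0 <;> simp [hv, act_add, mul_add]
        map_smul' := fun a x => by
          ext v
          by_cases hv : v = 0
          · simp [hv]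
          · simp only [hv, if_false, act_smul, map_smul, smul_eq_mul, RingHom.id_apply,
              Pi.smul_apply]
            ring }
    have hβval : ∀ x (g : GL (Fin 2) (ZMod p)),
        β x (g.1.mulVec ![1, 0]) = (detPow F c g)⁻¹ * l.1 (act F g x) := fun x g => by
      have hne : g.1.mulVec ![1, 0] ≠ 0 := fun h0 => by
        have := (mulVec_bijective g).1 (h0.trans (Matrix.mulVec_zero _).symm)
        simpa using congrFun this 0
      change (if g.1.mulVec ![1, 0] = 0 then 0 else _) = _
      rw [if_neg hne, key g (γ (g.1.mulVec ![1, 0])) 1 (by rw [hγ _ hne, one_smul])]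
      simp
    have hβ0 : ∀ x, β x 0 = 0 := fun x => if_pos rfl
    refine ⟨⟨β, fun x => ⟨hβ0 x, fun e he v => ?_⟩, fun g _ x => ?_⟩, ?_⟩
    · by_cases hv : v = 0
      · rw [hv, smul_zero, hβ0, mul_zero]
      · obtain ⟨g, rfl⟩ := exists_mulVec_eq hv
        have hev : e • g.1.mulVec ![1, 0] ≠ 0 := smul_ne_zero he hv
        obtain ⟨h, hh⟩ := exists_mulVec_eq hev
        rw [← hh, hβval, hβval, key g h e hh]
    · ext v
      rw [funAct_apply]
      by_cases hv : v = 0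
      · rw [hv, Matrix.mulVec_zero, hβ0, hβ0, mul_zero]
      · obtain ⟨h, rfl⟩ := exists_mulVec_eq hv
        rw [Matrix.mulVec_mulVec, ← Units.val_mul, hβval, hβval, detPow_mul, ← act_mul, mul_inv]
        have := hdet0 g
        field_simp
    · ext x
      change β x ![1, 0] = l.1 x
      have := hβval x 1
      rw [Units.val_one, Matrix.one_mulVec, act_one] at this
      rw [this]
      simp [detPow]
  exact (LinearEquiv.ofBijective Φ ⟨fun β β' h =>
    sub_eq_zero.1 (hker _ (by rw [map_sub, h, sub_self])), hsurj⟩).finrank_eq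

theorem symAct_X_one_of_mem_borel {g : GL (Fin 2) (ZMod p)} (hg : g ∈ borel p) :
    symAct (toMat F g) (MvPolynomial.X 1) = emb F (g 1 1) • MvPolynomial.X 1 := by
  simp [symAct, Fin.sum_univ_two, toMat_apply, mem_borel.1 hg, MvPolynomial.smul_eq_C_mul]

variable [Module.Finite (MonoidAlgebra F (GL (Fin 2) (ZMod p)))ᵐᵒᵖ P]
  [Module.Projective (MonoidAlgebra F (GL (Fin 2) (ZMod p)))ᵐᵒᵖ P]

/-- The exact sequence `0 → Sym^{n-1} ⊗ δ → Symⁿ → αⁿ → 0` of representations of the Borel subgroup,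
given by multiplication by `Y` and evaluation at `(1, 0)`. -/
theorem finrank_homSpace_borel_step (n : ℕ) (u v : ℤ) :
    Module.finrank F (homSpace P (borel p) (formAct F (torusPow F u v))
      (MvPolynomial.homogeneousSubmodule (Fin 2) F n)) =
    (if n = 0 then 0 else Module.finrank F (homSpace P (borel p) (formAct F (torusPow F u (v + 1)))
      (MvPolynomial.homogeneousSubmodule (Fin 2) F (n - 1)))) +
    Module.finrank F (homSpace P (borel p) (lineAct F (n + u) v) ⊤) := by
  let f : MvPolynomial (Fin 2) F →ₗ[F] F := (MvPolynomial.aeval ![1, 0]).toLinearMap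
  have hf : ∀ h, f h = MvPolynomial.eval ![1, 0] h := fun h => by
    simp [f, MvPolynomial.aeval_eq_eval]
  have key : ∀ X' : Submodule F (MvPolynomial (Fin 2) F),
      (∀ g : GL (Fin 2) (ZMod p), ∀ x ∈ X', formAct F (torusPow F u (v + 1)) g x ∈ X') →
      (∀ x ∈ X', MvPolynomial.X 1 * x ∈ MvPolynomial.homogeneousSubmodule (Fin 2) F n) →
      (∀ x ∈ MvPolynomial.homogeneousSubmodule (Fin 2) F n, f x = 0 →
        ∃ x' ∈ X', MvPolynomial.X 1 * x' = x) →
      Module.finrank F (homSpace P (borel p) (formAct F (torusPow F u v))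
        (MvPolynomial.homogeneousSubmodule (Fin 2) F n)) =
      Module.finrank F (homSpace P (borel p) (formAct F (torusPow F u (v + 1))) X') +
      Module.finrank F (homSpace P (borel p) (lineAct F (n + u) v) ⊤) := fun X' h0 h1 h2 =>
    finrank_homSpace_add (borel p) (formAct F (torusPow F u (v + 1))) (formAct F (torusPow F u v))
      (lineAct F (n + u) v) X' _ ⊤ (LinearMap.mulLeft F (MvPolynomial.X 1)) f
      (fun g _ x hx => formAct_mem _ g hx)
      (fun g hg g' hg' x _ => formAct_mul _ (torusPow_mul u v hg hg') x)
      (fun g _ x hx => h0 g x hx)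
      (fun g hg x _ => by
        have hd := (_root_.map_ne_zero (emb F)).2 (diag_ne_zero_of_mem_borel hg).2
        simp only [LinearMap.mulLeft_apply, formAct_apply, map_mul, symAct_X_one_of_mem_borel hg,
          torusPow, zpow_add_one₀ hd]
        simp only [smul_mul_assoc, mul_smul_comm, smul_smul, mul_assoc])
      (fun g hg x hx => by
        have h0 := diag_ne_zero_of_mem_borel hg
        have hvec : (toMat F g).mulVec ![1, 0] = emb F (g 0 0) • ![1, 0] := by
          ext i
          fin_cases i <;>
            simp [Matrix.mulVec, dotProduct, toMat_apply, mem_borel.1 hg]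
        rw [hf, hf, formAct_apply, MvPolynomial.smul_eval, eval_symAct, hvec, eval_smul_vec hx,
          lineAct_apply, torusPow, torusPow, zpow_add₀ ((_root_.map_ne_zero (emb F)).2 h0.1),
          zpow_natCast]
        ring)
      (fun x _ h => (mul_eq_zero.1 h).resolve_left (MvPolynomial.X_ne_zero 1)) h1
      (fun _ _ => Submodule.mem_top)
      (fun x _ => by rw [hf, LinearMap.mulLeft_apply, map_mul]; simp)
      h2
      (fun y _ => ⟨y • MvPolynomial.X 0 ^ n, Submodule.smul_mem _ _ (X_pow_mem_forms 0 n), by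
        rw [map_smul, hf]; simp⟩)
  have hcoef : ∀ x ∈ MvPolynomial.homogeneousSubmodule (Fin 2) F n, f x = 0 →
      (dehom x).coeff n = 0 := fun x hx h0 => by
    rw [← eval_one_zero_eq_coeff hx, ← hf, h0]
  split_ifs with hn
  · rw [key ⊥ (fun g x hx => by
      rw [(Submodule.mem_bot F).1 hx, map_zero]; exact Submodule.zero_mem _)
      (fun x hx => by rw [(Submodule.mem_bot F).1 hx, mul_zero]; exact Submodule.zero_mem _)
      (fun x hx h0 => ⟨0, Submodule.zero_mem _, ?_⟩), finrank_homSpace_bot]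
    have h1 := hcoef x hx h0
    have h2 := natDegree_dehom_le hx
    subst hn
    rw [← homog_dehom hx, eq_C_of_natDegree_le_zero h2, h1, C_0, map_zero, mul_zero]
  · refine key _ (fun g x hx => formAct_mem _ g hx) (fun x hx => ?_) (fun x hx h0 => ?_)
    · have := (MvPolynomial.isHomogeneous_X F (1 : Fin 2)).mul hx
      rwa [show 1 + (n - 1) = n by omega] at this
    · have h1 := hcoef x hx h0
      have h2 : (dehom x).natDegree ≤ n - 1 := by
        refine natDegree_le_iff_coeff_eq_zero.2 fun N hN => ?_
        rcases eq_or_ne N n with rfl | hNn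
        · exact h1
        · exact coeff_eq_zero_of_natDegree_lt ((natDegree_dehom_le hx).trans_lt (by omega))
      refine ⟨homog (n - 1) (dehom x), homog_isHomogeneous _ _, eq_of_dehom_eq (n := n) ?_ hx ?_⟩
      · have := (MvPolynomial.isHomogeneous_X F (1 : Fin 2)).mul
          (homog_isHomogeneous (n - 1) (dehom x))
        rwa [show 1 + (n - 1) = n by omega] at this
      · rw [map_mul, dehom_X_one, one_mul, dehom_homog h2]

/-- The restriction of `Symⁿ` to the Borel subgroup is filtered by the lines `αⁱ δ^{n-i}` for `0 ≤ i
≤ n`. -/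
theorem finrank_homSpace_borel (n : ℕ) (u v : ℤ) :
    Module.finrank F (homSpace P (borel p) (formAct F (torusPow F u v))
      (MvPolynomial.homogeneousSubmodule (Fin 2) F n)) =
    ∑ i ∈ Finset.range (n + 1),
      Module.finrank F (homSpace P (borel p) (lineAct F (i + u) (n - i + v)) ⊤) := by
  induction n generalizing v with
  | zero =>
    rw [finrank_homSpace_borel_step, if_pos rfl, zero_add, zero_add, Finset.sum_range_one,
      show ((0 : ℕ) : ℤ) - ((0 : ℕ) : ℤ) + v = v by ring]
  | succ n ih =>
    rw [finrank_homSpace_borel_step, if_neg (by omega), Nat.add_sub_cancel, ih,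
      Finset.sum_range_succ _ (n + 1)]
    congr 1
    · refine Finset.sum_congr rfl fun i _ => ?_
      rw [show (n : ℤ) - i + (v + 1) = ((n + 1 : ℕ) : ℤ) - i + v by push_cast; ring]
    · rw [sub_self, zero_add]

end Borel

/-! ### Multiplicities as numbers of lattice points -/

section Counting

variable (p : ℕ) (a s : ℤ)

/-- The degrees `i ≡ s` or `i ≡ a + s` modulo `p - 1`, which index the power basis of abstract
classical forms. -/
def IsDeg (i : ℤ) : Prop := ((p : ℤ) - 1) ∣ i - s ∨ ((p : ℤ) - 1) ∣ i - a - s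

open Classical in
/-- The least `N ≡ a + 2 s` modulo `p - 1` such that the Serre weight attached to the degree `i`
occurs in `Sym^N`: a degree `i` as in `IsDeg` contributes to the unramified forms of weight `N + 2`
if and only if `threshold i ≤ N`. -/
def threshold (i : ℤ) : ℤ :=
  (p + 1) * i + if ((p : ℤ) - 1) ∣ i - s then a else 2 * ((p : ℤ) - 1) - a

variable {p a s}

theorem isDeg_shift (i : ℤ) : IsDeg p a s (i + 1) ↔ IsDeg p a (s - 1) i := by
  simp only [IsDeg]
  rw [show i + 1 - s = i - (s - 1) by ring, show i + 1 - a - s = i - a - (s - 1) by ring]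

theorem threshold_shift (i : ℤ) : threshold p a s (i + 1) = threshold p a (s - 1) i + (p + 1) := by
  simp only [threshold]
  rw [show i + 1 - s = i - (s - 1) by ring]
  ring

theorem threshold_ge (ha1 : 1 ≤ a) (ha2 : a + 1 < p) (i : ℤ) :
    (p + 1) * i + 1 ≤ threshold p a s i := by
  simp only [threshold]
  split_ifs <;> linarith

end Counting

section Multiplicity

variable {p : ℕ} [Fact p.Prime] {F : Type*} [Field F] [CharP F p]
  {P : Type*} [AddCommGroup P] [Module (MonoidAlgebra F (GL (Fin 2) (ZMod p)))ᵐᵒᵖ P]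
  [Module F P] [IsScalarTower F (MonoidAlgebra F (GL (Fin 2) (ZMod p)))ᵐᵒᵖ P]
  [Module.Finite (MonoidAlgebra F (GL (Fin 2) (ZMod p)))ᵐᵒᵖ P]
  [Module.Projective (MonoidAlgebra F (GL (Fin 2) (ZMod p)))ᵐᵒᵖ P]
  {a : ℕ} {π : P →ₗ[F] MvPolynomial (Fin 2) F}

theorem eq_of_dvd_sub {q x y : ℤ} (h : q ∣ x - y) (h1 : x - y < q) (h2 : -q < x - y) : x = y := by
  have := Int.eq_zero_of_abs_lt_dvd h (by rw [abs_lt]; exact ⟨h2, h1⟩)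
  omega

open Classical in
/-- The restriction of the projective envelope of `Sym^a` to the Borel subgroup sees exactly the two
characters `α^a` and `δ^a` of the torus. -/
theorem IsCover.finrank_line (hπ : IsCover (p := p) a π) (ha1 : 1 ≤ a) (ha2 : a + 1 < p)
    (i j : ℤ) :
    Module.finrank F (homSpace P (borel p) (lineAct F i j) ⊤) =
      (if ((p : ℤ) - 1) ∣ i - a ∧ ((p : ℤ) - 1) ∣ j then 1 else 0) +
      (if ((p : ℤ) - 1) ∣ i ∧ ((p : ℤ) - 1) ∣ j - a then 1 else 0) := by
  have hp : 1 < p := (Fact.out : p.Prime).one_lt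
  have hq : 0 < (p : ℤ) - 1 := by omega
  -- the representative of `i - j` in `{1, …, p - 1}`
  obtain ⟨b, hb⟩ : ∃ b : ℕ, (b : ℤ) = (i - j - 1) % ((p : ℤ) - 1) + 1 :=
    ⟨((i - j - 1) % ((p : ℤ) - 1) + 1).toNat, by
      have := Int.emod_nonneg (i - j - 1) hq.ne'
      omega⟩
  have hb1 := Int.emod_nonneg (i - j - 1) hq.ne'
  have hb2 := Int.emod_lt_of_pos (i - j - 1) hq
  have hbd : ((p : ℤ) - 1) ∣ (i - j) - b := by
    have := Int.dvd_self_sub_emod (x := i - j - 1) (m := (p : ℤ) - 1)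
    rwa [show i - j - b = i - j - 1 - (i - j - 1) % ((p : ℤ) - 1) by rw [hb]; ring]
  obtain ⟨m, hm⟩ : ∃ m : ℕ, b + m = p - 1 := ⟨p - 1 - b, by omega⟩
  have hm' : (b : ℤ) + m = (p : ℤ) - 1 := by omega
  have h1 := finrank_homSpace_frobenius (P := P) (F := F) (p := p) (i - j) j
  rw [sub_add_cancel] at h1
  rw [← h1, funSpace_congr hbd, finrank_homSpace_fun (by omega) hm,
    hπ.finrank_forms_small ha1 ha2 (by omega), hπ.finrank_forms_small ha1 ha2 (by omega)]
  congr 1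
  · refine if_congr (and_congr_left fun hj => ⟨fun h => ?_, fun h => ?_⟩) rfl rfl
    · have := dvd_add hbd hj
      rwa [h, show i - j - (a : ℤ) + j = i - a by ring] at this
    · have := dvd_sub (dvd_sub h hj) hbd
      rw [show i - a - j - (i - j - b) = (b : ℤ) - a by ring] at this
      exact_mod_cast eq_of_dvd_sub this (by omega) (by omega)
  · refine if_congr ⟨fun ⟨h, hj⟩ => ?_, fun ⟨hi, hj⟩ => ?_⟩ rfl rfl
    · have h3 : ((p : ℤ) - 1) ∣ i := by
        have := dvd_add hbd hj
        rwa [show i - j - (b : ℤ) + (j + b) = i by ring] at this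
      refine ⟨h3, ?_⟩
      have := dvd_sub hj (dvd_refl ((p : ℤ) - 1))
      have h4 : j + (b : ℤ) - ((p : ℤ) - 1) = j - a := by rw [← hm', h]; ring
      rwa [h4] at this
    · refine ⟨?_, ?_⟩
      · have := dvd_sub (dvd_add (dvd_sub hbd hi) hj) (dvd_neg.2 (dvd_refl ((p : ℤ) - 1)))
        rw [show i - j - (b : ℤ) - i + (j - a) - -((p : ℤ) - 1) = m - a by rw [← hm']; ring] at this
        exact_mod_cast eq_of_dvd_sub this (by omega) (by omega)
      · have := dvd_sub hi hbd
        rwa [show i - (i - j - (b : ℤ)) = j + b by ring] at this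

open Classical in
/-- The multiplicity of the Borel representation `Symⁿ ⊗ α^u δ^v`. -/
theorem IsCover.finrank_borel (hπ : IsCover (p := p) a π) (ha1 : 1 ≤ a) (ha2 : a + 1 < p)
    (n : ℕ) (s v : ℤ) (hn : ((p : ℤ) - 1) ∣ n - s + v - a) :
    Module.finrank F (homSpace P (borel p) (formAct F (torusPow F (-s) v))
      (MvPolynomial.homogeneousSubmodule (Fin 2) F n)) =
      ((Finset.range (n + 1)).filter fun i : ℕ => IsDeg p a s (i : ℤ)).card := by
  rw [finrank_homSpace_borel, Finset.card_filter]
  refine Finset.sum_congr rfl fun i _ => ?_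
  rw [hπ.finrank_line ha1 ha2]
  have hna : ¬ ((p : ℤ) - 1) ∣ a := fun h => by
    have := Int.le_of_dvd (by omega) h
    omega
  have e1 : (((p : ℤ) - 1) ∣ (i : ℤ) + -s - a ∧ ((p : ℤ) - 1) ∣ (n : ℤ) - i + v) ↔
      ((p : ℤ) - 1) ∣ (i : ℤ) - a - s := by
    rw [show (i : ℤ) + -s - a = i - a - s by ring]
    refine ⟨fun h => h.1, fun h => ⟨h, ?_⟩⟩
    have := dvd_sub hn h
    rwa [show (n : ℤ) - s + v - a - (i - a - s) = n - i + v by ring] at this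
  have e2 : (((p : ℤ) - 1) ∣ (i : ℤ) + -s ∧ ((p : ℤ) - 1) ∣ (n : ℤ) - i + v - a) ↔
      ((p : ℤ) - 1) ∣ (i : ℤ) - s := by
    rw [← sub_eq_add_neg]
    refine ⟨fun h => h.1, fun h => ⟨h, ?_⟩⟩
    have := dvd_sub hn h
    rwa [show (n : ℤ) - s + v - a - (i - s) = n - i + v - a by ring] at this
  rw [if_congr e1 rfl rfl, if_congr e2 rfl rfl]
  by_cases h1 : ((p : ℤ) - 1) ∣ (i : ℤ) - s
  · have h2 : ¬ ((p : ℤ) - 1) ∣ (i : ℤ) - a - s := fun h2 => hna (by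
      have := dvd_sub h1 h2
      rwa [show (i : ℤ) - s - (i - a - s) = a by ring] at this)
    simp [IsDeg, h1, h2]
  · by_cases h2 : ((p : ℤ) - 1) ∣ (i : ℤ) - a - s <;> simp [IsDeg, h1, h2]

open Classical in
/-- The multiplicity of `Symⁿ ⊗ det^{-s}`. -/
theorem IsCover.finrank_forms (hπ : IsCover (p := p) a π) (ha1 : 1 ≤ a) (ha2 : a + 1 < p)
    (n : ℕ) (s : ℤ) (hn : ((p : ℤ) - 1) ∣ n - a - 2 * s) (M : ℕ) (hM : n < M) :
    Module.finrank F (homSpace P ⊤ (formAct F (detPow F (-s)))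
      (MvPolynomial.homogeneousSubmodule (Fin 2) F n)) =
      ((Finset.range M).filter fun i : ℕ =>
        IsDeg p a s (i : ℤ) ∧ threshold p a s i ≤ n).card := by
  have hp : 1 < p := (Fact.out : p.Prime).one_lt
  have hna : ¬ ((p : ℤ) - 1) ∣ a := fun h => by
    have := Int.le_of_dvd (by omega) h
    omega
  induction n using Nat.strong_induction_on generalizing s M with
  | _ n ih =>
  obtain ⟨M, rfl⟩ : ∃ M', M = M' + 1 := ⟨M - 1, by omega⟩
  have hsplit : ((Finset.range (M + 1)).filter fun i : ℕ =>
      IsDeg p a s (i : ℤ) ∧ threshold p a s i ≤ n).card =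
      ((Finset.range M).filter fun i : ℕ =>
        IsDeg p a (s - 1) (i : ℤ) ∧ threshold p a (s - 1) i ≤ (n : ℤ) - (p + 1)).card +
      if IsDeg p a s 0 ∧ threshold p a s 0 ≤ n then 1 else 0 := by
    rw [Finset.card_filter, Finset.card_filter, Finset.sum_range_succ']
    congr 1
    refine Finset.sum_congr rfl fun i _ => ?_
    refine if_congr ?_ rfl rfl
    push_cast
    rw [isDeg_shift, threshold_shift, le_sub_iff_add_le]
  have hempty : (n : ℤ) - (p + 1) < 0 → ((Finset.range M).filter fun i : ℕ =>
      IsDeg p a (s - 1) (i : ℤ) ∧ threshold p a (s - 1) i ≤ (n : ℤ) - (p + 1)).card = 0 :=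
    fun hneg => by
    rw [Finset.card_eq_zero, Finset.filter_eq_empty_iff]
    rintro i - ⟨-, h⟩
    have h1 := threshold_ge (p := p) (a := a) (s := s - 1) (by omega) (by omega) i
    have h2 : 0 ≤ ((p : ℤ) + 1) * i := by positivity
    linarith
  rw [hsplit]
  rcases Nat.lt_or_ge n p with hnp | hnp
  · rw [hπ.finrank_forms_small ha1 ha2 hnp, hempty (by omega), zero_add]
    refine if_congr ?_ rfl rfl
    simp only [threshold, IsDeg, mul_zero, zero_add, zero_sub, dvd_neg]
    constructor
    · rintro ⟨rfl, h⟩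
      exact ⟨Or.inl h, by rw [if_pos h]⟩
    · rintro ⟨-, h⟩
      split_ifs at h with hs
      · refine ⟨?_, hs⟩
        have := dvd_add hn (hs.mul_left 2)
        rw [show (n : ℤ) - a - 2 * s + 2 * s = n - a by ring] at this
        exact_mod_cast eq_of_dvd_sub this (by omega) (by omega)
      · omega
  · have hfun : Module.finrank F (homSpace P ⊤ (funAct F (detPow F (-s))) (funSpace p F n)) =
        if IsDeg p a s 0 ∧ threshold p a s 0 ≤ n then 1 else 0 := by
      rw [finrank_homSpace_frobenius, hπ.finrank_line ha1 ha2]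
      have e1 : (((p : ℤ) - 1) ∣ (n : ℤ) + -s - a ∧ ((p : ℤ) - 1) ∣ -s) ↔ ((p : ℤ) - 1) ∣ s := by
        rw [dvd_neg]
        refine ⟨fun h => h.2, fun h => ⟨?_, h⟩⟩
        have := dvd_add hn h
        rwa [show (n : ℤ) - a - 2 * s + s = n + -s - a by ring] at this
      have e2 : (((p : ℤ) - 1) ∣ (n : ℤ) + -s ∧ ((p : ℤ) - 1) ∣ -s - a) ↔
          ((p : ℤ) - 1) ∣ a + s := by
        rw [show -s - (a : ℤ) = -(a + s) by ring, dvd_neg]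
        refine ⟨fun h => h.2, fun h => ⟨?_, h⟩⟩
        have := dvd_add hn h
        rwa [show (n : ℤ) - a - 2 * s + (a + s) = n + -s by ring] at this
      rw [if_congr e1 rfl rfl, if_congr e2 rfl rfl]
      simp only [threshold, IsDeg, mul_zero, zero_add, zero_sub, dvd_neg,
        show -(a : ℤ) - s = -(a + s) by ring]
      by_cases hs : ((p : ℤ) - 1) ∣ s
      · have hs2 : ¬ ((p : ℤ) - 1) ∣ a + s := fun h => hna (by
          have := dvd_sub h hs
          rwa [add_sub_cancel_right] at this)
        have : (a : ℤ) ≤ n := by omega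
        simp [hs, hs2, this]
      · by_cases hs2 : ((p : ℤ) - 1) ∣ a + s
        · have h3 : 2 * ((p : ℤ) - 1) - a ≤ n := by
            -- `n ≡ -a` modulo `p - 1` and `n ≥ p`
            have := dvd_add hn (hs2.mul_left 2)
            rw [show (n : ℤ) - a - 2 * s + 2 * (a + s) = n + a by ring] at this
            obtain ⟨e, he⟩ := this
            have he2 : 1 < e := by
              by_contra hcon
              have : ((p : ℤ) - 1) * e ≤ ((p : ℤ) - 1) * 1 :=
                mul_le_mul_of_nonneg_left (by omega) (by omega)
              omega
            have : ((p : ℤ) - 1) * 2 ≤ ((p : ℤ) - 1) * e :=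
              mul_le_mul_of_nonneg_left (by omega) (by omega)
            omega
          simp [hs, hs2, h3]
        · simp [hs, hs2]
    rw [finrank_homSpace_forms n hnp, hfun]
    congr 1
    split_ifs with hnp'
    · rw [hempty (by omega)]
    · rw [show -s + 1 = -(s - 1) by ring, ih (n - (p + 1)) (by omega) (s - 1) (by
        have := dvd_sub hn (dvd_refl ((p : ℤ) - 1))
        rwa [show (n : ℤ) - a - 2 * s - (p - 1) = ((n - (p + 1) : ℕ) : ℤ) - a - 2 * (s - 1) by
          push_cast [show p + 1 ≤ n by omega]; ring] at this) M (by omega)]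
      push_cast [show p + 1 ≤ n by omega]
      rfl

end Multiplicity

/-! ### Integration against elements of the Iwasawa algebra -/

section PadicLimit

variable {p : ℕ} [Fact p.Prime]

theorem exists_padicInt_limit (c : ℕ → ℤ_[p]) (hc : ∀ n, (p : ℤ_[p]) ^ n ∣ c (n + 1) - c n) :
    ∃ l, ∀ n, (p : ℤ_[p]) ^ n ∣ l - c n := by
  have hmem : ∀ n (x : ℤ_[p]), x ∈ (IsLocalRing.maximalIdeal ℤ_[p] ^ n • ⊤ :
      Submodule ℤ_[p] ℤ_[p]) ↔
      (p : ℤ_[p]) ^ n ∣ x := fun n x => by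
    rw [PadicInt.maximalIdeal_eq_span_p, Ideal.span_singleton_pow, smul_eq_mul, Ideal.mul_top,
      Ideal.mem_span_singleton]
  obtain ⟨l, hl⟩ := IsPrecomplete.prec (I := IsLocalRing.maximalIdeal ℤ_[p]) inferInstance
    (f := c) fun {m n} hmn => by
      rw [SModEq.sub_mem, hmem, ← dvd_neg, neg_sub]
      induction n, hmn using Nat.le_induction with
      | base => simp
      | succ n hmn ih =>
        rw [← sub_add_sub_cancel (c (n + 1)) (c n) (c m)]
        exact dvd_add ((pow_dvd_pow _ hmn).trans (hc n)) ih
  refine ⟨l, fun n => ?_⟩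
  have := hl n
  rwa [SModEq.sub_mem, hmem, ← dvd_neg, neg_sub] at this

theorem padicInt_eq_zero_of_forall_pow_dvd (x : ℤ_[p]) (hx : ∀ n, (p : ℤ_[p]) ^ n ∣ x) :
    x = 0 := by
  refine IsHausdorff.haus (I := IsLocalRing.maximalIdeal ℤ_[p]) inferInstance x fun n => ?_
  rw [SModEq.sub_mem, sub_zero, PadicInt.maximalIdeal_eq_span_p, Ideal.span_singleton_pow,
    smul_eq_mul, Ideal.mul_top, Ideal.mem_span_singleton]
  exact hx n

variable {W : Type*} [AddCommGroup W] [Module ℤ_[p] W] [Module.Finite ℤ_[p] W]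
  [Module.Free ℤ_[p] W]

variable (p) in
/-- A sequence in a finite free `ℤ_p`-module whose `n`-th difference is divisible by `pⁿ` has a
limit, with the expected rate of convergence. -/
theorem exists_padic_limit (w : ℕ → W) (hw : ∀ n, ∃ z, w (n + 1) - w n = p ^ n • z) :
    ∃ l, ∀ n, ∃ z, l - w n = p ^ n • z := by
  let b := Module.Free.chooseBasis ℤ_[p] W
  have h : ∀ i, ∃ l, ∀ n, (p : ℤ_[p]) ^ n ∣ l - b.repr (w n) i := fun i =>
    exists_padicInt_limit _ fun n => by
      obtain ⟨z, hz⟩ := hw n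
      refine ⟨b.repr z i, ?_⟩
      rw [← Finsupp.sub_apply, ← map_sub, hz, map_nsmul, Finsupp.smul_apply, nsmul_eq_mul,
        Nat.cast_pow]
  choose l hl using h
  refine ⟨∑ i, l i • b i, fun n => ?_⟩
  choose z hz using fun i => hl i n
  refine ⟨∑ i, z i • b i, ?_⟩
  conv_lhs => rw [← b.sum_repr (w n), ← Finset.sum_sub_distrib]
  rw [Finset.smul_sum]
  refine Finset.sum_congr rfl fun i _ => ?_
  rw [← sub_smul, hz, mul_smul, ← Nat.cast_pow, Nat.cast_smul_eq_nsmul]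

variable (p) in
theorem eq_zero_of_forall_pow_smul (x : W) (hx : ∀ n, ∃ z, x = p ^ n • z) : x = 0 := by
  let b := Module.Free.chooseBasis ℤ_[p] W
  apply b.repr.injective
  ext i
  rw [map_zero, Finsupp.zero_apply]
  refine padicInt_eq_zero_of_forall_pow_dvd _ fun n => ?_
  obtain ⟨z, hz⟩ := hx n
  refine ⟨b.repr z i, ?_⟩
  rw [hz, map_nsmul, Finsupp.smul_apply, nsmul_eq_mul, Nat.cast_pow]

end PadicLimit

section GroupRing

theorem generalLinearGroup_map_surjective {R S : Type*} [CommRing R] [IsLocalRing R] [CommRing S]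
    (f : R →+* S) (hf : Function.Surjective f) :
    Function.Surjective (Matrix.GeneralLinearGroup.map (n := Fin 2) f) := by
  intro g
  rcases subsingleton_or_nontrivial S with hS | hS
  · exact ⟨1, Subsingleton.elim _ _⟩
  have hloc : IsLocalHom f := hf.isLocalHom
  choose r hr using hf
  let M : Matrix (Fin 2) (Fin 2) R := g.1.map r
  have hM : f.mapMatrix M = g.1 := by
    ext i j
    simp [M, hr]
  have hdet : IsUnit M.det := by
    refine isUnit_of_map_unit f _ ?_
    rw [RingHom.map_det, hM]
    exact (Matrix.isUnit_iff_isUnit_det _).1 g.isUnit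
  refine ⟨Matrix.GeneralLinearGroup.mk'' M hdet, ?_⟩
  apply Units.ext
  exact hM

variable {p : ℕ} [Fact p.Prime]

/-- A ring of characteristic `p` has at most one `ℤ_p`-algebra structure. -/
theorem ringHom_padicInt_ext {R : Type*} [Ring R] [CharP R p] (f g : ℤ_[p] →+* R) : f = g := by
  ext x
  obtain ⟨n, -, hn⟩ := PadicInt.exists_mem_range (x := x)
  rw [PadicInt.maximalIdeal_eq_span_p, Ideal.mem_span_singleton] at hn
  obtain ⟨y, hy⟩ := hn
  rw [sub_eq_iff_eq_add] at hy
  simp [hy]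

/-- Reduction modulo `pⁿ` on `GL₂(ℤ_p)`. -/
def redPow (n : ℕ) : GL (Fin 2) ℤ_[p] →* GL (Fin 2) (ZMod (p ^ n)) :=
  Matrix.GeneralLinearGroup.map (PadicInt.toZModPow n)

theorem redPow_surjective (n : ℕ) : Function.Surjective (redPow (p := p) n) :=
  generalLinearGroup_map_surjective _ (ZMod.ringHom_surjective _)

/-- Reduction modulo `p` on `GL₂(ℤ_p)`. -/
def redGL : GL (Fin 2) ℤ_[p] →* GL (Fin 2) (ZMod p) :=
  Matrix.GeneralLinearGroup.map PadicInt.toZMod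

theorem redGL_surjective : Function.Surjective (redGL (p := p)) :=
  generalLinearGroup_map_surjective _ (ZMod.ringHom_surjective _)

variable {O : Type*} [CommRing O]

theorem groupElem_one : groupElem O (1 : GL (Fin 2) ℤ_[p]) = 1 := by
  apply Subtype.ext
  funext n
  simp [groupElem, MonoidAlgebra.one_def]

theorem groupElem_mul (g h : GL (Fin 2) ℤ_[p]) :
    groupElem O (g * h) = groupElem O g * groupElem O h := by
  apply Subtype.ext
  funext n
  simp [groupElem, MonoidAlgebra.single_mul_single]

variable (p O) in
/-- The homomorphism `O[K_p] → O⟦K_p⟧`, whose image is dense. -/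
def ofGroupRing : MonoidAlgebra O (GL (Fin 2) ℤ_[p]) →ₐ[O] IwasawaAlgebra p O :=
  MonoidAlgebra.lift O (IwasawaAlgebra p O) (GL (Fin 2) ℤ_[p])
    { toFun := groupElem O
      map_one' := groupElem_one
      map_mul' := groupElem_mul }

theorem ofGroupRing_single (g : GL (Fin 2) ℤ_[p]) (c : O) :
    ofGroupRing p O (MonoidAlgebra.single g c) = c • groupElem O g := by
  rw [ofGroupRing, MonoidAlgebra.lift_single]
  rfl

theorem ofGroupRing_single_level (g : GL (Fin 2) ℤ_[p]) (c : O) (n : ℕ) :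
    (ofGroupRing p O (MonoidAlgebra.single g c)).1 n = MonoidAlgebra.single (redPow n g) c := by
  rw [ofGroupRing_single]
  change c • MonoidAlgebra.single (redPow n g) (1 : O) = _
  rw [MonoidAlgebra.smul_single, smul_eq_mul, mul_one]

theorem exists_ofGroupRing_level (n : ℕ) (z : MonoidAlgebra O (GL (Fin 2) (ZMod (p ^ n)))) :
    ∃ y, (ofGroupRing p O y).1 n = z := by
  induction z using MonoidAlgebra.induction_linear with
  | zero => exact ⟨0, by rw [map_zero]; rfl⟩
  | add x y hx hy =>
    obtain ⟨x', hx⟩ := hx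
    obtain ⟨y', hy⟩ := hy
    exact ⟨x' + y', by rw [map_add, ← hx, ← hy]; rfl⟩
  | single γ c =>
    obtain ⟨g, rfl⟩ := redPow_surjective n γ
    exact ⟨MonoidAlgebra.single g c, ofGroupRing_single_level g c n⟩

theorem reduction_congr [IsLocalRing O] {n : ℕ} (hn : 1 ≤ n) {x y : IwasawaAlgebra p O}
    (h : x.1 n = y.1 n) : reduction p O x = reduction p O y := by
  have h1 : x.1 1 = y.1 1 := by rw [← x.2 1 n hn, ← y.2 1 n hn, h]
  exact congrArg (fun z => (MonoidAlgebra.mapRingHom _ (IsLocalRing.residue O))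
    (MonoidAlgebra.mapDomainRingHom O (Matrix.GeneralLinearGroup.map
      (ZMod.castHom (dvd_of_eq (pow_one p).symm) (ZMod p))) z)) h1

theorem reduction_ofGroupRing_single [IsLocalRing O] (g : GL (Fin 2) ℤ_[p]) (c : O) :
    reduction p O (ofGroupRing p O (MonoidAlgebra.single g c)) =
      MonoidAlgebra.single (redGL g) (IsLocalRing.residue O c) := by
  change (MonoidAlgebra.mapRingHom _ (IsLocalRing.residue O))
    (MonoidAlgebra.mapDomainRingHom O (Matrix.GeneralLinearGroup.map
      (ZMod.castHom (dvd_of_eq (pow_one p).symm) (ZMod p)))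
        ((ofGroupRing p O (MonoidAlgebra.single g c)).1 1)) = _
  rw [ofGroupRing_single_level]
  have h : Matrix.GeneralLinearGroup.map (ZMod.castHom (dvd_of_eq (pow_one p).symm) (ZMod p))
      (redPow 1 g) = redGL g := by
    rw [redGL, ← ringHom_padicInt_ext ((ZMod.castHom (dvd_of_eq (pow_one p).symm)
      (ZMod p)).comp (PadicInt.toZModPow 1)) PadicInt.toZMod]
    rfl
  simp [h]

/-- `InLevel n x` means that `x` is divisible by `pⁿ` at level `n`. -/
theorem InLevel.exists_smul {n : ℕ} {x : IwasawaAlgebra p O} (hx : InLevel n x) :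
    ∃ z, x.1 n = (p : O) ^ n • z := by
  choose c hc using hx
  refine ⟨∑ g, MonoidAlgebra.single g (c g), ?_⟩
  ext g
  rw [hc g]
  simp [MonoidAlgebra.coeff_sum, Finsupp.single_apply]

theorem inLevel_of_eq_smul {n : ℕ} {x : IwasawaAlgebra p O}
    {z : MonoidAlgebra O (GL (Fin 2) (ZMod (p ^ n)))} (h : x.1 n = (p : O) ^ n • z) :
    InLevel n x := fun g => by
  rw [h]
  exact ⟨z.coeff g, rfl⟩

theorem InLevel.mul_left {n : ℕ} {x : IwasawaAlgebra p O} (hx : InLevel n x)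
    (y : IwasawaAlgebra p O) : InLevel n (y * x) := by
  obtain ⟨z, hz⟩ := hx.exists_smul
  refine inLevel_of_eq_smul (z := y.1 n * z) ?_
  change y.1 n * x.1 n = _
  rw [hz, mul_smul_comm]

theorem inLevel_of_level_eq {n : ℕ} {x y : IwasawaAlgebra p O} (h : x.1 n = y.1 n) :
    InLevel n (x - y) :=
  inLevel_of_eq_smul (z := 0) (by
    change x.1 n - y.1 n = _
    rw [h, sub_self, smul_zero])

variable {W : Type*} [AddCommGroup W] [Module O W]

/-- Riemann sums of a Lipschitz function on `K_p` depend on the choice of the sample points only up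
to the expected precision. -/
theorem pairing_sub_pairing_section (f : GL (Fin 2) ℤ_[p] → W)
    (hf : ∀ n g g', redPow n g = redPow n g' → ∃ z, f g - f g' = p ^ n • z) (n : ℕ)
    (r : GL (Fin 2) (ZMod (p ^ n)) → GL (Fin 2) ℤ_[p]) (hr : ∀ γ, redPow n (r γ) = γ)
    (y : MonoidAlgebra O (GL (Fin 2) ℤ_[p])) :
    ∃ z, pairing f y - pairing (f ∘ r) ((ofGroupRing p O y).1 n) = p ^ n • z := by
  induction y using MonoidAlgebra.induction_linear with
  | zero => exact ⟨0, by rw [map_zero, map_zero]; change 0 - pairing (f ∘ r) 0 = _; simp⟩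
  | add x y hx hy =>
    obtain ⟨z, hz⟩ := hx
    obtain ⟨z', hz'⟩ := hy
    refine ⟨z + z', ?_⟩
    rw [smul_add, ← hz, ← hz', map_add, map_add]
    change _ - pairing (f ∘ r) (_ + _) = _
    rw [map_add]
    abel
  | single g c =>
    obtain ⟨z, hz⟩ := hf n g (r (redPow n g)) (hr _).symm
    refine ⟨c • z, ?_⟩
    rw [ofGroupRing_single_level, pairing_single, pairing_single, ← smul_sub, Function.comp_apply,
      hz, smul_comm]

variable [Module ℤ_[p] W] [Module.Finite ℤ_[p] W] [Module.Free ℤ_[p] W]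

/-- The integral `∫ f dμ` of a Lipschitz function `f` on `K_p` against the measures `μ ∈ O⟦K_p⟧`,
characterized as the limit of Riemann sums. -/
theorem exists_integral (f : GL (Fin 2) ℤ_[p] → W)
    (hf : ∀ n g g', redPow n g = redPow n g' → ∃ z, f g - f g' = p ^ n • z) :
    ∃ I : IwasawaAlgebra p O →ₗ[O] W, ∀ n x y, (ofGroupRing p O y).1 n = x.1 n →
      ∃ z, I x - pairing f y = p ^ n • z := by
  choose r hr using fun n => redPow_surjective (p := p) n
  have key : ∀ x : IwasawaAlgebra p O, ∃ l, ∀ n y, (ofGroupRing p O y).1 n = x.1 n →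
      ∃ z, l - pairing f y = p ^ n • z := fun x => by
    obtain ⟨l, hl⟩ := exists_padic_limit p (fun n => pairing (f ∘ r n) (x.1 n)) fun n => by
      obtain ⟨y, hy⟩ := exists_ofGroupRing_level (n + 1) (x.1 (n + 1))
      have hy' : (ofGroupRing p O y).1 n = x.1 n := by
        rw [← x.2 n (n + 1) n.le_succ, ← hy, (ofGroupRing p O y).2 n (n + 1) n.le_succ]
      obtain ⟨z, hz⟩ := pairing_sub_pairing_section f hf (n + 1) (r (n + 1)) (hr _) y
      obtain ⟨z', hz'⟩ := pairing_sub_pairing_section f hf n (r n) (hr _) y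
      refine ⟨z' - p • z, ?_⟩
      rw [smul_sub, ← hz', smul_smul, ← pow_succ, ← hz, hy, hy']
      abel
    refine ⟨l, fun n y hy => ?_⟩
    obtain ⟨z, hz⟩ := hl n
    obtain ⟨z', hz'⟩ := pairing_sub_pairing_section f hf n (r n) (hr _) y
    refine ⟨z - z', ?_⟩
    rw [smul_sub, ← hz, ← hz', hy]
    abel
  choose I hI using key
  refine ⟨{ toFun := I, map_add' := fun x x' => ?_, map_smul' := fun c x => ?_ }, fun n x y =>
    hI x n y⟩
  · refine sub_eq_zero.1 (eq_zero_of_forall_pow_smul p _ fun n => ?_)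
    obtain ⟨y, hy⟩ := exists_ofGroupRing_level n (x.1 n)
    obtain ⟨y', hy'⟩ := exists_ofGroupRing_level n (x'.1 n)
    obtain ⟨z, hz⟩ := hI x n y hy
    obtain ⟨z', hz'⟩ := hI x' n y' hy'
    obtain ⟨z'', hz''⟩ := hI (x + x') n (y + y') (by
      rw [map_add]
      change _ + _ = x.1 n + x'.1 n
      rw [← hy, ← hy'])
    refine ⟨z'' - z - z', ?_⟩
    rw [smul_sub, smul_sub, ← hz, ← hz', ← hz'', map_add]
    abel
  · refine sub_eq_zero.1 (eq_zero_of_forall_pow_smul p _ fun n => ?_)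
    obtain ⟨y, hy⟩ := exists_ofGroupRing_level n (x.1 n)
    obtain ⟨z, hz⟩ := hI x n y hy
    obtain ⟨z', hz'⟩ := hI (c • x) n (c • y) (by
      rw [map_smul]
      change _ = c • x.1 n
      rw [← hy]
      rfl)
    refine ⟨z' - c • z, ?_⟩
    rw [smul_sub, smul_comm, ← hz, ← hz', map_smul, smul_sub, RingHom.id_apply]
    abel

end GroupRing

/-! ### Abstract classical forms and their reduction -/

section Forms

theorem exists_eq_smul_of_dvd_coeff {R : Type*} [CommRing R] [IsDomain R] {r : R} (hr : r ≠ 0)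
    {N : ℕ} {f : MvPolynomial (Fin 2) R} (hf : f ∈ MvPolynomial.homogeneousSubmodule (Fin 2) R N)
    (h : ∀ e, r ∣ MvPolynomial.coeff e f) :
    ∃ z ∈ MvPolynomial.homogeneousSubmodule (Fin 2) R N, f = r • z := by
  obtain ⟨z, hz⟩ := (MvPolynomial.C_dvd_iff_dvd_coeff r f).2 h
  rw [← MvPolynomial.smul_eq_C_mul] at hz
  refine ⟨z, ?_, hz⟩
  rw [MvPolynomial.mem_homogeneousSubmodule] at hf ⊢
  intro e he
  refine hf ?_
  rw [hz, MvPolynomial.coeff_smul, smul_eq_mul]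
  exact mul_ne_zero hr he

theorem map_symAct {R S : Type*} [CommRing R] [CommRing S] (f : R →+* S)
    (M : Matrix (Fin 2) (Fin 2) R) (h : MvPolynomial (Fin 2) R) :
    MvPolynomial.map f (symAct M h) = symAct (f.mapMatrix M) (MvPolynomial.map f h) := by
  have : (MvPolynomial.map f).comp (symAct M).toRingHom =
      (symAct (f.mapMatrix M)).toRingHom.comp (MvPolynomial.map f) := by
    ext i
    · simp
    · simp [symAct]
  exact congrArg (fun g => g h) this

theorem map_smul_eq {R S : Type*} [CommRing R] [CommRing S] (f : R →+* S) (c : R)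
    (h : MvPolynomial (Fin 2) R) :
    MvPolynomial.map f (c • h) = f c • MvPolynomial.map f h := by
  simp [MvPolynomial.smul_eq_C_mul]

theorem exists_forms_lift {R S : Type*} [CommRing R] [CommRing S] (f : R →+* S)
    (hf : Function.Surjective f) {N : ℕ} {h : MvPolynomial (Fin 2) S}
    (hh : h ∈ MvPolynomial.homogeneousSubmodule (Fin 2) S N) :
    ∃ h' ∈ MvPolynomial.homogeneousSubmodule (Fin 2) R N, MvPolynomial.map f h' = h := by
  choose r hr using hf
  refine ⟨∑ e ∈ h.support, MvPolynomial.monomial e (r (MvPolynomial.coeff e h)),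
    Submodule.sum_mem _ fun e he => ?_, ?_⟩
  · rw [MvPolynomial.mem_homogeneousSubmodule] at hh ⊢
    refine MvPolynomial.isHomogeneous_monomial _ ?_
    rw [← hh (MvPolynomial.mem_support_iff.1 he)]
    simp [Finsupp.weight_apply, Finsupp.degree, Finsupp.sum]
    rfl
  · conv_rhs => rw [h.as_sum]
    simp [map_sum, hr]

/-- The action of a matrix on binary forms of degree `N`. -/
def formsMap {R : Type*} [CommRing R] (N : ℕ) (M : Matrix (Fin 2) (Fin 2) R) :
    MvPolynomial.homogeneousSubmodule (Fin 2) R N →ₗ[R]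
      MvPolynomial.homogeneousSubmodule (Fin 2) R N :=
  (symAct M).toLinearMap.restrict fun _ hf => symAct_isHomogeneous _ hf

/-- The rank of a lattice can be computed after reduction. -/
theorem finrank_eq_of_reduction {R : Type*} [CommRing R] [IsLocalRing R] {S N : Type*}
    [AddCommGroup S] [Module R S] [Module.Free R S] [Module.Finite R S] [AddCommGroup N]
    [Module (IsLocalRing.ResidueField R) N] (T : S →ₛₗ[IsLocalRing.residue R] N)
    (hT : Function.Surjective T) (hker : ∀ s, T s = 0 → ∃ r ∈ IsLocalRing.maximalIdeal R,
      ∃ s', s = r • s') :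
    Module.finrank R S = Module.finrank (IsLocalRing.ResidueField R) N := by
  let b := Module.Free.chooseBasis R S
  have hli : LinearIndependent (IsLocalRing.ResidueField R) (T ∘ b) := by
    rw [Fintype.linearIndependent_iff]
    intro c hc i
    choose c' hc' using fun i => IsLocalRing.residue_surjective (c i)
    have h0 : T (∑ i, c' i • b i) = 0 := by
      rw [map_sum, ← hc]
      exact Finset.sum_congr rfl fun i _ => by rw [map_smulₛₗ, hc', Function.comp_apply]
    obtain ⟨r, hr, s', hs'⟩ := hker _ h0
    have h1 := congrArg (fun s => b.repr s i) hs'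
    simp only [b.repr_sum_self, map_smul, Finsupp.smul_apply, smul_eq_mul] at h1
    rw [← hc', IsLocalRing.residue_eq_zero_iff, h1]
    exact Ideal.mul_mem_right _ _ hr
  have hsp : ⊤ ≤ Submodule.span (IsLocalRing.ResidueField R) (Set.range (T ∘ b)) := by
    rintro x -
    obtain ⟨s, rfl⟩ := hT x
    rw [← b.sum_repr s, map_sum]
    refine Submodule.sum_mem _ fun i _ => ?_
    rw [map_smulₛₗ]
    exact Submodule.smul_mem _ _ (Submodule.subset_span ⟨i, rfl⟩)
  rw [Module.finrank_eq_card_basis (Module.Basis.mk hli hsp), Module.finrank_eq_card_basis b]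

variable {p : ℕ} [Fact p.Prime] {O : Type*} [CommRing O] [Algebra ℤ_[p] O]
  {H : Type*} [AddCommGroup H] [Module O H] [Module (IwasawaAlgebra p O)ᵐᵒᵖ H]

theorem toMatO_mul (g h : GL (Fin 2) ℤ_[p]) : toMatO O (g * h) = toMatO O g * toMatO O h := by
  simp only [toMatO, Units.val_mul, map_mul]

variable (O H) in
/-- Continuous forms on which the inverse image in `K_p` of the subgroup `C` of `GL₂(𝔽_p)` acts
through `χ`. It specializes to both `formsIw` and `formsUr`. -/
def charForms (k : ℕ) (C : Subgroup (GL (Fin 2) (ZMod p))) (χ : GL (Fin 2) (ZMod p) → O) :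
    Submodule O (H →ₗ[O] MvPolynomial (Fin 2) O) where
  carrier := {φ | φ ∈ contForms (p := p) O H k ∧ ∀ g : GL (Fin 2) ℤ_[p], redGL g ∈ C → ∀ h : H,
    φ (MulOpposite.op (groupElem O g) • h) = χ (redGL g) • symAct (toMatO O g) (φ h)}
  add_mem' := by
    rintro φ φ' ⟨h1, h2⟩ ⟨h1', h2'⟩
    refine ⟨add_mem h1 h1', fun g hg h => ?_⟩
    simp only [LinearMap.add_apply, map_add, smul_add, h2 g hg, h2' g hg]
  zero_mem' := ⟨zero_mem _, by simp⟩
  smul_mem' := by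
    rintro c φ ⟨h1, h2⟩
    refine ⟨Submodule.smul_mem _ c h1, fun g hg h => ?_⟩
    simp only [LinearMap.smul_apply, map_smul, h2 g hg]
    rw [smul_comm]

theorem op_smul_op_smul (x y : IwasawaAlgebra p O) (h : H) :
    MulOpposite.op y • MulOpposite.op x • h = MulOpposite.op (x * y) • h := by
  rw [smul_smul, ← MulOpposite.op_mul]

theorem op_smul_assoc [IsScalarTower O (IwasawaAlgebra p O)ᵐᵒᵖ H] (c : O) (x : IwasawaAlgebra p O)
    (h : H) : MulOpposite.op (c • x) • h = c • MulOpposite.op x • h := by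
  rw [MulOpposite.op_smul, smul_assoc]

theorem exists_approx {k : ℕ} {φ : H →ₗ[O] MvPolynomial (Fin 2) O}
    (hφ : φ ∈ contForms (p := p) O H k) (x : IwasawaAlgebra p O) (m : ℕ) :
    ∃ n y, 1 ≤ n ∧ (ofGroupRing p O y).1 n = x.1 n ∧ ∀ h e, (p : O) ^ m ∣
      MvPolynomial.coeff e
        (φ (MulOpposite.op x • h) - φ (MulOpposite.op (ofGroupRing p O y) • h)) := by
  obtain ⟨n, hn⟩ := hφ.2 m
  obtain ⟨y, hy⟩ := exists_ofGroupRing_level (O := O) (max n 1) (x.1 (max n 1))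
  refine ⟨max n 1, y, le_max_right _ _, hy, fun h e => ?_⟩
  rw [← map_sub, ← sub_smul, ← MulOpposite.op_sub]
  exact hn _ ((inLevel_of_level_eq hy.symm).mono (le_max_left _ _)) h e

section Residue

variable [IsLocalRing O] [Module.Finite ℤ_[p] O] [FaithfulSMul ℤ_[p] O]
  [IsScalarTower O (IwasawaAlgebra p O)ᵐᵒᵖ H]
  [hchar : CharP (IsLocalRing.ResidueField O) p]

theorem residue_toMatO (g : GL (Fin 2) ℤ_[p]) :
    (IsLocalRing.residue O).mapMatrix (toMatO O g) =
      toMat (IsLocalRing.ResidueField O) (redGL g) := by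
  ext i j
  exact congrArg (fun f => f (g i j)) (ringHom_padicInt_ext ((IsLocalRing.residue O).comp
    (algebraMap ℤ_[p] O)) ((ZMod.castHom (dvd_refl p) _).comp PadicInt.toZMod))

theorem residue_natCast_p : IsLocalRing.residue O (p : O) = 0 := by
  rw [map_natCast, CharP.cast_eq_zero]

theorem map_residue_eq_of_dvd {f g : MvPolynomial (Fin 2) O}
    (h : ∀ e, (p : O) ^ 1 ∣ MvPolynomial.coeff e (f - g)) :
    MvPolynomial.map (IsLocalRing.residue O) f = MvPolynomial.map (IsLocalRing.residue O) g := by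
  rw [← sub_eq_zero, ← map_sub]
  ext e
  obtain ⟨z, hz⟩ := h e
  rw [MvPolynomial.coeff_map, hz, map_mul, pow_one, residue_natCast_p, zero_mul,
    MvPolynomial.coeff_zero]

/-- Modulo the maximal ideal, a form depends on `x ∈ O⟦K_p⟧` only through the reduction of `x`. -/
theorem map_residue_smul {k : ℕ} {C : Subgroup (GL (Fin 2) (ZMod p))}
    {χ : GL (Fin 2) (ZMod p) → O} (hχ1 : χ 1 = 1) {φ : H →ₗ[O] MvPolynomial (Fin 2) O}
    (hφ : φ ∈ charForms O H k C χ) (x : IwasawaAlgebra p O) (h : H) :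
    MvPolynomial.map (IsLocalRing.residue O) (φ (MulOpposite.op x • h)) =
      pairing (fun γ => MvPolynomial.map (IsLocalRing.residue O)
        (φ (MulOpposite.op (groupElem O (Function.surjInv redGL_surjective γ)) • h)))
        (reduction p O x) := by
  obtain ⟨n, y, hn, hy, hxy⟩ := exists_approx hφ.1 x 1
  rw [map_residue_eq_of_dvd (hxy h), ← reduction_congr hn hy]
  clear hxy hy
  induction y using MonoidAlgebra.induction_linear with
  | zero => simp
  | add y z hy hz => simp only [map_add, MulOpposite.op_add, add_smul, hy, hz]
  | single g c =>
    rw [reduction_ofGroupRing_single, pairing_single, ofGroupRing_single, op_smul_assoc, map_smul,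
      map_smul_eq]
    congr 1
    set l := Function.surjInv redGL_surjective (redGL g) with hl
    have hlg : redGL (l⁻¹ * g) = 1 := by
      rw [map_mul, map_inv, Function.surjInv_eq redGL_surjective, inv_mul_cancel]
    have h1 := hφ.2 (l⁻¹ * g) (by rw [hlg]; exact C.one_mem)
      (MulOpposite.op (groupElem O l) • h)
    rw [op_smul_op_smul, ← groupElem_mul, mul_inv_cancel_left, hlg, hχ1, one_smul] at h1
    rw [h1, map_symAct, residue_toMatO, hlg]
    simp [toMat, symAct_one]

section Quotient

variable {P : Type*} [AddCommGroup P]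
  [Module (MonoidAlgebra (IsLocalRing.ResidueField O) (GL (Fin 2) (ZMod p)))ᵐᵒᵖ P]
  [Module (IsLocalRing.ResidueField O) P]
  [IsScalarTower (IsLocalRing.ResidueField O)
    (MonoidAlgebra (IsLocalRing.ResidueField O) (GL (Fin 2) (ZMod p)))ᵐᵒᵖ P]
  (q : H →ₛₗ[RingHom.op (reduction p O)] P)

theorem quotient_op_smul (x : IwasawaAlgebra p O) (h : H) :
    q (MulOpposite.op x • h) = MulOpposite.op (reduction p O x) • q h := by
  rw [map_smulₛₗ]
  rfl

theorem quotient_groupElem_smul (g : GL (Fin 2) ℤ_[p]) (h : H) :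
    q (MulOpposite.op (groupElem O g) • h) = act (IsLocalRing.ResidueField O) (redGL g) (q h) := by
  rw [quotient_op_smul, act]
  congr 2
  have := reduction_ofGroupRing_single g (1 : O)
  rwa [ofGroupRing_single, one_smul, map_one] at this

theorem quotient_smul (c : O) (h : H) : q (c • h) = IsLocalRing.residue O c • q h := by
  have h1 : c • h = MulOpposite.op (ofGroupRing p O (MonoidAlgebra.single 1 c)) • h := by
    rw [ofGroupRing_single, op_smul_assoc, groupElem_one, MulOpposite.op_one, one_smul]
  rw [h1, quotient_op_smul, reduction_ofGroupRing_single, op_single_smul_eq, map_one, act_one]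

theorem map_residue_eq_zero {k : ℕ} {C : Subgroup (GL (Fin 2) (ZMod p))}
    {χ : GL (Fin 2) (ZMod p) → O} (hχ1 : χ 1 = 1) {φ : H →ₗ[O] MvPolynomial (Fin 2) O}
    (hφ : φ ∈ charForms O H k C χ) {h : H} (hh : h ∈ augSubmodule p O H) :
    MvPolynomial.map (IsLocalRing.residue O) (φ h) = 0 := by
  have key : ∀ y : IwasawaAlgebra p O,
      MvPolynomial.map (IsLocalRing.residue O) (φ (MulOpposite.op y • h)) = 0 := by
    refine Submodule.span_induction (p := fun h _ => ∀ y : IwasawaAlgebra p O,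
      MvPolynomial.map (IsLocalRing.residue O) (φ (MulOpposite.op y • h)) = 0) ?_ ?_ ?_ ?_ hh
    · rintro _ ⟨x, hx, h, rfl⟩ y
      rw [op_smul_op_smul, map_residue_smul hχ1 hφ, map_mul, hx, zero_mul, map_zero]
    · intro y
      simp
    · intro h h' _ _ h1 h2 y
      rw [smul_add, map_add, map_add, h1, h2, add_zero]
    · intro r h _ h1 y
      rw [smul_smul]
      exact h1 (r.unop * y)
  simpa using key 1

/-- The reduction of a form, as a map out of `H / H · (ϖ, I)`. -/
theorem exists_reduction_form (hq : Function.Surjective q)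
    (hker : LinearMap.ker q = augSubmodule p O H) {k : ℕ} {C : Subgroup (GL (Fin 2) (ZMod p))}
    {χ : GL (Fin 2) (ZMod p) → O} (hχ1 : χ 1 = 1) {φ : H →ₗ[O] MvPolynomial (Fin 2) O}
    (hφ : φ ∈ charForms O H k C χ) :
    ∃ β ∈ homSpace P C (formAct (IsLocalRing.ResidueField O) fun g => IsLocalRing.residue O (χ g))
      (MvPolynomial.homogeneousSubmodule (Fin 2) (IsLocalRing.ResidueField O) (k - 2)),
      ∀ h, β (q h) = MvPolynomial.map (IsLocalRing.residue O) (φ h) := by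
  choose r hr using hq
  have hwd : ∀ h h', q h = q h' → MvPolynomial.map (IsLocalRing.residue O) (φ h) =
      MvPolynomial.map (IsLocalRing.residue O) (φ h') := fun h h' e => by
    rw [← sub_eq_zero, ← map_sub, ← map_sub]
    refine map_residue_eq_zero hχ1 hφ ?_
    rw [← hker, LinearMap.mem_ker, map_sub, e, sub_self]
  let β : P →ₗ[IsLocalRing.ResidueField O] MvPolynomial (Fin 2) (IsLocalRing.ResidueField O) :=
    { toFun := fun x => MvPolynomial.map (IsLocalRing.residue O) (φ (r x))
      map_add' := fun x y => by
        rw [← map_add, ← map_add]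
        exact hwd _ _ (by rw [map_add, hr, hr, hr])
      map_smul' := fun c x => by
        obtain ⟨c, rfl⟩ := IsLocalRing.residue_surjective c
        rw [RingHom.id_apply, ← map_smul_eq, ← map_smul]
        exact hwd _ _ (by rw [quotient_smul, hr, hr]) }
  have hβ : ∀ h, β (q h) = MvPolynomial.map (IsLocalRing.residue O) (φ h) := fun h =>
    hwd _ _ (hr _)
  refine ⟨β, ⟨fun x => ?_, fun c hc x => ?_⟩, hβ⟩
  · exact (hφ.1.1 (r x)).map _
  · obtain ⟨h, rfl⟩ : ∃ h, q h = x := ⟨r x, hr x⟩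
    obtain ⟨g, rfl⟩ := redGL_surjective c
    rw [← quotient_groupElem_smul, hβ, hβ, hφ.2 g hc, map_smul_eq, map_symAct, residue_toMatO]
    rfl

end Quotient

end Residue

section Lift

variable [IsDomain O] [IsDiscreteValuationRing O] [Module.Finite ℤ_[p] O] [FaithfulSMul ℤ_[p] O]
  [IsScalarTower O (IwasawaAlgebra p O)ᵐᵒᵖ H]

variable (p O) in
theorem natCast_p_ne_zero : (p : O) ≠ 0 := by
  rw [← map_natCast (algebraMap ℤ_[p] O)]
  exact (map_ne_zero_iff _ (FaithfulSMul.algebraMap_injective ℤ_[p] O)).2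
    (Nat.cast_ne_zero.2 (Fact.out : p.Prime).ne_zero)

/-- A continuous form that vanishes on the translates of `h` by group elements vanishes on the whole
submodule that `h` generates: group elements span a dense subring of `O⟦K_p⟧`. -/
theorem form_eq_zero {k : ℕ} {φ : H →ₗ[O] MvPolynomial (Fin 2) O}
    (hφ : φ ∈ contForms (p := p) O H k) {h : H}
    (h0 : ∀ g : GL (Fin 2) ℤ_[p], φ (MulOpposite.op (groupElem O g) • h) = 0)
    (x : IwasawaAlgebra p O) : φ (MulOpposite.op x • h) = 0 := by
  have : Module.IsTorsionFree ℤ_[p] O := inferInstance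
  ext e
  refine eq_zero_of_forall_pow_smul p _ fun m => ?_
  obtain ⟨n, y, -, -, hxy⟩ := exists_approx hφ x m
  have hy : φ (MulOpposite.op (ofGroupRing p O y) • h) = 0 := by
    clear hxy
    induction y using MonoidAlgebra.induction_linear with
    | zero => simp
    | add y z hy hz => simp only [map_add, MulOpposite.op_add, add_smul, hy, hz, add_zero]
    | single g c => rw [ofGroupRing_single, op_smul_assoc, map_smul, h0, smul_zero]
  obtain ⟨z, hz⟩ := hxy h e
  rw [hy, sub_zero] at hz
  exact ⟨z, by rw [hz, nsmul_eq_mul, Nat.cast_pow]⟩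

/-- A form is determined by its values on the translates of finitely many generators of `H` by
representatives of `GL₂(𝔽_p)`, so the forms embed into a finite free module. -/
theorem charForms_finite_free [Module.Finite (IwasawaAlgebra p O)ᵐᵒᵖ H]
    [Module.Projective (IwasawaAlgebra p O)ᵐᵒᵖ H] (k : ℕ) (C : Subgroup (GL (Fin 2) (ZMod p)))
    (χ : GL (Fin 2) (ZMod p) → O) :
    Module.Finite O (charForms O H k C χ) ∧ Module.Free O (charForms O H k C χ) := by
  obtain ⟨n, b, ι, hb⟩ := exists_dual_basis (IwasawaAlgebra p O)ᵐᵒᵖ H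
  let l := Function.surjInv (redGL_surjective (p := p))
  have hl : ∀ γ, redGL (l γ) = γ := Function.surjInv_eq redGL_surjective
  let T : charForms O H k C χ →ₗ[O]
      (Fin n → GL (Fin 2) (ZMod p) → MvPolynomial.homogeneousSubmodule (Fin 2) O (k - 2)) :=
    { toFun := fun φ j γ => ⟨φ.1 (MulOpposite.op (groupElem O (l γ)) • b j), φ.2.1.1 _⟩
      map_add' := fun _ _ => rfl
      map_smul' := fun _ _ => rfl }
  have hT : Function.Injective T := by
    suffices h : ∀ φ, T φ = 0 → φ = 0 from fun φ φ' e =>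
      sub_eq_zero.1 (h _ (by rw [map_sub, e, sub_self]))
    intro φ hφ
    have h0 : ∀ j g, φ.1 (MulOpposite.op (groupElem O g) • b j) = 0 := fun j g => by
      have hlg : redGL ((l (redGL g))⁻¹ * g) = 1 := by
        rw [map_mul, map_inv, hl, inv_mul_cancel]
      have h1 := φ.2.2 ((l (redGL g))⁻¹ * g) (by rw [hlg]; exact C.one_mem)
        (MulOpposite.op (groupElem O (l (redGL g))) • b j)
      have h2 : φ.1 (MulOpposite.op (groupElem O (l (redGL g))) • b j) = 0 :=
        congrArg (fun f => (f j (redGL g)).1) hφ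
      rwa [op_smul_op_smul, ← groupElem_mul, mul_inv_cancel_left, h2, map_zero, smul_zero] at h1
    ext h : 2
    rw [← hb h, map_sum]
    exact Finset.sum_eq_zero fun j _ => form_eq_zero φ.2.1 (h0 j) (ι h j).unop
  have hfin : Module.Finite O (charForms O H k C χ) := Module.Finite.of_injective T hT
  refine ⟨hfin, ?_⟩
  have : Module.IsTorsionFree O (charForms O H k C χ) := hT.moduleIsTorsionFree T (map_smul T)
  exact Module.free_of_finite_type_torsion_free' (R := O) (M := charForms O H k C χ)

variable [hchar : CharP (IsLocalRing.ResidueField O) p]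

theorem redGL_eq_of_redPow_eq {n : ℕ} (hn : 1 ≤ n) {g g' : GL (Fin 2) ℤ_[p]}
    (h : redPow n g = redPow n g') : redGL g = redGL g' := by
  have hd : p ∣ p ^ n := dvd_pow_self p (by omega)
  have key : ∀ g : GL (Fin 2) ℤ_[p], redGL g =
      Matrix.GeneralLinearGroup.map (ZMod.castHom hd (ZMod p)) (redPow n g) := fun g => by
    rw [redGL, ← ringHom_padicInt_ext ((ZMod.castHom hd (ZMod p)).comp (PadicInt.toZModPow n))
      PadicInt.toZMod]
    rfl
  rw [key, key, h]

theorem formsMap_sub_of_redPow_eq {N n : ℕ} {g g' : GL (Fin 2) ℤ_[p]}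
    (h : redPow n g = redPow n g') (v : MvPolynomial.homogeneousSubmodule (Fin 2) O N) :
    ∃ z, formsMap N (toMatO O g) v - formsMap N (toMatO O g') v = p ^ n • z := by
  let I : Ideal O := Ideal.span {(p : O) ^ n}
  have h1 : (Ideal.Quotient.mk I).mapMatrix (toMatO O g) =
      (Ideal.Quotient.mk I).mapMatrix (toMatO O g') := by
    ext i j
    have h2 : PadicInt.toZModPow n (g i j - g' i j) = 0 := by
      rw [map_sub, sub_eq_zero]
      exact congrArg (fun f : GL (Fin 2) (ZMod (p ^ n)) => f i j) h
    rw [← RingHom.mem_ker, PadicInt.ker_toZModPow, Ideal.mem_span_singleton] at h2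
    obtain ⟨c, hc⟩ := h2
    change Ideal.Quotient.mk I (algebraMap ℤ_[p] O (g i j)) =
      Ideal.Quotient.mk I (algebraMap ℤ_[p] O (g' i j))
    rw [Ideal.Quotient.eq, ← map_sub, hc, map_mul, map_pow, map_natCast]
    exact Ideal.mul_mem_right _ _ (Ideal.mem_span_singleton_self _)
  obtain ⟨z, hz, hz'⟩ := exists_eq_smul_of_dvd_coeff (pow_ne_zero n (natCast_p_ne_zero p O))
    (formsMap N (toMatO O g) v - formsMap N (toMatO O g') v).2 fun e => by
      rw [← Ideal.mem_span_singleton, ← Ideal.Quotient.eq_zero_iff_mem, ← MvPolynomial.coeff_map]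
      change MvPolynomial.coeff e (MvPolynomial.map (Ideal.Quotient.mk I)
        (symAct (toMatO O g) v.1 - symAct (toMatO O g') v.1)) = 0
      rw [map_sub, map_symAct, map_symAct, h1, sub_self, MvPolynomial.coeff_zero]
  refine ⟨⟨z, hz⟩, Subtype.ext ?_⟩
  rw [hz', ← Nat.cast_pow, Nat.cast_smul_eq_nsmul]
  rfl

theorem formsMap_mul_apply (N : ℕ) (g g' : GL (Fin 2) ℤ_[p])
    (v : MvPolynomial.homogeneousSubmodule (Fin 2) O N) :
    formsMap N (toMatO O (g * g')) v = formsMap N (toMatO O g') (formsMap N (toMatO O g) v) := by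
  apply Subtype.ext
  change symAct (toMatO O (g * g')) _ = symAct (toMatO O g') (symAct (toMatO O g) _)
  rw [toMatO_mul, symAct_mul, AlgHom.comp_apply]

/-- The integral `∫ v(ḡ)|_g dμ(g)` for a function `v` on `GL₂(𝔽_p)` with values in binary forms. -/
theorem exists_form_integral (N : ℕ) {C : Subgroup (GL (Fin 2) (ZMod p))}
    {χ : GL (Fin 2) (ZMod p) → O}
    (v : GL (Fin 2) (ZMod p) → MvPolynomial.homogeneousSubmodule (Fin 2) O N)
    (hv : ∀ γ, ∀ c ∈ C, v (γ * c) = χ c • v γ) :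
    ∃ I : IwasawaAlgebra p O →ₗ[O] MvPolynomial.homogeneousSubmodule (Fin 2) O N,
      (∀ m x, InLevel m x → ∃ z, I x = p ^ m • z) ∧
      (∀ g : GL (Fin 2) ℤ_[p], redGL g ∈ C → ∀ x, I (x * groupElem O g) =
        χ (redGL g) • formsMap N (toMatO O g) (I x)) ∧
      ∀ x, MvPolynomial.map (IsLocalRing.residue O) (I x).1 =
        pairing (fun γ => symAct (toMat (IsLocalRing.ResidueField O) γ)
          (MvPolynomial.map (IsLocalRing.residue O) (v γ).1)) (reduction p O x) := by
  have hWfin : Module.Finite ℤ_[p] (MvPolynomial.homogeneousSubmodule (Fin 2) O N) :=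
    Module.Finite.trans O _
  obtain ⟨f, hf⟩ : ∃ f : GL (Fin 2) ℤ_[p] → MvPolynomial.homogeneousSubmodule (Fin 2) O N,
    ∀ g, f g = formsMap N (toMatO O g) (v (redGL g)) := ⟨_, fun _ => rfl⟩
  have hlip : ∀ m g g', redPow m g = redPow m g' → ∃ z, f g - f g' = p ^ m • z :=
    fun m g g' hgg => by
    rcases Nat.eq_zero_or_pos m with rfl | hm
    · exact ⟨f g - f g', by rw [pow_zero, one_smul]⟩
    · rw [hf, hf, redGL_eq_of_redPow_eq hm hgg]
      exact formsMap_sub_of_redPow_eq hgg _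
  have hmul : ∀ g : GL (Fin 2) ℤ_[p], redGL g ∈ C → ∀ γ,
      f (γ * g) = (χ (redGL g) • formsMap N (toMatO O g)) (f γ) := fun g hg γ => by
    rw [hf, hf, map_mul, hv _ _ hg, map_smul, LinearMap.smul_apply, formsMap_mul_apply]
  obtain ⟨I, hI⟩ := exists_integral (O := O) f hlip
  refine ⟨I, fun m x hx => ?_, fun g hg x => ?_, fun x => ?_⟩
  · obtain ⟨t, ht⟩ := hx.exists_smul
    obtain ⟨y, hy⟩ := exists_ofGroupRing_level m t
    obtain ⟨z, hz⟩ := hI m x ((p : O) ^ m • y) (by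
      rw [map_smul, ht, ← hy]
      rfl)
    refine ⟨z + pairing f y, ?_⟩
    rw [smul_add, ← hz, map_smul, ← Nat.cast_pow, Nat.cast_smul_eq_nsmul, sub_add_cancel]
  · refine sub_eq_zero.1 (eq_zero_of_forall_pow_smul p _ fun m => ?_)
    obtain ⟨y, hy⟩ := exists_ofGroupRing_level m (x.1 m)
    obtain ⟨z, hz⟩ := hI m x y hy
    obtain ⟨z', hz'⟩ := hI m (x * groupElem O g) (y * MonoidAlgebra.single g 1) (by
      rw [map_mul, ofGroupRing_single, one_smul]
      change _ * _ = x.1 m * _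
      rw [← hy])
    rw [pairing_mul_single f _ g (hmul g hg) y] at hz'
    refine ⟨z' - χ (redGL g) • formsMap N (toMatO O g) z, ?_⟩
    rw [smul_sub, ← hz', smul_comm, ← map_nsmul, ← hz, LinearMap.smul_apply, map_sub, smul_sub]
    abel
  · obtain ⟨y, hy⟩ := exists_ofGroupRing_level 1 (x.1 1)
    obtain ⟨z, hz⟩ := hI 1 x y hy
    have h1 : MvPolynomial.map (IsLocalRing.residue O) (I x).1 =
        MvPolynomial.map (IsLocalRing.residue O) (pairing f y).1 := by
      refine map_residue_eq_of_dvd fun e => ⟨MvPolynomial.coeff e z.1, ?_⟩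
      have h2 := congrArg (fun w => MvPolynomial.coeff e w.1) hz
      rw [← Nat.cast_smul_eq_nsmul O, Nat.cast_pow] at h2
      exact h2
    rw [h1, ← reduction_congr le_rfl hy]
    clear hy hz h1
    induction y using MonoidAlgebra.induction_linear with
    | zero => simp
    | add y z hy hz => rw [map_add, map_add, map_add, map_add, Submodule.coe_add, map_add, hy, hz]
    | single g c =>
      rw [reduction_ofGroupRing_single, pairing_single, pairing_single, hf]
      change MvPolynomial.map _ (c • symAct (toMatO O g) (v (redGL g)).1) = _
      rw [map_smul_eq, map_symAct, residue_toMatO]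

variable {P : Type*} [AddCommGroup P]
  [Module (MonoidAlgebra (IsLocalRing.ResidueField O) (GL (Fin 2) (ZMod p)))ᵐᵒᵖ P]
  [Module (IsLocalRing.ResidueField O) P]
  [IsScalarTower (IsLocalRing.ResidueField O)
    (MonoidAlgebra (IsLocalRing.ResidueField O) (GL (Fin 2) (ZMod p)))ᵐᵒᵖ P]
  (q : H →ₛₗ[RingHom.op (reduction p O)] P)

/-- Every equivariant map over the residue field lifts to a form: a form is obtained by integrating
a lift to `K_p` of its values on generators, and projectivity of `H` provides the measures. -/
theorem exists_form_lift [Module.Finite (IwasawaAlgebra p O)ᵐᵒᵖ H]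
    [Module.Projective (IwasawaAlgebra p O)ᵐᵒᵖ H] {k : ℕ} {C : Subgroup (GL (Fin 2) (ZMod p))}
    {χ : GL (Fin 2) (ZMod p) → O} (hχ : ∀ c ∈ C, ∀ c' ∈ C, χ (c * c') = χ c * χ c')
    {β : P →ₗ[IsLocalRing.ResidueField O] MvPolynomial (Fin 2) (IsLocalRing.ResidueField O)}
    (hβ : β ∈ homSpace P C
      (formAct (IsLocalRing.ResidueField O) fun g => IsLocalRing.residue O (χ g))
      (MvPolynomial.homogeneousSubmodule (Fin 2) (IsLocalRing.ResidueField O) (k - 2))) :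
    ∃ φ ∈ charForms O H k C χ, ∀ h, β (q h) = MvPolynomial.map (IsLocalRing.residue O) (φ h) := by
  obtain ⟨n, b, ι, hb⟩ := exists_dual_basis (IwasawaAlgebra p O)ᵐᵒᵖ H
  let ev : Fin n → GL (Fin 2) (ZMod p) → MvPolynomial (Fin 2) (IsLocalRing.ResidueField O) :=
    fun j γ => β (act (IsLocalRing.ResidueField O) γ (q (b j)))
  have htoMat : ∀ γ : GL (Fin 2) (ZMod p), ∀ x, symAct (toMat (IsLocalRing.ResidueField O) γ)
      (symAct (toMat (IsLocalRing.ResidueField O) γ⁻¹) x) = x := fun γ x => by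
    rw [← AlgHom.comp_apply, ← symAct_mul, ← toMat_mul, inv_mul_cancel]
    simp [toMat, symAct_one]
  have key : ∀ j, ∃ v : GL (Fin 2) (ZMod p) →
        MvPolynomial.homogeneousSubmodule (Fin 2) O (k - 2), (∀ γ, v γ ∈ Set.univ) ∧
      (∀ γ, MvPolynomial.map (IsLocalRing.residue O) (v γ).1 =
        symAct (toMat (IsLocalRing.ResidueField O) γ⁻¹) (ev j γ)) ∧
      ∀ γ, ∀ c ∈ C, v (γ * c) = χ c • v γ := fun j =>
    exists_equivariant_lift C (fun c x => χ c • x) (fun c y => IsLocalRing.residue O (χ c) • y)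
      (fun w : MvPolynomial.homogeneousSubmodule (Fin 2) O (k - 2) =>
        MvPolynomial.map (IsLocalRing.residue O) w.1) Set.univ
      (fun _ _ _ _ => trivial) (fun c hc c' hc' x _ => by rw [hχ c hc c' hc', smul_smul, mul_comm])
      (fun c _ x _ => map_smul_eq _ _ _)
      (fun γ => symAct (toMat (IsLocalRing.ResidueField O) γ⁻¹) (ev j γ))
      (fun γ => by
        obtain ⟨x, hx, hx'⟩ := exists_forms_lift (IsLocalRing.residue O)
          IsLocalRing.residue_surjective (h := symAct (toMat (IsLocalRing.ResidueField O) γ⁻¹)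
            (ev j γ)) (symAct_isHomogeneous _ (hβ.1 _))
        exact ⟨⟨x, hx⟩, trivial, hx'⟩)
      (fun γ c hc => by
        simp only [ev, act_mul, hβ.2 c hc, formAct_apply, map_smul]
        rw [mul_inv_rev, toMat_mul, symAct_mul, AlgHom.comp_apply]
        congr 2
        simpa using htoMat c⁻¹ (ev j γ))
  choose v hvu hv hvc using key
  choose I hIlevel hIeq hIres using fun j => exists_form_integral (k - 2) (v j) (hvc j)
  have hIβ : ∀ j x, MvPolynomial.map (IsLocalRing.residue O) (I j x).1 =
      β (MulOpposite.op (reduction p O x) • q (b j)) := fun j x => by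
    rw [hIres]
    simp only [hv, htoMat]
    induction reduction p O x using MonoidAlgebra.induction_linear with
    | zero => simp
    | add y z hy hz => rw [map_add, MulOpposite.op_add, add_smul, map_add, hy, hz]
    | single γ c => rw [op_single_smul_eq, pairing_single, map_smul]
  let ιj : Fin n → H →ₗ[O] IwasawaAlgebra p O := fun j =>
    (MulOpposite.opLinearEquiv O).symm.toLinearMap ∘ₗ
      (LinearMap.proj j : (Fin n → (IwasawaAlgebra p O)ᵐᵒᵖ) →ₗ[O] _) ∘ₗ (ι.restrictScalars O)
  have hιj : ∀ j x h, ιj j (MulOpposite.op x • h) = ιj j h * x := fun j x h => by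
    simp [ιj]
  let Φ : H →ₗ[O] MvPolynomial.homogeneousSubmodule (Fin 2) O (k - 2) :=
    ∑ j, (I j).comp (ιj j)
  let φ : H →ₗ[O] MvPolynomial (Fin 2) O := (Submodule.subtype _).comp Φ
  have hφ : ∀ h, φ h = ∑ j, (I j (ιj j h)).1 := fun h => by
    simp [φ, Φ]
  refine ⟨φ, ⟨⟨fun h => (Φ h).2, fun m => ⟨m, fun x hx h e => ?_⟩⟩, fun g hg h => ?_⟩, fun h => ?_⟩
  · rw [hφ, MvPolynomial.coeff_sum]
    refine Finset.dvd_sum fun j _ => ?_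
    rw [hιj]
    obtain ⟨z, hz⟩ := hIlevel j m _ (hx.mul_left (ιj j h))
    refine ⟨MvPolynomial.coeff e z.1, ?_⟩
    rw [hz, ← Nat.cast_smul_eq_nsmul O, Nat.cast_pow]
    rfl
  · rw [hφ, hφ, map_sum, Finset.smul_sum]
    refine Finset.sum_congr rfl fun j _ => ?_
    rw [hιj, hIeq j g hg]
    rfl
  · rw [hφ, map_sum]
    conv_lhs => rw [← hb h, map_sum, map_sum]
    refine Finset.sum_congr rfl fun j _ => ?_
    rw [hIβ, ← quotient_op_smul]
    rfl

/-- The rank of a space of forms is the dimension of the corresponding space of equivariant maps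
over the residue field. -/
theorem finrank_charForms [Module.Finite (IwasawaAlgebra p O)ᵐᵒᵖ H]
    [Module.Projective (IwasawaAlgebra p O)ᵐᵒᵖ H] (hq : Function.Surjective q)
    (hker : LinearMap.ker q = augSubmodule p O H) (k : ℕ) (C : Subgroup (GL (Fin 2) (ZMod p)))
    {χ : GL (Fin 2) (ZMod p) → O} (hχ1 : χ 1 = 1)
    (hχ : ∀ c ∈ C, ∀ c' ∈ C, χ (c * c') = χ c * χ c') :
    Module.finrank O (charForms O H k C χ) = Module.finrank (IsLocalRing.ResidueField O)
      (homSpace P C (formAct (IsLocalRing.ResidueField O) fun g => IsLocalRing.residue O (χ g))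
        (MvPolynomial.homogeneousSubmodule (Fin 2) (IsLocalRing.ResidueField O) (k - 2))) := by
  obtain ⟨hfin, hfree⟩ := charForms_finite_free (H := H) k C χ
  choose r hr hqr using fun φ : charForms O H k C χ => exists_reduction_form q hq hker hχ1 φ.2
  have hext : ∀ {β β' : P →ₗ[IsLocalRing.ResidueField O]
      MvPolynomial (Fin 2) (IsLocalRing.ResidueField O)}, (∀ h, β (q h) = β' (q h)) → β = β' :=
    fun h => LinearMap.ext fun x => by
      obtain ⟨y, rfl⟩ := hq x
      exact h y
  let T : charForms O H k C χ →ₛₗ[IsLocalRing.residue O] homSpace P C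
      (formAct (IsLocalRing.ResidueField O) fun g => IsLocalRing.residue O (χ g))
        (MvPolynomial.homogeneousSubmodule (Fin 2) (IsLocalRing.ResidueField O) (k - 2)) :=
    { toFun := fun φ => ⟨r φ, hr φ⟩
      map_add' := fun φ φ' => Subtype.ext (hext fun h => by
        rw [hqr]
        change _ = r φ (q h) + r φ' (q h)
        rw [hqr, hqr, ← map_add]
        rfl)
      map_smul' := fun c φ => Subtype.ext (hext fun h => by
        rw [hqr]
        change _ = IsLocalRing.residue O c • r φ (q h)
        rw [hqr, ← map_smul_eq]
        rfl) }
  refine finrank_eq_of_reduction (R := O) (S := charForms O H k C χ) (N := homSpace P C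
      (formAct (IsLocalRing.ResidueField O) fun g => IsLocalRing.residue O (χ g))
      (MvPolynomial.homogeneousSubmodule (Fin 2) (IsLocalRing.ResidueField O) (k - 2))) T
    (fun β => ?_) fun φ hφ => ?_
  · obtain ⟨φ, hφ, h⟩ := exists_form_lift q hχ β.2
    exact ⟨⟨φ, hφ⟩, Subtype.ext (hext fun x => by rw [h]; exact hqr ⟨φ, hφ⟩ x)⟩
  · obtain ⟨ϖ, hϖ⟩ := IsDiscreteValuationRing.exists_irreducible O
    have hm := hϖ.maximalIdeal_eq
    refine ⟨ϖ, by rw [hm]; exact Ideal.mem_span_singleton_self _, ?_⟩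
    have h0 : ∀ h e, ϖ ∣ MvPolynomial.coeff e (φ.1 h) := fun h e => by
      have h1 : MvPolynomial.map (IsLocalRing.residue O) (φ.1 h) = 0 := by
        rw [← hqr]
        exact congrArg (fun β => β.1 (q h)) hφ
      rw [← Ideal.mem_span_singleton, ← hm, ← IsLocalRing.residue_eq_zero_iff,
        ← MvPolynomial.coeff_map, h1, MvPolynomial.coeff_zero]
    choose ψ hψ hφψ using fun h => exists_eq_smul_of_dvd_coeff hϖ.ne_zero (φ.2.1.1 h) (h0 h)
    have hinj : ∀ {x y : MvPolynomial (Fin 2) O}, ϖ • x = ϖ • y → x = y := fun {x y} h =>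
      smul_right_injective _ hϖ.ne_zero h
    let ψ' : H →ₗ[O] MvPolynomial (Fin 2) O :=
      { toFun := ψ
        map_add' := fun x y => hinj (by rw [smul_add, ← hφψ, ← hφψ, ← hφψ, map_add])
        map_smul' := fun c x => hinj (by
          rw [RingHom.id_apply, smul_comm, ← hφψ, ← hφψ, map_smul]) }
    have hpϖ : ϖ ∣ (p : O) := by
      rw [← Ideal.mem_span_singleton, ← hm, ← IsLocalRing.residue_eq_zero_iff, residue_natCast_p]
    obtain ⟨t, ht⟩ := hpϖ
    refine ⟨⟨ψ', ⟨⟨hψ, fun m => ?_⟩, fun g hg h => ?_⟩⟩, Subtype.ext (LinearMap.ext hφψ)⟩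
    · obtain ⟨n, hn⟩ := φ.2.1.2 (m + 1)
      refine ⟨n, fun x hx h e => ?_⟩
      obtain ⟨z, hz⟩ := hn x hx h e
      rw [hφψ, MvPolynomial.coeff_smul, smul_eq_mul, pow_succ', ht] at hz
      refine ⟨t * z, mul_left_cancel₀ hϖ.ne_zero ?_⟩
      change ϖ * MvPolynomial.coeff e (ψ _) = _
      rw [hz, ht]
      ring
    · refine hinj ?_
      change ϖ • ψ _ = ϖ • (χ (redGL g) • symAct (toMatO O g) (ψ h))
      rw [← hφψ, φ.2.2 g hg, hφψ h, map_smul, smul_comm]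

end Lift
end Forms

/-! ### The ranks of the spaces of abstract classical forms -/

section Ranks

theorem homSpace_congr {F Γ P E : Type*} [Field F] [Group Γ] [AddCommGroup P]
    [Module (MonoidAlgebra F Γ)ᵐᵒᵖ P] [Module F P] [IsScalarTower F (MonoidAlgebra F Γ)ᵐᵒᵖ P]
    [AddCommGroup E] [Module F E] {C : Subgroup Γ} {ρ ρ' : Γ → E →ₗ[F] E} (h : ∀ c ∈ C, ρ c = ρ' c)
    (X : Submodule F E) : homSpace P C ρ X = homSpace P C ρ' X := by
  ext β
  exact and_congr_right fun _ => forall₂_congr fun c hc => by rw [h c hc]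

variable {p : ℕ} [Fact p.Prime] {O : Type*} [CommRing O] [IsDomain O] [IsDiscreteValuationRing O]
  [Algebra ℤ_[p] O] [Module.Finite ℤ_[p] O] [FaithfulSMul ℤ_[p] O]

theorem residue_omega [CharP (IsLocalRing.ResidueField O) p] (m : ℤ) (u : (ZMod p)ˣ) :
    IsLocalRing.residue O (omega p O m u) =
      emb (IsLocalRing.ResidueField O) (u : ZMod p) ^ m := by
  have h1 : ∀ x : ℤ_[p], IsLocalRing.residue O (algebraMap ℤ_[p] O x) =
      emb (IsLocalRing.ResidueField O) (PadicInt.toZMod x) := fun x =>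
    congrArg (fun f => f x) (ringHom_padicInt_ext ((IsLocalRing.residue O).comp
      (algebraMap ℤ_[p] O)) ((emb (IsLocalRing.ResidueField O)).comp PadicInt.toZMod))
  have h2 : ∀ x : ℤ_[p], PadicInt.toZMod x =
      WittVector.constantCoeff ((WittVector.equiv p).symm x) := fun x =>
    congrArg (fun f => f x) (ringHom_padicInt_ext PadicInt.toZMod
      (WittVector.constantCoeff.comp (WittVector.equiv p).symm.toRingHom))
  have h3 : ∀ x : Oˣ, IsLocalRing.residue O ((x ^ m : Oˣ) : O) =
      (IsLocalRing.residue O (x : O)) ^ m := fun x => by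
    have := congrArg Units.val (map_zpow (Units.map (IsLocalRing.residue O).toMonoidHom) x m)
    rwa [Units.val_zpow_eq_zpow_val] at this
  rw [omega, MonoidHom.zpow_apply, h3]
  congr 1
  change IsLocalRing.residue O (algebraMap ℤ_[p] O
    (WittVector.equiv p (WittVector.teichmuller p (u : ZMod p)))) = _
  rw [h1, h2, RingEquiv.symm_apply_apply]
  simp

variable (O) in
/-- The character `(α β; 0 δ) ↦ ω(α)^i ω(δ)^j` of the Borel subgroup, extended by zero. -/
def omegaTorus (i j : ℤ) (g : GL (Fin 2) (ZMod p)) : O :=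
  if h : g 0 0 ≠ 0 ∧ g 1 1 ≠ 0 then
    omega p O i (Units.mk0 _ h.1) * omega p O j (Units.mk0 _ h.2) else 0

theorem omegaTorus_of_eq (i j : ℤ) {g : GL (Fin 2) (ZMod p)} {u v : (ZMod p)ˣ}
    (hu : (u : ZMod p) = g 0 0) (hv : (v : ZMod p) = g 1 1) :
    omegaTorus O i j g = omega p O i u * omega p O j v := by
  have h : g 0 0 ≠ 0 ∧ g 1 1 ≠ 0 := ⟨by rw [← hu]; exact u.ne_zero, by rw [← hv]; exact v.ne_zero⟩
  rw [omegaTorus, dif_pos h]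
  congr 3 <;> exact Units.ext (by simp [hu, hv])

theorem exists_units_of_mem_borel {g : GL (Fin 2) (ZMod p)} (hg : g ∈ borel p) :
    ∃ u v : (ZMod p)ˣ, (u : ZMod p) = g 0 0 ∧ (v : ZMod p) = g 1 1 :=
  ⟨Units.mk0 _ (diag_ne_zero_of_mem_borel hg).1, Units.mk0 _ (diag_ne_zero_of_mem_borel hg).2,
    rfl, rfl⟩

theorem omegaTorus_mul (i j : ℤ) {g h : GL (Fin 2) (ZMod p)} (hg : g ∈ borel p) (hh : h ∈ borel p) :
    omegaTorus O i j (g * h) = omegaTorus O i j g * omegaTorus O i j h := by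
  obtain ⟨u, v, hu, hv⟩ := exists_units_of_mem_borel hg
  obtain ⟨u', v', hu', hv'⟩ := exists_units_of_mem_borel hh
  have h0 : ((u * u' : (ZMod p)ˣ) : ZMod p) = (g * h) 0 0 := by
    simp [Matrix.mul_apply, Fin.sum_univ_two, mem_borel.1 hh, hu, hu']
  have h1 : ((v * v' : (ZMod p)ˣ) : ZMod p) = (g * h) 1 1 := by
    simp [Matrix.mul_apply, Fin.sum_univ_two, mem_borel.1 hg, hv, hv']
  rw [omegaTorus_of_eq i j h0 h1, omegaTorus_of_eq i j hu hv, omegaTorus_of_eq i j hu' hv']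
  simp only [map_mul, Units.val_mul]
  ring

theorem redGL_mem_borel {g : GL (Fin 2) ℤ_[p]} : redGL g ∈ borel p ↔ (p : ℤ_[p]) ∣ g 1 0 := by
  rw [← Ideal.mem_span_singleton, ← PadicInt.maximalIdeal_eq_span_p, ← PadicInt.ker_toZMod]
  rfl

section Compare

variable {H : Type*} [AddCommGroup H] [Module O H] [Module (IwasawaAlgebra p O)ᵐᵒᵖ H]

theorem formsIw_eq_charForms (k : ℕ) (i j : ℤ) :
    formsIw O H k (prodChar (omega p O i) (omega p O j)) =
      charForms O H k (borel p) (omegaTorus O i j) := by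
  ext φ
  refine and_congr_right fun _ => ⟨fun h g hg => ?_, fun h g hg u v hu hv => ?_⟩
  · obtain ⟨u, v, hu, hv⟩ := exists_units_of_mem_borel hg
    rw [omegaTorus_of_eq i j hu hv]
    exact h g (redGL_mem_borel.1 hg) u v hu hv
  · have := h g (redGL_mem_borel.2 hg)
    rwa [omegaTorus_of_eq i j hu hv] at this

theorem formsUr_eq_charForms (k : ℕ) (i : ℤ) :
    formsUr O H k (omega p O i) = charForms O H k ⊤
      fun g => (omega p O i (Matrix.GeneralLinearGroup.det g) : O) := by
  ext φ
  refine and_congr_right fun _ => ⟨fun h g _ => ?_, fun h g => ?_⟩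
  · simp only [redGL, Matrix.GeneralLinearGroup.map_det]
    exact h g
  · have := h g trivial
    simpa only [redGL, Matrix.GeneralLinearGroup.map_det] using this

end Compare

open Classical in
/-- The ranks of the spaces of abstract classical forms, as numbers of degrees. -/
theorem IsPrimitiveOfType.finrank_forms {H : Type*} [AddCommGroup H] [Module O H]
    [Module (IwasawaAlgebra p O)ᵐᵒᵖ H] [IsScalarTower O (IwasawaAlgebra p O)ᵐᵒᵖ H]
    [Module.Finite (IwasawaAlgebra p O)ᵐᵒᵖ H] [Module.Projective (IwasawaAlgebra p O)ᵐᵒᵖ H]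
    {a : ℕ} (hH : IsPrimitiveOfType p O H a) (ha1 : 1 ≤ a) (ha2 : a + 1 < p) (k : ℕ) (s : ℤ) :
    (∀ v : ℤ, ((p : ℤ) - 1) ∣ (k - 2 : ℕ) - s + v - a →
      dIw O H k (prodChar (omega p O (-s)) (omega p O v)) =
        ((Finset.range (k - 2 + 1)).filter fun i : ℕ => IsDeg p a s (i : ℤ)).card) ∧
    (((p : ℤ) - 1) ∣ (k - 2 : ℕ) - a - 2 * s → ∀ M, k - 2 < M →
      dUr O H k (omega p O (-s)) = ((Finset.range M).filter fun i : ℕ =>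
        IsDeg p a s (i : ℤ) ∧ threshold p a s i ≤ (k - 2 : ℕ)).card) := by
  have hchar : CharP (IsLocalRing.ResidueField O) p := residue_charP p O
  obtain ⟨P, hP1, hP2, hP, q, hq, hker⟩ := hH
  let : Module (IsLocalRing.ResidueField O) P := Module.compHom P (algebraMap
    (IsLocalRing.ResidueField O)
    (MonoidAlgebra (IsLocalRing.ResidueField O) (GL (Fin 2) (ZMod p)))ᵐᵒᵖ)
  have : IsScalarTower (IsLocalRing.ResidueField O)
      (MonoidAlgebra (IsLocalRing.ResidueField O) (GL (Fin 2) (ZMod p)))ᵐᵒᵖ P :=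
    ⟨fun c x y => by
      rw [Algebra.smul_def, mul_smul]
      rfl⟩
  have : Module.Projective
      (MonoidAlgebra (IsLocalRing.ResidueField O) (GL (Fin 2) (ZMod p)))ᵐᵒᵖ P := hP.1
  have : Module.Finite
      (MonoidAlgebra (IsLocalRing.ResidueField O) (GL (Fin 2) (ZMod p)))ᵐᵒᵖ P := by
    obtain ⟨n, b, ι, hb⟩ := exists_dual_basis (IwasawaAlgebra p O)ᵐᵒᵖ H
    refine ⟨Submodule.fg_iff_exists_fin_generating_family.2 ⟨n, q ∘ b, eq_top_iff.2 ?_⟩⟩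
    rintro x -
    obtain ⟨h, rfl⟩ := hq x
    rw [← hb h, map_sum]
    refine Submodule.sum_mem _ fun j _ => ?_
    rw [map_smulₛₗ]
    exact Submodule.smul_mem _ _ (Submodule.subset_span ⟨j, rfl⟩)
  obtain ⟨π, hπ⟩ := hP.exists_isCover
  refine ⟨fun v hv => ?_, fun hk M hM => ?_⟩
  · rw [dIw, formsIw_eq_charForms, finrank_charForms q hq hker k (borel p)
      (by rw [omegaTorus_of_eq (u := 1) (v := 1) _ _ (by simp) (by simp)]; simp)
      (fun c hc c' hc' => omegaTorus_mul _ _ hc hc'),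
      homSpace_congr (ρ' := formAct _ (torusPow _ (-s) v)) fun c hc => ?_,
      hπ.finrank_borel ha1 ha2 (k - 2) s v hv]
    obtain ⟨x, y, hx, hy⟩ := exists_units_of_mem_borel hc
    rw [formAct, formAct, omegaTorus_of_eq _ _ hx hy, map_mul, residue_omega, residue_omega,
      torusPow, hx, hy]
  · rw [dUr, formsUr_eq_charForms, finrank_charForms q hq hker k ⊤ (by simp)
      (fun c _ c' _ => by simp),
      homSpace_congr (ρ' := formAct _ (detPow _ (-s))) fun c hc => ?_,
      hπ.finrank_forms ha1 ha2 (k - 2) s hk M hM]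
    rw [formAct, formAct, residue_omega, detPow]
    rfl

end Ranks

/-! ### Distances between weight points -/

section WeightPoints

variable {p : ℕ} [Fact p.Prime]

/-- The bound `v_p(n!) ≤ (n - 1) / (p - 1) ≤ (n - 1) / 2`, from which the convergence of the
exponential series on `p ℤ_p` follows. -/
theorem norm_inv_factorial_mul_pow_le (hp : 3 ≤ p) (n : ℕ) :
    ‖((n.factorial : ℚ_[p]))⁻¹‖ ^ 2 ≤ (p : ℝ) ^ (n - 1) := by
  have h0 : ((n.factorial : ℕ) : ℚ_[p]) ≠ 0 := Nat.cast_ne_zero.2 n.factorial_ne_zero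
  have hp1 : (1 : ℝ) ≤ p := by exact_mod_cast (show 1 ≤ p by omega)
  rw [norm_inv, Padic.norm_eq_zpow_neg_valuation h0, Padic.valuation_natCast, zpow_neg, inv_inv,
    zpow_natCast, ← pow_mul]
  refine pow_le_pow_right₀ hp1 ?_
  rcases Nat.eq_zero_or_pos n with rfl | hn
  · simp
  · have h1 := sub_one_mul_padicValNat_factorial_lt_of_ne_zero (p := p) hn.ne'
    have h2 : 2 * padicValNat p n.factorial ≤ (p - 1) * padicValNat p n.factorial :=
      Nat.mul_le_mul_right _ (by omega)
    omega

theorem lt_expSeries_radius (hp : 3 ≤ p) {x : ℚ_[p]} (hx : ‖x‖ ≤ (p : ℝ)⁻¹) :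
    x ∈ Metric.eball (0 : ℚ_[p]) (NormedSpace.expSeries ℚ_[p] ℚ_[p]).radius := by
  have hp1 : (1 : ℝ) < p := by exact_mod_cast (show 1 < p by omega)
  have hs : (1 : ℝ) < √(p : ℝ) := Real.lt_sqrt_of_sq_lt (by simpa using hp1)
  have hsq : √(p : ℝ) ^ 2 = p := Real.sq_sqrt (by linarith)
  let r : NNReal := ⟨(√(p : ℝ))⁻¹, by positivity⟩
  have hr : (r : ENNReal) ≤ (NormedSpace.expSeries ℚ_[p] ℚ_[p]).radius := by
    refine FormalMultilinearSeries.le_radius_of_bound _ 1 fun n => ?_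
    have h1 : ‖NormedSpace.expSeries ℚ_[p] ℚ_[p] n‖ = ‖((n.factorial : ℚ_[p]))⁻¹‖ := by
      rw [NormedSpace.expSeries, norm_smul, ContinuousMultilinearMap.norm_mkPiAlgebraFin, mul_one]
    rw [h1]
    change _ * ((√(p : ℝ))⁻¹) ^ n ≤ 1
    rw [inv_pow, ← div_eq_mul_inv, div_le_one (by positivity)]
    refine le_of_sq_le_sq ?_ (by positivity)
    rw [← pow_mul, mul_comm n 2, pow_mul, hsq]
    exact (norm_inv_factorial_mul_pow_le hp n).trans (pow_le_pow_right₀ hp1.le (by omega))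
  refine Metric.eball_subset_eball hr ?_
  rw [Metric.mem_eball, edist_zero_right, ← ofReal_norm, ENNReal.ofReal_lt_coe_iff (by positivity)]
  refine hx.trans_lt (inv_strictAnti₀ (by positivity) ?_)
  nlinarith

/-- In `exp x - 1 = x + x ^ 2 / 2 + ⋯` the linear term dominates for `x ∈ p ℤ_p`. -/
theorem norm_exp_sub_one (hp : 3 ≤ p) {x : ℚ_[p]} (hx : ‖x‖ ≤ (p : ℝ)⁻¹) :
    ‖NormedSpace.exp x - 1‖ = ‖x‖ := by
  have hp1 : (1 : ℝ) < p := by exact_mod_cast (show 1 < p by omega)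
  rcases eq_or_ne x 0 with rfl | hx0
  · simp
  have hsum := NormedSpace.expSeries_div_hasSum_exp_of_mem_ball ℚ_[p] x (lt_expSeries_radius hp hx)
  have hsum2 : HasSum (fun n => x ^ (n + 2) / (n + 2).factorial) (NormedSpace.exp x - 1 - x) := by
    have := (hasSum_nat_add_iff' 2).2 hsum
    simpa [Finset.sum_range_succ, sub_sub] using this
  have hterm : ∀ n, ‖x ^ (n + 2) / (n + 2).factorial‖ ≤ (√(p : ℝ))⁻¹ * ‖x‖ := fun n => by
    refine le_of_sq_le_sq ?_ (by positivity)
    have h1 := norm_inv_factorial_mul_pow_le hp (n + 2)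
    have h2 : ‖x‖ ^ (n + 1) ≤ ((p : ℝ)⁻¹) ^ (n + 1) := by gcongr
    have h3 : ((p : ℝ)⁻¹) ^ (n + 1) ≤ (p : ℝ)⁻¹ :=
      pow_le_of_le_one (by positivity) (inv_le_one_of_one_le₀ hp1.le) (by omega)
    have h4 : ((√(p : ℝ))⁻¹) ^ 2 = (p : ℝ)⁻¹ := by rw [inv_pow, Real.sq_sqrt (by positivity)]
    rw [div_eq_mul_inv, norm_mul, norm_pow, mul_pow, mul_pow, h4]
    calc (‖x‖ ^ (n + 2)) ^ 2 * ‖((n + 2).factorial : ℚ_[p])⁻¹‖ ^ 2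
        ≤ (‖x‖ ^ (n + 2)) ^ 2 * (p : ℝ) ^ (n + 1) := by gcongr; exact h1
      _ = ‖x‖ ^ 2 * (‖x‖ ^ (n + 1) * (‖x‖ ^ (n + 1) * (p : ℝ) ^ (n + 1))) := by ring
      _ ≤ ‖x‖ ^ 2 * ((p : ℝ)⁻¹ * (((p : ℝ)⁻¹) ^ (n + 1) * (p : ℝ) ^ (n + 1))) := by
        gcongr
        exact h2.trans h3
      _ = (p : ℝ)⁻¹ * ‖x‖ ^ 2 := by
        rw [← mul_pow, inv_mul_cancel₀ (by positivity), one_pow]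
        ring
  have hrest : ‖NormedSpace.exp x - 1 - x‖ < ‖x‖ := by
    have hs : (1 : ℝ) < √(p : ℝ) := Real.lt_sqrt_of_sq_lt (by simpa using hp1)
    refine lt_of_le_of_lt (b := (√(p : ℝ))⁻¹ * ‖x‖) ?_
      (mul_lt_of_lt_one_left (norm_pos_iff.2 hx0) (inv_lt_one_of_one_lt₀ hs))
    refine le_of_tendsto ((continuous_norm.tendsto _).comp hsum2.tendsto_sum_nat)
      (Filter.Eventually.of_forall fun n => ?_)
    exact IsUltrametricDist.norm_sum_le_of_forall_le_of_nonneg (by positivity) fun i _ => hterm i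
  have h1 : NormedSpace.exp x - 1 = (NormedSpace.exp x - 1 - x) + x := by ring
  rw [h1, IsUltrametricDist.norm_add_eq_max_of_norm_ne_norm hrest.ne, max_eq_right hrest.le]

theorem norm_weightPoint_sub (hp : 3 ≤ p) (k k' : ℤ) :
    ‖weightPoint p k - weightPoint p k'‖ = ‖(p : ℚ_[p]) * ((k - k' : ℤ) : ℚ_[p])‖ := by
  have hle : ∀ m : ℤ, ‖(p : ℚ_[p]) * (m : ℚ_[p])‖ ≤ (p : ℝ)⁻¹ := fun m => by
    rw [norm_mul, Padic.norm_p]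
    exact mul_le_of_le_one_right (by positivity) (Padic.norm_int_le_one m)
  have h1 : ‖NormedSpace.exp ((p : ℚ_[p]) * ((k' - 2 : ℤ) : ℚ_[p]))‖ = 1 := by
    have h := norm_exp_sub_one hp (hle (k' - 2))
    have hlt : ‖NormedSpace.exp ((p : ℚ_[p]) * ((k' - 2 : ℤ) : ℚ_[p])) - 1‖ < ‖(1 : ℚ_[p])‖ := by
      rw [h, norm_one]
      exact (hle _).trans_lt (inv_lt_one_of_one_lt₀ (by exact_mod_cast (show 1 < p by omega)))
    have h3 := IsUltrametricDist.norm_add_eq_max_of_norm_ne_norm hlt.ne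
    rwa [sub_add_cancel, max_eq_right hlt.le, norm_one] at h3
  have h2 : weightPoint p k - weightPoint p k' =
      NormedSpace.exp ((p : ℚ_[p]) * ((k' - 2 : ℤ) : ℚ_[p])) *
        (NormedSpace.exp ((p : ℚ_[p]) * ((k - k' : ℤ) : ℚ_[p])) - 1) := by
    rw [mul_sub, ← NormedSpace.exp_add_of_mem_ball (lt_expSeries_radius hp (hle _))
      (lt_expSeries_radius hp (hle _)), weightPoint, weightPoint]
    push_cast
    ring_nf
  rw [h2, norm_mul, h1, one_mul, norm_exp_sub_one hp (hle _)]

theorem weightPoint_sub_ne_zero (hp : 3 ≤ p) {k k' : ℤ} (h : k ≠ k') :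
    weightPoint p k - weightPoint p k' ≠ 0 := by
  rw [← norm_ne_zero_iff, norm_weightPoint_sub hp, norm_ne_zero_iff]
  refine mul_ne_zero (Nat.cast_ne_zero.2 (by omega)) (Int.cast_ne_zero.2 (sub_ne_zero.2 h))

/-- The difference `w_k - w_l` is `exp (p (l - 2)) * (exp (p (k - l)) - 1)`, and the first factor is
a unit. -/
theorem valuation_weightPoint_sub (hp : 3 ≤ p) {k k' : ℤ} (h : k ≠ k') :
    (weightPoint p k - weightPoint p k').valuation = 1 + padicValInt p (k - k') := by
  have h0 := weightPoint_sub_ne_zero hp h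
  have hp0 : (p : ℚ_[p]) ≠ 0 := Nat.cast_ne_zero.2 (by omega)
  have hk0 : ((k - k' : ℤ) : ℚ_[p]) ≠ 0 := Int.cast_ne_zero.2 (sub_ne_zero.2 h)
  have h1 := norm_weightPoint_sub hp k k'
  rw [Padic.norm_eq_zpow_neg_valuation h0, Padic.norm_eq_zpow_neg_valuation (mul_ne_zero hp0 hk0),
    Padic.valuation_mul hp0 hk0, Padic.valuation_p, Padic.valuation_intCast] at h1
  have := zpow_right_injective₀ (a := (p : ℝ)) (by positivity)
    (by exact_mod_cast (show p ≠ 1 by omega)) h1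
  omega

end WeightPoints

/-! ### The sequence of degrees -/

section Degrees

variable {p : ℕ} {a s s' : ℤ}

theorem not_dvd_of_lt (ha1 : 1 ≤ a) (ha2 : a + 4 ≤ p) : ¬ ((p : ℤ) - 1) ∣ a := fun h => by
  have := Int.le_of_dvd (by omega) h
  omega

theorem isDeg_iff_of_dvd {x y i j : ℤ} (h : ((p : ℤ) - 1) ∣ (i - x) - (j - y)) :
    IsDeg p a x i ↔ IsDeg p a y j := by
  unfold IsDeg
  rw [show i - x = (j - y) + ((i - x) - (j - y)) by ring,
    show i - a - x = (j - a - y) + ((i - x) - (j - y)) by ring, dvd_add_left h, dvd_add_left h]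

theorem threshold_eq_of_dvd {x y i j : ℤ} (h : ((p : ℤ) - 1) ∣ (i - x) - (j - y)) :
    threshold p a x i = threshold p a y j + (p + 1) * (i - j) := by
  unfold threshold
  have : ((p : ℤ) - 1) ∣ i - x ↔ ((p : ℤ) - 1) ∣ j - y := by
    rw [show i - x = (j - y) + ((i - x) - (j - y)) by ring, dvd_add_left h]
  rw [if_congr this rfl rfl]
  ring

/-- The reflection `i ↦ N - i`, which underlies the Atkin-Lehner involutions, interchanges the two
residue classes of degrees and replaces `s` by `N - a - s`. -/
theorem isDeg_reflect {N : ℤ} (h : ((p : ℤ) - 1) ∣ s' - (N - a - s)) (i : ℤ) :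
    IsDeg p a s' (N - i) ↔ IsDeg p a s i := by
  unfold IsDeg
  rw [or_comm]
  refine or_congr ?_ ?_
  · rw [show N - i - a - s' = -(i - s) - (s' - (N - a - s)) by ring, dvd_sub_left h, dvd_neg]
  · rw [show N - i - s' = -(i - a - s) - (s' - (N - a - s)) by ring, dvd_sub_left h, dvd_neg]

theorem threshold_reflect (ha1 : 1 ≤ a) (ha2 : a + 4 ≤ p) {N : ℤ}
    (h : ((p : ℤ) - 1) ∣ s' - (N - a - s)) {i : ℤ} (hi : IsDeg p a s i) :
    threshold p a s' (N - i) = (p + 1) * N + 2 * ((p : ℤ) - 1) - threshold p a s i := by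
  have h1 : ((p : ℤ) - 1) ∣ N - i - s' ↔ ((p : ℤ) - 1) ∣ i - a - s := by
    rw [show N - i - s' = -(i - a - s) - (s' - (N - a - s)) by ring, dvd_sub_left h, dvd_neg]
  have h2 : ((p : ℤ) - 1) ∣ i - s → ¬ ((p : ℤ) - 1) ∣ i - a - s := fun h3 h4 =>
    not_dvd_of_lt ha1 ha2 (by simpa using dvd_sub h3 h4)
  unfold threshold
  rw [if_congr h1 rfl rfl]
  rcases hi with hi | hi
  · rw [if_pos hi, if_neg (h2 hi)]
    ring
  · rw [if_neg fun h3 => h2 h3 hi, if_pos hi]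
    ring

theorem dvd_threshold_sub {i : ℤ} (hi : IsDeg p a s i) :
    ((p : ℤ) - 1) ∣ threshold p a s i - (a + 2 * s) := by
  unfold threshold
  split_ifs with h
  · rw [show (p + 1) * i + a - (a + 2 * s) = ((p : ℤ) - 1) * i + (i - s) * 2 by ring]
    exact dvd_add (dvd_mul_right _ _) (h.mul_right _)
  · have h := hi.resolve_left h
    rw [show (p + 1) * i + (2 * ((p : ℤ) - 1) - a) - (a + 2 * s) =
      ((p : ℤ) - 1) * (i + 2) + (i - a - s) * 2 by ring]
    exact dvd_add (dvd_mul_right _ _) (h.mul_right _)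

theorem threshold_ge' (ha1 : 1 ≤ a) (ha2 : a + 4 ≤ p) (i : ℤ) :
    (p + 1) * i + 1 ≤ threshold p a s i := threshold_ge ha1 (by linarith) i

theorem threshold_strictMono (ha1 : 1 ≤ a) (ha2 : a + 4 ≤ p) {i j : ℤ} (hi : IsDeg p a s i)
    (hij : i < j) : threshold p a s i < threshold p a s j := by
  unfold threshold
  have hp : (0 : ℤ) < p + 1 := by positivity
  have h0 := mul_lt_mul_of_pos_left hij hp
  split_ifs with h1 h2 h2
  · linarith
  · linarith
  · have h3 := hi.resolve_left h1
    -- consecutive degrees `i ≡ a + s` and `j ≡ s` are at least `p - 1 - a` apart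
    have h4 : ((p : ℤ) - 1) ∣ j - i + a := by
      have := dvd_sub h2 h3
      rwa [show j - s - (i - a - s) = j - i + a by ring] at this
    have h5 := Int.le_of_dvd (by linarith) h4
    have h6 := mul_le_mul_of_nonneg_left (show (p : ℤ) - 1 - a ≤ j - i by linarith) hp.le
    have h7 : (0 : ℤ) < ((p : ℤ) - 1) * ((p : ℤ) - 1 - a) := mul_pos (by linarith) (by linarith)
    nlinarith
  · linarith

open Classical in
variable (p a s) in
/-- The number of degrees below `M`. -/
def degCount (M : ℕ) : ℕ := Nat.count (fun i : ℕ => IsDeg p a s i) M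

variable (p a s) in
/-- The increasing enumeration of the degrees. -/
def degSeq (n : ℕ) : ℕ := Nat.nth (fun i : ℕ => IsDeg p a s i) n

open Classical in
variable (p a s) in
/-- The number of degrees whose threshold is at most `N`. -/
def urCount (N : ℕ) : ℕ :=
  ((Finset.range (N + 1)).filter fun i : ℕ => IsDeg p a s i ∧ threshold p a s i ≤ N).card

theorem infinite_isDeg (hp : 1 < p) : (Set.ofPred fun i : ℕ => IsDeg p a s i).Infinite := by
  refine Set.infinite_of_forall_exists_gt fun n => ?_
  have h1 := Int.emod_nonneg s (show (p : ℤ) - 1 ≠ 0 by omega)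
  have h2 : (n + 1 : ℤ) ≤ ((p : ℤ) - 1) * (n + 1) := le_mul_of_one_le_left (by positivity)
    (by omega)
  refine ⟨(s % ((p : ℤ) - 1) + ((p : ℤ) - 1) * (n + 1)).toNat, ?_, by omega⟩
  left
  rw [Int.toNat_of_nonneg (by linarith)]
  refine ⟨n + 1 - s / ((p : ℤ) - 1), ?_⟩
  have := Int.emod_add_mul_ediv s ((p : ℤ) - 1)
  linarith

theorem isDeg_degSeq (hp : 1 < p) (n : ℕ) : IsDeg p a s (degSeq p a s n) :=
  Nat.nth_mem_of_infinite (infinite_isDeg hp) n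

theorem degSeq_strictMono (hp : 1 < p) : StrictMono (degSeq p a s) :=
  Nat.nth_strictMono (infinite_isDeg hp)

theorem degCount_degSeq (hp : 1 < p) (n : ℕ) : degCount p a s (degSeq p a s n) = n := by
  classical
  exact Nat.count_nth_of_infinite (infinite_isDeg hp) n

theorem degCount_degSeq_succ (hp : 1 < p) (n : ℕ) :
    degCount p a s (degSeq p a s n + 1) = n + 1 := by
  classical
  exact Nat.count_nth_succ_of_infinite (infinite_isDeg hp) n

theorem degSeq_degCount {i : ℕ} (hi : IsDeg p a s i) : degSeq p a s (degCount p a s i) = i := by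
  classical
  exact Nat.nth_count (p := fun i : ℕ => IsDeg p a s i) hi

theorem lt_degCount_iff (hp : 1 < p) {n M : ℕ} : n < degCount p a s M ↔ degSeq p a s n < M := by
  classical
  rw [← not_le, ← not_le, not_iff_not]
  exact Nat.count_le_iff_le_nth (infinite_isDeg hp)

theorem degCount_succ_eq_card (N : ℕ) [DecidablePred fun i : ℕ => IsDeg p a s i] :
    degCount p a s (N + 1) = ((Finset.range (N + 1)).filter fun i : ℕ => IsDeg p a s i).card := by
  rw [degCount, Nat.count_eq_card_filter_range]
  congr

/-- The thresholds increase with the degrees, so the degrees with threshold at most `N` form an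
initial segment. -/
theorem lt_urCount_iff (ha1 : 1 ≤ a) (ha2 : a + 4 ≤ p) {n N : ℕ} :
    n < urCount p a s N ↔ threshold p a s (degSeq p a s n) ≤ N := by
  have hp : 1 < p := by omega
  have hlt : ∀ i : ℕ, threshold p a s i ≤ N → i < N + 1 := fun i hi => by
    have h1 := threshold_ge' (s := s) ha1 ha2 i
    have h2 : (i : ℤ) ≤ (p + 1) * i := le_mul_of_one_le_left (by positivity) (by omega)
    omega
  constructor
  · intro h
    by_contra! h2
    -- every degree that is counted is less than the `n`-th one
    have h3 : urCount p a s N ≤ degCount p a s (degSeq p a s n) := by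
      classical
      rw [degCount, Nat.count_eq_card_filter_range]
      refine Finset.card_le_card fun i hi => ?_
      simp only [Finset.mem_filter, Finset.mem_range] at hi ⊢
      refine ⟨?_, hi.2.1⟩
      by_contra! hni
      rcases hni.eq_or_lt with e | hlt
      · rw [e] at h2
        exact absurd hi.2.2 (not_le.2 h2)
      · have := threshold_strictMono (i := degSeq p a s n) (j := i) ha1 ha2 (isDeg_degSeq hp n)
          (by exact_mod_cast hlt)
        linarith [hi.2.2]
    rw [degCount_degSeq hp] at h3
    omega
  · intro h
    have h3 : degCount p a s (degSeq p a s n + 1) ≤ urCount p a s N := by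
      classical
      rw [degCount, Nat.count_eq_card_filter_range]
      refine Finset.card_le_card fun i hi => ?_
      simp only [Finset.mem_filter, Finset.mem_range] at hi ⊢
      have : threshold p a s i ≤ N := by
        rcases (Nat.lt_succ_iff.1 hi.1).eq_or_lt with e | hlt
        · rw [e]
          exact h
        · exact (threshold_strictMono ha1 ha2 hi.2 (by exact_mod_cast hlt)).le.trans h
      exact ⟨hlt i this, hi.2, this⟩
    rw [degCount_degSeq_succ hp] at h3
    omega

theorem degCount_reflect_add {N : ℕ} (h : ((p : ℤ) - 1) ∣ s' - (N - a - s)) {m : ℕ}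
    (hm : m ≤ N + 1) :
    degCount p a s' m + degCount p a s (N + 1 - m) = degCount p a s (N + 1) := by
  classical
  induction m with
  | zero => simp [degCount]
  | succ m ih =>
    have h1 : IsDeg p a s' m ↔ IsDeg p a s (N - m : ℕ) := by
      rw [← isDeg_reflect h]
      push_cast [show m ≤ N by omega]
      rw [sub_sub_cancel]
    rw [← ih (by omega), show N + 1 - m = N + 1 - (m + 1) + 1 by omega]
    unfold degCount
    rw [Nat.count_succ, Nat.count_succ, if_congr h1 rfl rfl,
      show N + 1 - (m + 1) = N - m by omega]
    omega

theorem degCount_reflect {N : ℕ} (h : ((p : ℤ) - 1) ∣ s' - (N - a - s)) :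
    degCount p a s' (N + 1) = degCount p a s (N + 1) := by
  have := degCount_reflect_add h le_rfl
  rw [Nat.sub_self] at this
  simpa [degCount] using this

/-- The reflection `i ↦ N - i` reverses the order of the degrees up to `N`. -/
theorem degSeq_reflect (hp : 1 < p) {N n : ℕ} (h : ((p : ℤ) - 1) ∣ s' - (N - a - s))
    (hn : n < degCount p a s (N + 1)) :
    (degSeq p a s' (degCount p a s (N + 1) - 1 - n) : ℤ) = N - degSeq p a s n := by
  have h1 := (lt_degCount_iff hp).1 hn
  have h2 := degCount_reflect_add h (m := N - degSeq p a s n) (by omega)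
  rw [show N + 1 - (N - degSeq p a s n) = degSeq p a s n + 1 by omega,
    degCount_degSeq_succ hp] at h2
  have h3 : IsDeg p a s' (N - degSeq p a s n : ℕ) := by
    push_cast [show degSeq p a s n ≤ N by omega]
    rw [isDeg_reflect h]
    exact isDeg_degSeq hp n
  have h4 := degSeq_degCount h3
  rw [show degCount p a s' (N - degSeq p a s n) = degCount p a s (N + 1) - 1 - n by omega] at h4
  rw [h4]
  push_cast [show degSeq p a s n ≤ N by omega]
  rfl

/-- The degrees beyond `N` are the degrees for `s - 1 - N`, shifted by `N + 1`. -/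
theorem degSeq_shift (hp : 1 < p) {N l : ℕ} (h : ((p : ℤ) - 1) ∣ s' - (s - 1 - N)) :
    (degSeq p a s (degCount p a s (N + 1) + l) : ℤ) = N + 1 + degSeq p a s' l := by
  have hiff : ∀ j : ℕ, IsDeg p a s (N + 1 + j : ℕ) ↔ IsDeg p a s' j := fun j => by
    refine isDeg_iff_of_dvd ?_
    push_cast
    rwa [show (N : ℤ) + 1 + j - s - (j - s') = s' - (s - 1 - N) by ring]
  have h1 : degCount p a s (N + 1 + degSeq p a s' l) = degCount p a s (N + 1) + l := by
    classical
    conv_rhs => rw [← degCount_degSeq (s := s') (a := a) hp l]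
    unfold degCount
    rw [Nat.count_add]
    simp only [hiff]
  have h2 := degSeq_degCount ((hiff _).2 (isDeg_degSeq hp l))
  rw [h1] at h2
  rw [h2]
  push_cast
  ring

end Degrees

/-! ### Increments of the ghost multiplicities -/

section Multiplicities

variable {p : ℕ} {a s s' : ℤ}

variable (p a s) in
/-- The ghost multiplicity of the weight `N + 2`, in terms of numbers of degrees. -/
def latticeMult (n N : ℕ) : ℕ :=
  if urCount p a s N < n ∧ n < degCount p a s (N + 1) - urCount p a s N then
    min (n - urCount p a s N) (degCount p a s (N + 1) - urCount p a s N - n) else 0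

variable (p a s) in
/-- The ghost multiplicity of the weight `N + 2`, extended by zero to negative `N`. -/
def intMult (n : ℕ) (N : ℤ) : ℤ := if 0 ≤ N then latticeMult p a s n N.toNat else 0

variable (p a s) in
/-- The increment of the ghost multiplicity of the weight `N + 2` at the degree `i`. The
multiplicity, as a function of `n`, starts to increase at the first degree with threshold greater
than `N`, turns at the middle of the degrees up to `N`, and stops decreasing at the reflection of
its beginning under `i ↦ N - i`; the three indicators test whether `i` has passed these points. -/
def multStep (N i : ℤ) : ℤ :=
  (if N < threshold p a s i then 1 else 0) +
    (if p * N + 2 * ((p : ℤ) - 1) ≤ threshold p a s i then 1 else 0) -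
    2 * (if N ≤ 2 * i then 1 else 0)

theorem ne_two_mul (ha1 : 1 ≤ a) (ha2 : a + 4 ≤ p) {N i : ℤ}
    (hN : ((p : ℤ) - 1) ∣ N - a - 2 * s) (hi : IsDeg p a s i) : N ≠ 2 * i := by
  rintro rfl
  refine not_dvd_of_lt ha1 ha2 ?_
  rcases hi with h | h
  · rw [show a = (i - s) * 2 - (2 * i - a - 2 * s) by ring]
    exact dvd_sub (h.mul_right _) hN
  · rw [show a = (2 * i - a - 2 * s) - (i - a - s) * 2 by ring]
    exact dvd_sub hN (h.mul_right _)

theorem dvd_self_reflect {N : ℤ} (hN : ((p : ℤ) - 1) ∣ N - a - 2 * s) :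
    ((p : ℤ) - 1) ∣ s - (N - a - s) := by
  rwa [show s - (N - a - s) = -(N - a - 2 * s) by ring, dvd_neg]

/-- The ghost multiplicity turns from increasing to decreasing at the middle of the degrees up to
`N`, which is fixed by the reflection `i ↦ N - i`. -/
theorem degCount_le_iff (ha1 : 1 ≤ a) (ha2 : a + 4 ≤ p) {N n : ℕ}
    (hN : ((p : ℤ) - 1) ∣ N - a - 2 * s) :
    degCount p a s (N + 1) ≤ 2 * n + 1 ↔ (N : ℤ) ≤ 2 * degSeq p a s n := by
  have hp : 1 < p := by omega
  rcases lt_or_ge n (degCount p a s (N + 1)) with h | h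
  · have h1 := degSeq_reflect hp (dvd_self_reflect hN) h
    have h2 := (degSeq_strictMono (a := a) (s := s) hp).le_iff_le
      (a := degCount p a s (N + 1) - 1 - n) (b := n)
    omega
  · have h1 := mt (lt_degCount_iff (a := a) (s := s) hp (n := n) (M := N + 1)).2 (not_lt.2 h)
    omega

theorem two_mul_urCount_le (ha1 : 1 ≤ a) (ha2 : a + 4 ≤ p) {N : ℕ}
    (hN : ((p : ℤ) - 1) ∣ N - a - 2 * s) : 2 * urCount p a s N ≤ degCount p a s (N + 1) := by
  by_contra! h
  have h1 := (lt_urCount_iff (s := s) ha1 ha2 (n := urCount p a s N - 1) (N := N)).1 (by omega)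
  have h2 := (degCount_le_iff ha1 ha2 hN (n := urCount p a s N - 1)).1 (by omega)
  have h3 := threshold_ge' (s := s) ha1 ha2 (degSeq p a s (urCount p a s N - 1))
  have h4 : (2 : ℤ) * degSeq p a s (urCount p a s N - 1) ≤
      (p + 1) * degSeq p a s (urCount p a s N - 1) :=
    mul_le_mul_of_nonneg_right (by linarith) (by positivity)
  linarith

/-- The reflection `i ↦ N - i` has no fixed point among the degrees. -/
theorem even_degCount (ha1 : 1 ≤ a) (ha2 : a + 4 ≤ p) {N : ℕ}
    (hN : ((p : ℤ) - 1) ∣ N - a - 2 * s) : Even (degCount p a s (N + 1)) := by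
  by_contra h
  obtain ⟨e, he⟩ := Nat.not_even_iff_odd.1 h
  have hp : 1 < p := by omega
  have h1 := degSeq_reflect hp (n := e) (dvd_self_reflect hN) (by omega)
  rw [show degCount p a s (N + 1) - 1 - e = e by omega] at h1
  exact ne_two_mul ha1 ha2 hN (isDeg_degSeq hp e) (by linarith)

/-- The end of the range in which the ghost series vanishes is the reflection of its beginning; the
stated threshold is the reflection of `N`. -/
theorem degCount_sub_le_iff (ha1 : 1 ≤ a) (ha2 : a + 4 ≤ p) {N n : ℕ}
    (hN : ((p : ℤ) - 1) ∣ N - a - 2 * s) :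
    degCount p a s (N + 1) - urCount p a s N ≤ n ↔
      p * N + 2 * ((p : ℤ) - 1) ≤ threshold p a s (degSeq p a s n) := by
  have hp : 1 < p := by omega
  have hu := two_mul_urCount_le ha1 ha2 hN
  rcases lt_or_ge n (degCount p a s (N + 1)) with h | h
  · have h1 := lt_urCount_iff (s := s) ha1 ha2 (n := degCount p a s (N + 1) - 1 - n) (N := N)
    rw [degSeq_reflect hp (dvd_self_reflect hN) h,
      threshold_reflect ha1 ha2 (dvd_self_reflect hN) (isDeg_degSeq hp n)] at h1
    rw [show degCount p a s (N + 1) - urCount p a s N ≤ n ↔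
      degCount p a s (N + 1) - 1 - n < urCount p a s N by omega, h1]
    constructor <;> intro <;> linarith
  · refine iff_of_true (by omega) ?_
    have h1 := mt (lt_degCount_iff (a := a) (s := s) hp (n := n) (M := N + 1)).2 (not_lt.2 h)
    have h2 := threshold_ge' (s := s) ha1 ha2 (degSeq p a s n)
    have h3 : ((p : ℤ) + 1) * (N + 1) ≤ (p + 1) * degSeq p a s n :=
      mul_le_mul_of_nonneg_left (by omega) (by positivity)
    -- both sides are congruent modulo `p - 1`
    have h4 : ((p : ℤ) - 1) ∣ threshold p a s (degSeq p a s n) - (p * N + 2 * ((p : ℤ) - 1)) +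
        (p - 1) := by
      have := dvd_sub (dvd_sub (dvd_threshold_sub (isDeg_degSeq (s := s) (a := a) hp n)) hN)
        (dvd_mul_right ((p : ℤ) - 1) (N + 1))
      rwa [show threshold p a s (degSeq p a s n) - (a + 2 * s) - ((N : ℤ) - a - 2 * s) -
        ((p : ℤ) - 1) * (N + 1) = threshold p a s (degSeq p a s n) -
          (p * N + 2 * ((p : ℤ) - 1)) + (p - 1) by ring] at this
    have h5 := Int.le_of_dvd (by linarith) h4
    linarith

/-- For negative `N` the three indicators in `multStep` are all equal to one, and both sides are
zero. -/
theorem intMult_succ_sub (ha1 : 1 ≤ a) (ha2 : a + 4 ≤ p) {N : ℤ}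
    (hN : ((p : ℤ) - 1) ∣ N - a - 2 * s) (n : ℕ) :
    intMult p a s (n + 1) N - intMult p a s n N = multStep p a s N (degSeq p a s n) := by
  rcases lt_or_ge N 0 with h | h
  · have h1 := threshold_ge' (s := s) ha1 ha2 (degSeq p a s n)
    have h2 : 0 ≤ ((p : ℤ) + 1) * degSeq p a s n := by positivity
    have h3 : p * N ≤ p * (-1) := mul_le_mul_of_nonneg_left (by omega) (by positivity)
    have h5 : ((p : ℤ) - 1) ∣ threshold p a s (degSeq p a s n) - (p * N + 2 * ((p : ℤ) - 1)) +
        (p - 1) := by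
      have := dvd_sub (dvd_sub (dvd_threshold_sub (isDeg_degSeq (s := s) (a := a) (n := n)
        (by omega : 1 < p))) hN) (dvd_mul_right ((p : ℤ) - 1) (N + 1))
      rwa [show threshold p a s (degSeq p a s n) - (a + 2 * s) - ((N : ℤ) - a - 2 * s) -
        ((p : ℤ) - 1) * (N + 1) = threshold p a s (degSeq p a s n) -
          (p * N + 2 * ((p : ℤ) - 1)) + (p - 1) by ring] at this
    have h6 := Int.le_of_dvd (by linarith) h5
    rw [intMult, intMult, if_neg (by omega), if_neg (by omega), multStep, if_pos (by linarith),
      if_pos (by linarith), if_pos (by linarith)]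
    norm_num
  · obtain ⟨N, rfl⟩ := Int.eq_ofNat_of_zero_le h
    have h1 : (N : ℤ) < threshold p a s (degSeq p a s n) ↔ urCount p a s N ≤ n := by
      rw [← not_le, ← lt_urCount_iff ha1 ha2, not_lt]
    rw [intMult, intMult, if_pos h, if_pos h, multStep, if_congr h1 rfl rfl,
      if_congr (degCount_sub_le_iff ha1 ha2 hN).symm rfl rfl,
      if_congr (degCount_le_iff ha1 ha2 hN).symm rfl rfl, Int.toNat_natCast, latticeMult,
      latticeMult]
    have h2 := two_mul_urCount_le ha1 ha2 hN
    obtain ⟨e, he⟩ := even_degCount ha1 ha2 hN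
    generalize urCount p a s N = u at *
    generalize degCount p a s (N + 1) = D at *
    subst he
    split_ifs <;> omega

theorem intMult_zero (N : ℤ) : intMult p a s 0 N = 0 := by
  simp [intMult, latticeMult]

theorem intMult_nonneg (n : ℕ) (N : ℤ) : 0 ≤ intMult p a s n N := by
  unfold intMult
  split_ifs <;> positivity

theorem intMult_eq_zero (ha1 : 1 ≤ a) (ha2 : a + 4 ≤ p) {n : ℕ} {N : ℤ}
    (h : threshold p a s (degSeq p a s n) ≤ N) : intMult p a s n N = 0 := by
  unfold intMult
  split_ifs with h0
  · obtain ⟨N, rfl⟩ := Int.eq_ofNat_of_zero_le h0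
    have h1 := (lt_urCount_iff ha1 ha2).2 h
    rw [Int.toNat_natCast, latticeMult, if_neg (by omega)]
    rfl
  · rfl

end Multiplicities

/-! ### Sums over weights -/

section WeightedSums

variable {p : ℕ}

variable (p) in
/-- The sum of `f x (1 + v_p(x))` over the nonzero `x ≡ z` modulo `p - 1` with `|x| ≤ R`. -/
def weightedSum (z : ℤ) (R : ℕ) (f : ℤ → ℤ) : ℤ :=
  ∑ x ∈ (Finset.Icc (-(R : ℤ)) R).filter fun x => ((p : ℤ) - 1) ∣ x - z ∧ x ≠ 0,
    f x * (1 + padicValInt p x)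

theorem weightedSum_congr {z : ℤ} {R : ℕ} {f g : ℤ → ℤ}
    (h : ∀ x, ((p : ℤ) - 1) ∣ x - z → f x = g x) : weightedSum p z R f = weightedSum p z R g :=
  Finset.sum_congr rfl fun x hx => by rw [h x (Finset.mem_filter.1 hx).2.1]

theorem weightedSum_congr_class {z z' : ℤ} (h : ((p : ℤ) - 1) ∣ z - z') (R : ℕ) (f : ℤ → ℤ) :
    weightedSum p z R f = weightedSum p z' R f := by
  unfold weightedSum
  congr 1
  refine Finset.filter_congr fun x _ => ?_
  rw [show x - z' = (x - z) + (z - z') by ring, dvd_add_left h]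

theorem weightedSum_add (z : ℤ) (R : ℕ) (f g : ℤ → ℤ) :
    weightedSum p z R (fun x => f x + g x) = weightedSum p z R f + weightedSum p z R g := by
  simp only [weightedSum, add_mul, Finset.sum_add_distrib]

theorem weightedSum_sub (z : ℤ) (R : ℕ) (f g : ℤ → ℤ) :
    weightedSum p z R (fun x => f x - g x) = weightedSum p z R f - weightedSum p z R g := by
  simp only [weightedSum, sub_mul, Finset.sum_sub_distrib]

theorem weightedSum_neg (z : ℤ) (R : ℕ) (f : ℤ → ℤ) :
    weightedSum p z R f = weightedSum p (-z) R fun x => f (-x) := by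
  unfold weightedSum
  refine Finset.sum_nbij' (fun x => -x) (fun x => -x) (fun x hx => ?_) (fun x hx => ?_)
    (fun x _ => neg_neg x) (fun x _ => neg_neg x) fun x _ => ?_
  · simp only [Finset.mem_filter, Finset.mem_Icc] at hx ⊢
    rw [show -x - -z = -(x - z) by ring, dvd_neg]
    exact ⟨by omega, hx.2.1, by omega⟩
  · simp only [Finset.mem_filter, Finset.mem_Icc] at hx ⊢
    rw [show -x - z = -(x - -z) by ring, dvd_neg]
    exact ⟨by omega, hx.2.1, by omega⟩
  · simp [padicValInt]

theorem weightedSum_ite_eq {z y : ℤ} {R : ℕ} (hy : ((p : ℤ) - 1) ∣ y - z) (h0 : y ≠ 0)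
    (hR : y.natAbs ≤ R) :
    weightedSum p z R (fun x => if x = y then 1 else 0) = 1 + padicValInt p y := by
  unfold weightedSum
  rw [Finset.sum_eq_single_of_mem y]
  · simp
  · simp only [Finset.mem_filter, Finset.mem_Icc]
    exact ⟨by omega, hy, h0⟩
  · intro x _ hx
    simp [hx]

theorem weightedSum_eq_zero {z : ℤ} {R : ℕ} {f : ℤ → ℤ} (h : ∀ x, x ≠ 0 → f x = 0) :
    weightedSum p z R f = 0 :=
  Finset.sum_eq_zero fun x hx => by rw [h x (Finset.mem_filter.1 hx).2.2, zero_mul]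

variable [Fact p.Prime]

/-- The points `V - (p - 1)` and `(V - (p - 1)) / p` contribute `1 + v_p(V - (p - 1))` and
`v_p(V - (p - 1))`. -/
theorem weightedSum_unit_step {z V : ℤ} {R : ℕ} (hV : ((p : ℤ) - 1) ∣ V - z)
    (hR : (V - ((p : ℤ) - 1)).natAbs ≤ R) :
    weightedSum p z R (fun x => (if x = V - ((p : ℤ) - 1) then 1 else 0) -
      (if p * x = V - ((p : ℤ) - 1) then 1 else 0)) = if V - ((p : ℤ) - 1) ≠ 0 then 1 else 0 := by
  have hp : 1 < p := (Fact.out : p.Prime).one_lt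
  generalize hW : V - ((p : ℤ) - 1) = W at *
  have hWz : ((p : ℤ) - 1) ∣ W - z := by
    rw [← hW, show V - ((p : ℤ) - 1) - z = V - z - (p - 1) by ring]
    exact dvd_sub hV dvd_rfl
  rcases eq_or_ne W 0 with h0 | h0
  · subst h0
    rw [if_neg (by simp)]
    refine weightedSum_eq_zero fun x hx => ?_
    rw [if_neg hx, if_neg (mul_ne_zero (by omega) hx), sub_zero]
  rw [if_pos h0, weightedSum_sub, weightedSum_ite_eq hWz h0 hR]
  by_cases hd : (p : ℤ) ∣ W
  · obtain ⟨y, hy⟩ := hd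
    subst hy
    have hp0 : (p : ℤ) ≠ 0 := by omega
    have hy0 : y ≠ 0 := right_ne_zero_of_mul h0
    have h1 : (fun x : ℤ => if (p : ℤ) * x = p * y then (1 : ℤ) else 0) =
        fun x => if x = y then 1 else 0 := by
      funext x
      exact if_congr (mul_right_inj' hp0) rfl rfl
    have hyz : ((p : ℤ) - 1) ∣ y - z := by
      have := dvd_sub hWz (dvd_mul_right ((p : ℤ) - 1) y)
      rwa [show (p : ℤ) * y - z - (p - 1) * y = y - z by ring] at this
    have hyR : y.natAbs ≤ R := by
      refine le_trans ?_ hR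
      rw [Int.natAbs_mul]
      exact Nat.le_mul_of_pos_left _ (by simp; omega)
    rw [h1, weightedSum_ite_eq hyz hy0 hyR, padicValInt.mul hp0 hy0, padicValInt_self]
    push_cast
    ring
  · rw [weightedSum_eq_zero, padicValInt.eq_zero_of_not_dvd hd]
    · norm_num
    · intro x _
      exact if_neg fun h => hd ⟨x, h.symm⟩

theorem ite_lt_sub_ite_lt {q x V : ℤ} (hq : 0 < q) (h : q ∣ x - V) :
    (if x < V then (1 : ℤ) else 0) - (if x < V - q then 1 else 0) = if x = V - q then 1 else 0 := by
  rcases lt_trichotomy x (V - q) with h1 | h1 | h1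
  · rw [if_pos (by omega), if_pos h1, if_neg h1.ne, sub_self]
  · rw [if_pos (by omega), if_neg (by omega), if_pos h1, sub_zero]
  · have h2 : ¬ x < V := fun h2 => by
      have := Int.le_of_dvd (by omega) ((dvd_sub_comm).1 h)
      omega
    rw [if_neg h2, if_neg (by omega), if_neg (by omega), sub_zero]

/-- The weighted count behind both the theta maps and the Atkin-Lehner involutions: although the
individual sums involve valuations, the difference is a number of integers. -/
theorem weightedSum_steps {z U : ℤ} (hU : ((p : ℤ) - 1) ∣ U - z) (M : ℕ) :
    ∀ᶠ R : ℕ in Filter.atTop, weightedSum p z R (fun x =>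
      (if x < U then 1 else 0) - (if x < U - ((p : ℤ) - 1) * M then 1 else 0) +
      (if p * x < U - ((p : ℤ) - 1) * M then 1 else 0) - (if p * x < U then 1 else 0)) =
      ∑ j ∈ Finset.range M, if U - ((p : ℤ) - 1) * (j + 1) ≠ 0 then 1 else 0 := by
  have hp : 1 < p := (Fact.out : p.Prime).one_lt
  induction M with
  | zero =>
    refine Filter.Eventually.of_forall fun R => ?_
    rw [Finset.sum_range_zero]
    refine weightedSum_eq_zero fun x _ => ?_
    simp
  | succ M ih =>
    filter_upwards [ih,
      Filter.eventually_ge_atTop (U - ((p : ℤ) - 1) * (M + 1)).natAbs] with R h1 h2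
    have hV : ((p : ℤ) - 1) ∣ U - ((p : ℤ) - 1) * M - z := by
      rw [show U - ((p : ℤ) - 1) * M - z = U - z - (p - 1) * M by ring]
      exact dvd_sub hU (dvd_mul_right _ _)
    have e : U - ((p : ℤ) - 1) * M - ((p : ℤ) - 1) = U - (p - 1) * (M + 1) := by ring
    have h3 := weightedSum_unit_step hV (R := R) (by rwa [e])
    rw [e] at h3
    rw [Finset.sum_range_succ, ← h1, ← h3, ← weightedSum_add]
    refine weightedSum_congr fun x hx => ?_
    have hx1 : ((p : ℤ) - 1) ∣ x - (U - ((p : ℤ) - 1) * M) := by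
      have := dvd_sub hx hV
      rwa [show x - z - (U - ((p : ℤ) - 1) * M - z) = x - (U - ((p : ℤ) - 1) * M) by ring] at this
    have hx2 : ((p : ℤ) - 1) ∣ p * x - (U - ((p : ℤ) - 1) * M) := by
      rw [show (p : ℤ) * x - (U - ((p : ℤ) - 1) * M) = (x - (U - ((p : ℤ) - 1) * M)) + (p - 1) * x
        by ring]
      exact dvd_add hx1 (dvd_mul_right _ _)
    have h4 := ite_lt_sub_ite_lt (by omega) hx1
    have h5 := ite_lt_sub_ite_lt (by omega) hx2
    rw [e] at h4 h5
    push_cast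
    linarith

end WeightedSums

/-! ### The valuations of the coefficients of the ghost series -/

section GhostVal

variable {p : ℕ} {a s s' : ℤ}

variable (p a s) in
/-- The valuation of the `n`-th coefficient of the ghost series at the weight `N₀ + 2`, in terms
of numbers of degrees; the zero at `N₀ + 2` itself, if there is one, is left out. -/
def ghostVal (N₀ : ℤ) (n : ℕ) : ℤ :=
  ∑ᶠ x : ℤ, if ((p : ℤ) - 1) ∣ x - (a + 2 * s - N₀) ∧ x ≠ 0 then
    intMult p a s n (x + N₀) * (1 + padicValInt p x) else 0

theorem eventually_weightedSum_intMult (ha1 : 1 ≤ a) (ha2 : a + 4 ≤ p) (N₀ : ℤ) (n : ℕ) :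
    ∀ᶠ R : ℕ in Filter.atTop, weightedSum p (a + 2 * s - N₀) R (fun x => intMult p a s n (x + N₀)) =
      ghostVal p a s N₀ n := by
  filter_upwards [Filter.eventually_ge_atTop (threshold p a s (degSeq p a s n) - N₀).natAbs,
    Filter.eventually_ge_atTop N₀.natAbs] with R h1 h2
  rw [ghostVal, weightedSum, Finset.sum_filter]
  refine (finsum_eq_sum_of_support_subset _ fun x hx => ?_).symm
  rw [Function.mem_support] at hx
  have h3 : intMult p a s n (x + N₀) ≠ 0 := fun h => hx (by simp [h])
  have h4 : 0 ≤ x + N₀ := by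
    by_contra h
    exact h3 (if_neg h)
  have h5 : ¬ threshold p a s (degSeq p a s n) ≤ x + N₀ := mt (intMult_eq_zero ha1 ha2) h3
  simp only [Finset.coe_Icc, Set.mem_Icc]
  omega

theorem ghostVal_zero (N₀ : ℤ) : ghostVal p a s N₀ 0 = 0 := by
  simp [ghostVal, intMult_zero]

theorem ghostVal_nonneg (N₀ : ℤ) (n : ℕ) : 0 ≤ ghostVal p a s N₀ n := by
  refine finsum_nonneg fun x => ?_
  have := intMult_nonneg (p := p) (a := a) (s := s) n (x + N₀)
  split_ifs <;> positivity

theorem eventually_weightedSum_multStep (ha1 : 1 ≤ a) (ha2 : a + 4 ≤ p) (N₀ : ℤ) (n : ℕ) :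
    ∀ᶠ R : ℕ in Filter.atTop,
      weightedSum p (a + 2 * s - N₀) R (fun x => multStep p a s (x + N₀) (degSeq p a s n)) =
        ghostVal p a s N₀ (n + 1) - ghostVal p a s N₀ n := by
  filter_upwards [eventually_weightedSum_intMult (s := s) ha1 ha2 N₀ n,
    eventually_weightedSum_intMult (s := s) ha1 ha2 N₀ (n + 1)] with R h1 h2
  rw [← h1, ← h2, ← weightedSum_sub]
  refine weightedSum_congr fun x hx => (intMult_succ_sub ha1 ha2 ?_ n).symm
  rwa [show x + N₀ - a - 2 * s = x - (a + 2 * s - N₀) by ring]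

theorem sum_range_ite_ne_zero {q U : ℤ} (hq : 0 < q) (M : ℕ) :
    ∑ j ∈ Finset.range M, (if U - q * (j + 1) ≠ 0 then (1 : ℤ) else 0) =
      M - if q ∣ U ∧ 0 < U ∧ U ≤ q * M then 1 else 0 := by
  induction M with
  | zero => simp
  | succ M ih =>
    rw [Finset.sum_range_succ, ih]
    push_cast
    have e : q * ((M : ℤ) + 1) = q * M + q := by ring
    have hM : 0 ≤ q * (M : ℤ) := by positivity
    by_cases h : U - q * (M + 1) = 0
    · have h1 : q ∣ U := ⟨M + 1, by linarith⟩
      rw [if_neg (by omega), if_neg (by omega), if_pos ⟨h1, by omega, by omega⟩]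
      ring
    · rw [if_pos h]
      have : (q ∣ U ∧ 0 < U ∧ U ≤ q * M) ↔ (q ∣ U ∧ 0 < U ∧ U ≤ q * ((M : ℤ) + 1)) := by
        refine and_congr_right fun h1 => and_congr_right fun _ => ⟨by omega, fun h2 => ?_⟩
        obtain ⟨y, rfl⟩ := h1
        have h3 : y ≤ M + 1 := le_of_mul_le_mul_left h2 hq
        have h4 : y ≠ M + 1 := fun h4 => h (by rw [h4, sub_self])
        exact mul_le_mul_of_nonneg_left (by omega) hq.le
      rw [if_congr this rfl rfl]
      ring

theorem lt_iff_le_sub {q y V : ℤ} (hq : 0 < q) (h : q ∣ y - V) : y < V ↔ y ≤ V - q := by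
  refine ⟨fun h1 => ?_, fun h1 => by omega⟩
  have := Int.le_of_dvd (by omega) ((dvd_sub_comm).1 h)
  omega

/-- The difference of two increments that correspond under a shift of the degrees by `N₀ + 1`. The
indicators in `multStep` that involve the middle of the degrees cancel, and the others combine into
a step function of `x` minus the same step function of `p * x`, whose weighted sum is evaluated in
`weightedSum_steps`. -/
theorem multStep_sub_shift (ha1 : 1 ≤ a) (ha2 : a + 4 ≤ p) {N₀ j x T : ℤ}
    (h : ((p : ℤ) - 1) ∣ s' - (s - 1 - N₀)) (hj : IsDeg p a s' j)
    (hx : ((p : ℤ) - 1) ∣ x - (a + 2 * s - N₀)) (hT : threshold p a s (N₀ + 1 + j) = T) :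
    multStep p a s (x + N₀) (N₀ + 1 + j) - multStep p a s' (x + (-N₀ - 2)) j =
      (if x < T - N₀ then 1 else 0) -
      (if x < T - N₀ - ((p : ℤ) - 1) * (N₀ + 1) then 1 else 0) +
      (if p * x < T - N₀ - ((p : ℤ) - 1) * (N₀ + 1) then 1 else 0) -
      (if p * x < T - N₀ then 1 else 0) := by
  have hq : (0 : ℤ) < (p : ℤ) - 1 := by linarith
  have h0 : ((p : ℤ) - 1) ∣ N₀ + 1 + j - s - (j - s') := by
    rwa [show N₀ + 1 + j - s - (j - s') = s' - (s - 1 - N₀) by ring]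
  have hT' : T = threshold p a s' j + (p + 1) * (N₀ + 1 + j - j) := by
    rw [← hT, threshold_eq_of_dvd h0]
  have hd : ((p : ℤ) - 1) ∣ T - (a + 2 * s) := by
    rw [← hT]
    exact dvd_threshold_sub ((isDeg_iff_of_dvd h0).2 hj)
  have hU : ((p : ℤ) - 1) ∣ p * x - (T - N₀) := by
    have := dvd_add (dvd_sub hx hd) (dvd_mul_right ((p : ℤ) - 1) x)
    rwa [show x - (a + 2 * s - N₀) - (T - (a + 2 * s)) + (p - 1) * x = p * x - (T - N₀) by
      ring] at this
  have hU' : ((p : ℤ) - 1) ∣ p * x - (T - N₀ - ((p : ℤ) - 1) * (N₀ + 1)) := by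
    have := dvd_add hU (dvd_mul_right ((p : ℤ) - 1) (N₀ + 1))
    rwa [show p * x - (T - N₀) + (p - 1) * (N₀ + 1) =
      p * x - (T - N₀ - ((p : ℤ) - 1) * (N₀ + 1)) by ring] at this
  have e1 := lt_iff_le_sub hq hU
  have e2 := lt_iff_le_sub hq hU'
  have m1 : (p : ℤ) * (x + N₀) = p * x + p * N₀ := by ring
  have m2 : (p : ℤ) * (x + (-N₀ - 2)) = p * x - p * N₀ - 2 * p := by ring
  have m3 : ((p : ℤ) - 1) * (N₀ + 1) = p * N₀ + p - N₀ - 1 := by ring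
  have m4 : ((p : ℤ) + 1) * (N₀ + 1 + j - j) = p * N₀ + p + N₀ + 1 := by ring
  rw [m3] at e2 ⊢
  rw [m4] at hT'
  unfold multStep
  rw [m1, m2, hT]
  generalize (p : ℤ) * x = A at *
  generalize (p : ℤ) * N₀ = B at *
  have i1 : x + N₀ < T ↔ x < T - N₀ := by omega
  have i2 : A + B + 2 * ((p : ℤ) - 1) ≤ T ↔ A < T - N₀ - (B + p - N₀ - 1) := by omega
  have i3 : x + (-N₀ - 2) ≤ 2 * j ↔ x + N₀ ≤ 2 * (N₀ + 1 + j) := by omega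
  have i4 : x + (-N₀ - 2) < threshold p a s' j ↔ x < T - N₀ - (B + p - N₀ - 1) := by omega
  have i5 : A - B - 2 * p + 2 * ((p : ℤ) - 1) ≤ threshold p a s' j ↔ A < T - N₀ := by omega
  rw [if_congr i1 rfl rfl, if_congr i2 rfl rfl, if_congr i3 rfl rfl, if_congr i4 rfl rfl,
    if_congr i5 rfl rfl]
  ring

/-- The sum of two increments that correspond under the reflection `i ↦ N₀ - i` and the reflection
of weights about `N₀ + 2` is the step function of `multStep_sub_shift`. -/
theorem multStep_add_reflect (ha1 : 1 ≤ a) (ha2 : a + 4 ≤ p) {N₀ i x T : ℤ}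
    (h : ((p : ℤ) - 1) ∣ s' - (N₀ - a - s)) (hi : IsDeg p a s i)
    (hx : ((p : ℤ) - 1) ∣ x - (a + 2 * s - N₀)) (hT : threshold p a s i = T) :
    multStep p a s (x + N₀) i + multStep p a s' (-x + N₀) (N₀ - i) =
      (if x < T - N₀ then 1 else 0) -
      (if x < T - N₀ - ((p : ℤ) - 1) * (N₀ + 1) then 1 else 0) +
      (if p * x < T - N₀ - ((p : ℤ) - 1) * (N₀ + 1) then 1 else 0) -
      (if p * x < T - N₀ then 1 else 0) := by
  have hq : (0 : ℤ) < (p : ℤ) - 1 := by linarith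
  have hd : ((p : ℤ) - 1) ∣ T - (a + 2 * s) := hT ▸ dvd_threshold_sub hi
  have hV : ((p : ℤ) - 1) ∣ x - (T - N₀) := by
    have := dvd_sub hx hd
    rwa [show x - (a + 2 * s - N₀) - (T - (a + 2 * s)) = x - (T - N₀) by ring] at this
  have hV' : ((p : ℤ) - 1) ∣ x - (T - N₀ - ((p : ℤ) - 1) * (N₀ + 1)) := by
    have := dvd_add hV (dvd_mul_right ((p : ℤ) - 1) (N₀ + 1))
    rwa [show x - (T - N₀) + (p - 1) * (N₀ + 1) =
      x - (T - N₀ - ((p : ℤ) - 1) * (N₀ + 1)) by ring] at this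
  have hU' : ((p : ℤ) - 1) ∣ p * x - (T - N₀ - ((p : ℤ) - 1) * (N₀ + 1)) := by
    have := dvd_add hV' (dvd_mul_right ((p : ℤ) - 1) x)
    rwa [show x - (T - N₀ - ((p : ℤ) - 1) * (N₀ + 1)) + (p - 1) * x =
      p * x - (T - N₀ - ((p : ℤ) - 1) * (N₀ + 1)) by ring] at this
  have hne : x + N₀ ≠ 2 * i := ne_two_mul ha1 ha2 (by
    rwa [show x + N₀ - a - 2 * s = x - (a + 2 * s - N₀) by ring]) hi
  have e1 := lt_iff_le_sub hq hV'
  have e2 := lt_iff_le_sub hq hU'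
  have m1 : (p : ℤ) * (x + N₀) = p * x + p * N₀ := by ring
  have m2 : (p : ℤ) * (-x + N₀) = -(p * x) + p * N₀ := by ring
  have m3 : ((p : ℤ) - 1) * (N₀ + 1) = p * N₀ + p - N₀ - 1 := by ring
  have m4 : ((p : ℤ) + 1) * N₀ = p * N₀ + N₀ := by ring
  rw [m3] at e1 e2 ⊢
  unfold multStep
  rw [m1, m2, threshold_reflect ha1 ha2 h hi, m4, hT]
  generalize (p : ℤ) * x = A at *
  generalize (p : ℤ) * N₀ = B at *
  have i1 : x + N₀ < T ↔ x < T - N₀ := by omega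
  have i2 : A + B + 2 * ((p : ℤ) - 1) ≤ T ↔ A < T - N₀ - (B + p - N₀ - 1) := by omega
  have i3 : -x + N₀ ≤ 2 * (N₀ - i) ↔ ¬ x + N₀ ≤ 2 * i := by omega
  have i4 : -x + N₀ < B + N₀ + 2 * ((p : ℤ) - 1) - T ↔ ¬ x < T - N₀ - (B + p - N₀ - 1) := by omega
  have i5 : -A + B + 2 * ((p : ℤ) - 1) ≤ B + N₀ + 2 * ((p : ℤ) - 1) - T ↔ ¬ A < T - N₀ := by omega
  rw [if_congr i1 rfl rfl, if_congr i2 rfl rfl, if_congr i3 rfl rfl, if_congr i4 rfl rfl,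
    if_congr i5 rfl rfl, ite_not, ite_not, ite_not]
  generalize (if x < T - N₀ then (1 : ℤ) else 0) = c1
  generalize (if A < T - N₀ - (B + p - N₀ - 1) then (1 : ℤ) else 0) = c2
  split_ifs <;> ring

variable [Fact p.Prime]

theorem ghostVal_theta_step (ha1 : 1 ≤ a) (ha2 : a + 4 ≤ p) {N l : ℕ}
    (h : ((p : ℤ) - 1) ∣ s' - (s - 1 - N)) :
    ghostVal p a s N (degCount p a s (N + 1) + l + 1) -
        ghostVal p a s N (degCount p a s (N + 1) + l) =
      N + 1 + (ghostVal p a s' (-N - 2) (l + 1) - ghostVal p a s' (-N - 2) l) := by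
  have hp : 1 < p := (Fact.out : p.Prime).one_lt
  have hσ := degSeq_shift (a := a) hp (l := l) h
  have hj := isDeg_degSeq (p := p) (a := a) (s := s') hp l
  have hi := isDeg_degSeq (p := p) (a := a) (s := s) hp (degCount p a s (N + 1) + l)
  obtain ⟨T, hT⟩ : ∃ T, threshold p a s (N + 1 + degSeq p a s' l) = T := ⟨_, rfl⟩
  have hd : ((p : ℤ) - 1) ∣ T - N - (a + 2 * s - N) := by
    rw [← hT, ← hσ, sub_sub_sub_cancel_right]
    exact dvd_threshold_sub hi
  have hcl : ((p : ℤ) - 1) ∣ (a + 2 * s' - (-N - 2)) - (a + 2 * s - N) := by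
    rw [show (a + 2 * s' - (-N - 2)) - (a + 2 * s - N) = (s' - (s - 1 - N)) * 2 by ring]
    exact h.mul_right _
  obtain ⟨R, h1, h2, h3⟩ := ((weightedSum_steps hd (N + 1)).and
    ((eventually_weightedSum_multStep (s := s) ha1 ha2 N (degCount p a s (N + 1) + l)).and
    (eventually_weightedSum_multStep (s := s') ha1 ha2 (-N - 2) l))).exists
  rw [weightedSum_congr_class hcl] at h3
  rw [← sub_eq_iff_eq_add, ← h2, ← h3, ← weightedSum_sub, hσ]
  have h4 := sum_range_ite_ne_zero (U := T - N) (q := (p : ℤ) - 1) (by omega) (N + 1)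
  push_cast at h4 h1
  have h5 := threshold_ge' (s := s) ha1 ha2 (N + 1 + degSeq p a s' l)
  have h6 : 0 ≤ ((p : ℤ) + 1) * degSeq p a s' l := by positivity
  have h7 : ((p : ℤ) - 1) * (N + 1) < T - N := by
    rw [← hT]
    linarith
  rw [if_neg fun h => absurd h.2.2 (not_le.2 h7), sub_zero] at h4
  exact (weightedSum_congr fun x hx => multStep_sub_shift ha1 ha2 h hj hx hT).trans (h1.trans h4)

/-- The theta maps, on the level of the points of the Newton polygons. -/
theorem ghostVal_theta (ha1 : 1 ≤ a) (ha2 : a + 4 ≤ p) {N : ℕ}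
    (h : ((p : ℤ) - 1) ∣ s' - (s - 1 - N)) (l : ℕ) :
    ghostVal p a s N (degCount p a s (N + 1) + l) =
      ghostVal p a s N (degCount p a s (N + 1)) + l * (N + 1) + ghostVal p a s' (-N - 2) l := by
  induction l with
  | zero => simp [ghostVal_zero]
  | succ l ih =>
    have := ghostVal_theta_step ha1 ha2 h (l := l)
    rw [← add_assoc]
    push_cast
    linarith

/-- The correction term is one if and only if the point `0`, which is left out of the sum of
valuations, is one of the points that the step function of `multStep_add_reflect` counts. -/
theorem ghostVal_reflect_step (ha1 : 1 ≤ a) (ha2 : a + 4 ≤ p) {N n : ℕ}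
    (h : ((p : ℤ) - 1) ∣ s' - (N - a - s)) (hn : n < degCount p a s (N + 1)) :
    ghostVal p a s N (n + 1) - ghostVal p a s N n +
      (ghostVal p a s' N (degCount p a s (N + 1) - n) -
        ghostVal p a s' N (degCount p a s (N + 1) - 1 - n)) =
      N + 1 - if ((p : ℤ) - 1) ∣ threshold p a s (degSeq p a s n) - N ∧
        0 < threshold p a s (degSeq p a s n) - N ∧
        threshold p a s (degSeq p a s n) - N ≤ ((p : ℤ) - 1) * (N + 1) then 1 else 0 := by
  have hp : 1 < p := (Fact.out : p.Prime).one_lt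
  have hi := isDeg_degSeq (p := p) (a := a) (s := s) hp n
  obtain ⟨T, hT⟩ : ∃ T, threshold p a s (degSeq p a s n) = T := ⟨_, rfl⟩
  have hd : ((p : ℤ) - 1) ∣ T - N - (a + 2 * s - N) := by
    rw [← hT, sub_sub_sub_cancel_right]
    exact dvd_threshold_sub hi
  have hcl : ((p : ℤ) - 1) ∣ -(a + 2 * s' - N) - (a + 2 * s - N) := by
    rw [show -(a + 2 * s' - N) - (a + 2 * s - N) = -((s' - (N - a - s)) * 2) by ring, dvd_neg]
    exact h.mul_right _
  obtain ⟨R, h1, h2, h3⟩ := ((weightedSum_steps hd (N + 1)).and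
    ((eventually_weightedSum_multStep (s := s) ha1 ha2 N n).and
    (eventually_weightedSum_multStep (s := s') ha1 ha2 N (degCount p a s (N + 1) - 1 - n)))).exists
  rw [weightedSum_neg, weightedSum_congr_class hcl] at h3
  rw [show degCount p a s (N + 1) - 1 - n + 1 = degCount p a s (N + 1) - n by omega] at h3
  rw [← h2, ← h3, ← weightedSum_add, degSeq_reflect hp h hn, hT]
  have h4 := sum_range_ite_ne_zero (U := T - N) (q := (p : ℤ) - 1) (by omega) (N + 1)
  push_cast at h4 h1
  rw [← h4, ← h1]
  exact weightedSum_congr fun x hx => multStep_add_reflect ha1 ha2 h hi hx hT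

/-- The inequality that remains of `ghostVal_reflect` when no congruence condition is imposed. -/
theorem ghostVal_reflect_le (ha1 : 1 ≤ a) (ha2 : a + 4 ≤ p) {N n : ℕ}
    (h : ((p : ℤ) - 1) ∣ s' - (N - a - s)) (hn : n ≤ degCount p a s (N + 1)) :
    ghostVal p a s N n + ghostVal p a s' N (degCount p a s (N + 1)) ≤
      ghostVal p a s' N (degCount p a s (N + 1) - n) + n * (N + 1) := by
  induction n with
  | zero => simp [ghostVal_zero]
  | succ n ih =>
    have h1 := ghostVal_reflect_step ha1 ha2 h (n := n) (by omega)
    have h2 := ih (by omega)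
    rw [show degCount p a s (N + 1) - 1 - n = degCount p a s (N + 1) - (n + 1) by omega] at h1
    push_cast
    split_ifs at h1 <;> linarith

/-- The Atkin-Lehner involutions, on the level of the points of the Newton polygons. -/
theorem ghostVal_reflect (ha1 : 1 ≤ a) (ha2 : a + 4 ≤ p) {N n : ℕ}
    (h : ((p : ℤ) - 1) ∣ s' - (N - a - s)) (hN : ¬ ((p : ℤ) - 1) ∣ N - a - 2 * s)
    (hn : n ≤ degCount p a s (N + 1)) :
    ghostVal p a s N n + ghostVal p a s' N (degCount p a s (N + 1)) =
      ghostVal p a s' N (degCount p a s (N + 1) - n) + n * (N + 1) := by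
  have hp : 1 < p := (Fact.out : p.Prime).one_lt
  induction n with
  | zero => simp [ghostVal_zero]
  | succ n ih =>
    have h1 := ghostVal_reflect_step ha1 ha2 h (n := n) (by omega)
    have h2 := ih (by omega)
    have h3 : ¬ ((p : ℤ) - 1) ∣ threshold p a s (degSeq p a s n) - N := fun h3 => hN <| by
      have := dvd_sub (dvd_threshold_sub (isDeg_degSeq (a := a) (s := s) hp n)) h3
      rwa [show ∀ T : ℤ, T - (a + 2 * s) - (T - N) = N - a - 2 * s from fun _ => by ring] at this
    rw [if_neg fun h4 => h3 h4.1] at h1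
    rw [show degCount p a s (N + 1) - 1 - n = degCount p a s (N + 1) - (n + 1) by omega] at h1
    push_cast
    linarith

/-- When `N + 2` lies in the congruence class of the weights of the ghost series, the increments at
reflected positions add up to `N + 1` outside of the range in which the ghost series vanishes at the
weight `N + 2`, and to `N` inside of it. -/
theorem ghostVal_reflect_step_self (ha1 : 1 ≤ a) (ha2 : a + 4 ≤ p) {N n : ℕ}
    (hN : ((p : ℤ) - 1) ∣ N - a - 2 * s) (hn : n < degCount p a s (N + 1)) :
    ghostVal p a s N (n + 1) - ghostVal p a s N n +
      (ghostVal p a s N (degCount p a s (N + 1) - n) -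
        ghostVal p a s N (degCount p a s (N + 1) - 1 - n)) =
      N + 1 - if urCount p a s N ≤ n ∧ n < degCount p a s (N + 1) - urCount p a s N
        then 1 else 0 := by
  have hp : 1 < p := (Fact.out : p.Prime).one_lt
  rw [ghostVal_reflect_step ha1 ha2 (dvd_self_reflect hN) hn]
  refine congr_arg _ (if_congr ?_ rfl rfl)
  have hd : ((p : ℤ) - 1) ∣ threshold p a s (degSeq p a s n) - N := by
    have := dvd_sub (dvd_threshold_sub (isDeg_degSeq (a := a) (s := s) hp n)) hN
    rwa [show ∀ T : ℤ, T - (a + 2 * s) - (N - a - 2 * s) = T - N from fun _ => by ring] at this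
  have h1 := lt_urCount_iff (s := s) ha1 ha2 (n := n) (N := N)
  have h2 := degCount_sub_le_iff ha1 ha2 hN (n := n)
  have h3 : ((p : ℤ) - 1) ∣ threshold p a s (degSeq p a s n) -
      (p * N + 2 * ((p : ℤ) - 1)) := by
    have := dvd_sub hd (dvd_mul_right ((p : ℤ) - 1) (N + 2))
    rwa [show ∀ T : ℤ, T - N - (p - 1) * (N + 2) = T - (p * N + 2 * ((p : ℤ) - 1)) from
      fun _ => by ring] at this
  have h4 := lt_iff_le_sub (by omega) h3
  have h5 : ((p : ℤ) - 1) * (N + 1) = p * N + p - N - 1 := by ring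
  rw [h5]
  omega

/-- The `p`-stabilizations, on the level of the points of the Newton polygon. -/
theorem ghostVal_reflect_self (ha1 : 1 ≤ a) (ha2 : a + 4 ≤ p) {N n : ℕ}
    (hN : ((p : ℤ) - 1) ∣ N - a - 2 * s) (hn : n ≤ urCount p a s N) :
    ghostVal p a s N n + ghostVal p a s N (degCount p a s (N + 1)) =
      ghostVal p a s N (degCount p a s (N + 1) - n) + n * (N + 1) := by
  have hu := two_mul_urCount_le ha1 ha2 hN
  induction n with
  | zero => simp [ghostVal_zero]
  | succ n ih =>
    have h1 := ghostVal_reflect_step_self ha1 ha2 hN (n := n) (by omega)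
    have h2 := ih (by omega)
    rw [if_neg (by omega)] at h1
    rw [show degCount p a s (N + 1) - 1 - n = degCount p a s (N + 1) - (n + 1) by omega] at h1
    push_cast
    linarith

/-- The ghost duality. -/
theorem ghostVal_duality (ha1 : 1 ≤ a) (ha2 : a + 4 ≤ p) {N c h : ℕ}
    (hN : ((p : ℤ) - 1) ∣ N - a - 2 * s) (hc : degCount p a s (N + 1) = 2 * c)
    (hh : h + urCount p a s N ≤ c) :
    ghostVal p a s N (c + h) - ghostVal p a s N (c - h) = h * N := by
  induction h with
  | zero => simp
  | succ h ih =>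
    have h1 := ghostVal_reflect_step_self ha1 ha2 hN (n := c + h) (by omega)
    have h2 := ih (by omega)
    rw [if_pos (by omega)] at h1
    rw [show degCount p a s (N + 1) - 1 - (c + h) = c - (h + 1) by omega,
      show degCount p a s (N + 1) - (c + h) = c - h by omega] at h1
    rw [← add_assoc]
    push_cast
    linarith

/-- Only weights up to the threshold can contribute positively to an increment: the second indicator
in `multStep` forces the third one to be one. -/
theorem multStep_le (ha1 : 1 ≤ a) (ha2 : a + 4 ≤ p) {N i : ℤ} (hi0 : 0 ≤ i) :
    multStep p a s N i ≤ if 0 ≤ N ∧ N < threshold p a s i then 1 else 0 := by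
  have h1 : threshold p a s i ≤ (p + 1) * i + 2 * ((p : ℤ) - 1) := by
    unfold threshold
    split_ifs <;> linarith
  have h2 := threshold_ge' (s := s) ha1 ha2 i
  have h3 : 0 ≤ ((p : ℤ) + 1) * i := by positivity
  unfold multStep
  rcases lt_or_ge N 0 with hN | hN
  · rw [if_pos (show N ≤ 2 * i by omega)]
    split_ifs <;> omega
  by_cases h4 : p * N + 2 * ((p : ℤ) - 1) ≤ threshold p a s i
  · have h5 : N ≤ 2 * i := by
      by_contra! h6
      have h7 : (p : ℤ) * (2 * i + 1) ≤ p * N := mul_le_mul_of_nonneg_left h6 (by positivity)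
      nlinarith
    rw [if_pos h5]
    split_ifs <;> omega
  · rw [if_neg h4]
    split_ifs <;> omega

theorem sum_one_add_padicValNat_le (hp : 5 ≤ p) (K : ℕ) :
    ∑ j ∈ Finset.range K, (1 + padicValNat p (j + 1)) ≤ 2 * K := by
  have h1 : ∑ j ∈ Finset.range K, (1 + padicValNat p (j + 1)) = K + padicValNat p K.factorial := by
    induction K with
    | zero => simp
    | succ K ih =>
      rw [Finset.sum_range_succ, ih, Nat.factorial_succ,
        padicValNat.mul (by omega) K.factorial_ne_zero]
      omega
  have h2 := sub_one_mul_padicValNat_factorial (p := p) K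
  have h3 : 1 * padicValNat p K.factorial ≤ (p - 1) * padicValNat p K.factorial :=
    Nat.mul_le_mul_right _ (by omega)
  omega

/-- Before the range in which the ghost series vanishes at the weight `N + 2`, the increments are at
most half of `N`. -/
theorem two_mul_ghostVal_step_le (ha1 : 1 ≤ a) (ha2 : a + 4 ≤ p) {N n : ℕ}
    (hN : ((p : ℤ) - 1) ∣ N - a - 2 * s) (hn : n < urCount p a s N) :
    2 * (ghostVal p a s N (n + 1) - ghostVal p a s N n) ≤ N := by
  have hp : 1 < p := (Fact.out : p.Prime).one_lt
  have hT := (lt_urCount_iff (s := s) ha1 ha2).1 hn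
  obtain ⟨K, hK⟩ : ∃ K, N / (p - 1) = K := ⟨_, rfl⟩
  have hK1 : (p - 1) * K ≤ N := hK ▸ Nat.mul_div_le N (p - 1)
  have hK2 : N < (p - 1) * (K + 1) := hK ▸ Nat.lt_mul_div_succ N (by omega)
  zify [hp.le] at hK1 hK2
  obtain ⟨R, hR, h1⟩ := ((Filter.eventually_ge_atTop N).and
    (eventually_weightedSum_multStep (s := s) ha1 ha2 N n)).exists
  have hz : ((p : ℤ) - 1) ∣ a + 2 * s - N := by
    rwa [show a + 2 * s - N = -(N - a - 2 * s) by ring, dvd_neg]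
  have hq0 : (p : ℤ) - 1 ≠ 0 := by omega
  have h2 : weightedSum p (a + 2 * s - N) R (fun x => multStep p a s (x + N) (degSeq p a s n)) ≤
      weightedSum p (a + 2 * s - N) R fun x =>
        ∑ j ∈ Finset.range K, if x = -(((p : ℤ) - 1) * (j + 1)) then 1 else 0 := by
    refine Finset.sum_le_sum fun x hx => mul_le_mul_of_nonneg_right ?_ (by positivity)
    refine (multStep_le ha1 ha2 (by positivity)).trans ?_
    have hnn : ∀ j ∈ Finset.range K,
        (0 : ℤ) ≤ if x = -(((p : ℤ) - 1) * (j + 1)) then 1 else 0 := fun j _ => by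
      split_ifs <;> norm_num
    split_ifs with h
    · obtain ⟨y, hy⟩ := (dvd_sub_left hz).1 (Finset.mem_filter.1 hx).2.1
      have hy1 : y < 0 := by
        by_contra! h3
        have : 0 ≤ ((p : ℤ) - 1) * y := mul_nonneg (by omega) h3
        omega
      have hy2 : -y < K + 1 := by
        refine lt_of_mul_lt_mul_left (a := (p : ℤ) - 1) ?_ (by omega)
        rw [mul_neg]
        omega
      refine le_trans ?_ (Finset.single_le_sum hnn (a := (-y - 1).toNat)
        (Finset.mem_range.2 (by omega)))
      rw [if_pos]
      rw [hy, Int.toNat_of_nonneg (by omega)]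
      ring
    · exact Finset.sum_nonneg hnn
  have h3 : (weightedSum p (a + 2 * s - N) R fun x =>
      ∑ j ∈ Finset.range K, if x = -(((p : ℤ) - 1) * (j + 1)) then 1 else 0) =
      ∑ j ∈ Finset.range K, (1 + padicValNat p (j + 1) : ℤ) := by
    unfold weightedSum
    simp_rw [Finset.sum_mul]
    rw [Finset.sum_comm]
    refine Finset.sum_congr rfl fun j hj => ?_
    have hj1 : ((p : ℤ) - 1) * (j + 1) ≤ (p - 1) * K :=
      mul_le_mul_of_nonneg_left (by have := Finset.mem_range.1 hj; omega) (by omega)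
    have hj2 : 0 ≤ ((p : ℤ) - 1) * (j + 1) := mul_nonneg (by omega) (by positivity)
    refine (weightedSum_ite_eq (p := p) (z := a + 2 * s - N) (R := R) ?_ ?_ ?_).trans ?_
    · exact dvd_sub (dvd_neg.2 (dvd_mul_right _ _)) hz
    · exact neg_ne_zero.2 (mul_ne_zero hq0 (by positivity))
    · omega
    · rw [show -(((p : ℤ) - 1) * (j + 1)) = -((p : ℤ) - 1) * (j + 1) by ring,
        padicValInt.mul (by omega) (by positivity), padicValInt.eq_zero_of_not_dvd]
      · simp only [zero_add]
        norm_cast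
      · intro h
        have h5 := (dvd_sub_right (dvd_neg.2 (dvd_refl (p : ℤ)))).1
          (show (p : ℤ) ∣ -(p : ℤ) - (-1) by rwa [show -(p : ℤ) - (-1) = -((p : ℤ) - 1) by ring])
        have := Int.le_of_dvd one_pos ((dvd_neg).1 h5)
        omega
  have h4 : (∑ j ∈ Finset.range K, (1 + padicValNat p (j + 1) : ℤ)) ≤ 2 * K := by
    exact_mod_cast sum_one_add_padicValNat_le (p := p) (by omega) K
  have h5 : 4 * (K : ℤ) ≤ (p - 1) * K := mul_le_mul_of_nonneg_right (by omega) (by positivity)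
  rw [← h1]
  linarith

end GhostVal

/-! ### Lower convex hulls of planar sets -/

section LowerHull

variable {P : Set (ℝ × ℝ)} {x : ℝ}

/-- The vertical line at `x` in the convex hull of `P`. -/
def hullFiber (P : Set (ℝ × ℝ)) (x : ℝ) : Set ℝ := {y | (x, y) ∈ convexHull ℝ P}

/-- The lower boundary of the convex hull of `P`. -/
def lowerHull (P : Set (ℝ × ℝ)) (x : ℝ) : ℝ := sInf (hullFiber P x)

theorem mem_lowerBounds_hullFiber {b m : ℝ} (h : ∀ z ∈ P, b + m * z.1 ≤ z.2) :
    b + m * x ∈ lowerBounds (hullFiber P x) := by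
  intro y hy
  have hc : Convex ℝ {z : ℝ × ℝ | b + m * z.1 ≤ z.2} := by
    intro z hz w hw r t hr ht hrt
    simp only [Set.mem_ofPred_eq, Prod.fst_add, Prod.snd_add, Prod.smul_fst, Prod.smul_snd,
      smul_eq_mul] at hz hw ⊢
    have h1 := mul_le_mul_of_nonneg_left hz hr
    have h2 := mul_le_mul_of_nonneg_left hw ht
    have h3 : b = r * b + t * b := by rw [← add_mul, hrt, one_mul]
    linarith
  exact convexHull_min h hc hy

theorem hullFiber_nonempty {z w : ℝ × ℝ} (hz : z ∈ P) (hw : w ∈ P) (hzx : z.1 ≤ x)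
    (hxw : x ≤ w.1) : (hullFiber P x).Nonempty := by
  have h := (convex_convexHull ℝ P).segment_subset (subset_convexHull ℝ P hz)
    (subset_convexHull ℝ P hw)
  have h1 : x ∈ segment ℝ z.1 w.1 := by
    rw [segment_eq_Icc (hzx.trans hxw)]
    exact ⟨hzx, hxw⟩
  obtain ⟨r, t, hr, ht, hrt, rfl⟩ := h1
  exact ⟨r * z.2 + t * w.2, h ⟨r, t, hr, ht, hrt, rfl⟩⟩

/-- Cutting a set along the vertical line through one of its points `c` does not change the lower
boundary of the convex hull on the chosen side (right if `e > 0`, left if `e < 0`), provided that a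
line through `c` supports the set from below. -/
theorem lowerHull_inter {c : ℝ × ℝ} (hc : c ∈ P) {m e : ℝ} (he : e ≠ 0)
    (h : ∀ z ∈ P, c.2 + m * (z.1 - c.1) ≤ z.2) (hx : 0 ≤ e * (x - c.1)) :
    lowerHull (P ∩ {z | 0 ≤ e * (z.1 - c.1)}) x = lowerHull P x := by
  set Q := P ∩ {z : ℝ × ℝ | 0 ≤ e * (z.1 - c.1)} with hQ
  have hsub : hullFiber Q x ⊆ hullFiber P x := fun y hy =>
    convexHull_mono Set.inter_subset_left hy
  have hcQ : c ∈ convexHull ℝ Q := subset_convexHull ℝ Q ⟨hc, by simp⟩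
  have hlow : ∀ z ∈ convexHull ℝ P, c.2 + m * (z.1 - c.1) ≤ z.2 := fun z hz => by
    have := mem_lowerBounds_hullFiber (P := P) (b := c.2 - m * c.1) (m := m) (x := z.1)
      (fun w hw => by linarith [h w hw]) (show z.2 ∈ hullFiber P z.1 from hz)
    linarith
  have hdom : ∀ y ∈ hullFiber P x, ∃ y' ∈ hullFiber Q x, y' ≤ y := by
    intro y hy
    have hPQ : P = (P ∩ {z : ℝ × ℝ | e * (z.1 - c.1) ≤ 0}) ∪ Q := by
      rw [hQ, ← Set.inter_union_distrib_left]
      exact (Set.inter_eq_left.2 fun z _ => le_total (e * (z.1 - c.1)) 0).symm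
    have hne : (P ∩ {z : ℝ × ℝ | e * (z.1 - c.1) ≤ 0}).Nonempty := ⟨c, hc, by simp⟩
    have hy' : (x, y) ∈ convexHull ℝ P := hy
    rw [hPQ, convexHull_union hne (show Q.Nonempty from ⟨c, hc, by simp⟩), mem_convexJoin] at hy'
    obtain ⟨u, hu, v, hv, t, t', ht, ht', htt, hxy⟩ := hy'
    have hu1 : e * (u.1 - c.1) ≤ 0 := by
      have hconv : Convex ℝ {z : ℝ × ℝ | e * (z.1 - c.1) ≤ 0} := by
        intro z hz w hw r t hr ht hrt
        simp only [Set.mem_ofPred_eq, Prod.fst_add, Prod.smul_fst, smul_eq_mul] at hz hw ⊢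
        have : e * (r * z.1 + t * w.1 - c.1) = r * (e * (z.1 - c.1)) + t * (e * (w.1 - c.1)) := by
          linear_combination e * c.1 * hrt
        rw [this]
        nlinarith
      exact convexHull_min Set.inter_subset_right hconv hu
    have hulow := hlow u (convexHull_mono Set.inter_subset_left hu)
    have hvlow := hlow v (convexHull_mono Set.inter_subset_left hv)
    have e1 : t * u.1 + t' * v.1 = x := congr_arg Prod.fst hxy
    have e2 : t * u.2 + t' * v.2 = y := congr_arg Prod.snd hxy
    -- the point at `x` of the segment from `c` to `v` lies below `(x, y)`
    have hX : e * (x - c.1) = t * (e * (u.1 - c.1)) + t' * (e * (v.1 - c.1)) := by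
      rw [← e1]
      linear_combination e * c.1 * htt
    have hXV : e * (x - c.1) ≤ t' * (e * (v.1 - c.1)) := by
      rw [hX]
      nlinarith
    obtain ⟨r, hr0, hrt, hr⟩ : ∃ r, 0 ≤ r ∧ r ≤ t' ∧ r * (v.1 - c.1) = x - c.1 := by
      rcases le_or_gt (e * (v.1 - c.1)) 0 with hV | hV
      · have h0 : e * (x - c.1) = 0 := le_antisymm (hXV.trans (by nlinarith)) hx
        exact ⟨0, le_rfl, ht', by rw [(mul_eq_zero.1 h0).resolve_left he, zero_mul]⟩
      · refine ⟨e * (x - c.1) / (e * (v.1 - c.1)), by positivity, ?_, ?_⟩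
        · rwa [div_le_iff₀ hV]
        · have h1 := (mul_ne_zero_iff.1 hV.ne').2
          field_simp
    refine ⟨(1 - r) * c.2 + r * v.2, ?_, ?_⟩
    · have := (convex_convexHull ℝ Q) hcQ hv (by linarith : 0 ≤ 1 - r) hr0 (by ring)
      change (x, (1 - r) * c.2 + r * v.2) ∈ convexHull ℝ Q
      convert this using 1
      refine Prod.ext ?_ rfl
      simp only [Prod.fst_add, Prod.smul_fst, smul_eq_mul]
      linarith
    · have h1 := mul_le_mul_of_nonneg_left hulow ht
      have h2 := mul_le_mul_of_nonneg_left hvlow (sub_nonneg.2 hrt)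
      have h3 : t * (m * (u.1 - c.1)) + (t' - r) * (m * (v.1 - c.1)) = 0 := by
        linear_combination m * e1 - m * hr - m * c.1 * htt
      have h4 : t * c.2 + t' * c.2 = c.2 := by rw [← add_mul, htt, one_mul]
      rw [← e2]
      linarith
  have hbdd : BddBelow (hullFiber P x) :=
    ⟨c.2 + m * (x - c.1), fun y hy => hlow (x, y) hy⟩
  unfold lowerHull
  rcases (hullFiber P x).eq_empty_or_nonempty with h0 | h0
  · rw [h0, Set.subset_eq_empty hsub h0]
  · obtain ⟨y, hy⟩ := h0
    obtain ⟨y', hy', -⟩ := hdom y hy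
    refine le_antisymm (le_csInf ⟨y, hy⟩ fun w hw => ?_) (csInf_le_csInf hbdd ⟨y', hy'⟩ hsub)
    obtain ⟨w', hw', hle⟩ := hdom w hw
    exact (csInf_le (hbdd.mono hsub) hw').trans hle

/-- The lower boundary of the convex hull of the image under a shear composed with an affine
transformation of the first coordinate. -/
theorem lowerHull_image {α β γ δ : ℝ} (hα : α ≠ 0) (hne : (hullFiber P x).Nonempty)
    (hb : BddBelow (hullFiber P x)) :
    lowerHull ((fun z : ℝ × ℝ => (α * z.1 + β, z.2 + (γ * z.1 + δ))) '' P) (α * x + β) =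
      lowerHull P x + (γ * x + δ) := by
  let f : ℝ × ℝ →ᵃ[ℝ] ℝ × ℝ :=
    { toFun := fun z => (α * z.1 + β, z.2 + (γ * z.1 + δ))
      linear := (α • LinearMap.fst ℝ ℝ ℝ).prod (LinearMap.snd ℝ ℝ ℝ + γ • LinearMap.fst ℝ ℝ ℝ)
      map_vadd' := fun z v => by
        ext <;> simp <;> ring }
  have h : hullFiber ((fun z : ℝ × ℝ => (α * z.1 + β, z.2 + (γ * z.1 + δ))) '' P) (α * x + β) =
      OrderIso.addRight (γ * x + δ) '' hullFiber P x := by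
    ext y
    have h1 : y ∈ hullFiber (f '' P) (α * x + β) ↔ (α * x + β, y) ∈ f '' convexHull ℝ P := by
      rw [AffineMap.image_convexHull]
      rfl
    refine h1.trans ⟨?_, ?_⟩
    · rintro ⟨z, hz, he⟩
      have e1 : α * z.1 + β = α * x + β := congr_arg Prod.fst he
      have e2 : z.2 + (γ * z.1 + δ) = y := congr_arg Prod.snd he
      have e3 : z.1 = x := mul_left_cancel₀ hα (by linarith)
      refine ⟨z.2, ?_, ?_⟩
      · rw [← e3]
        exact hz
      · rw [← e2, e3]
        rfl
    · rintro ⟨y, hy, rfl⟩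
      exact ⟨(x, y), hy, rfl⟩
  rw [lowerHull, h, ← OrderIso.map_csInf' _ hne hb]
  rfl

/-- The lower boundary of the convex hull of points in the upper half-plane increases to the right
of the origin, if the origin is one of the points. -/
theorem lowerHull_mono (h0 : (0, 0) ∈ P) (h : ∀ z ∈ P, 0 ≤ z.2) {x' : ℝ} (hx : 0 ≤ x)
    (hxx : x ≤ x') (hne : (hullFiber P x').Nonempty) : lowerHull P x ≤ lowerHull P x' := by
  have hnn : ∀ w, ∀ y ∈ hullFiber P w, 0 ≤ y := fun w y hy => by
    simpa using mem_lowerBounds_hullFiber (P := P) (b := 0) (m := 0) (by simpa using h) hy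
  refine le_csInf hne fun y hy => ?_
  have hy0 := hnn _ _ hy
  rcases hxx.eq_or_lt with rfl | hlt
  · exact csInf_le ⟨0, hnn _⟩ hy
  have hx' : 0 < x' := hx.trans_lt hlt
  have hr : x / x' ≤ 1 := (div_le_one hx').2 hxx
  have hr0 : 0 ≤ x / x' := by positivity
  refine (csInf_le ⟨0, hnn x⟩ (?_ : x / x' * y ∈ hullFiber P x)).trans
    (mul_le_of_le_one_left hy0 hr)
  have := (convex_convexHull ℝ P) (subset_convexHull ℝ P h0) hy (by linarith : 0 ≤ 1 - x / x') hr0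
    (by ring)
  change (x, x / x' * y) ∈ convexHull ℝ P
  convert this using 1
  refine Prod.ext ?_ ?_ <;> simp
  field_simp

/-- The lower boundary is linear between two points that lie on a line supporting the set. -/
theorem lowerHull_eq_of_mem_line {z w : ℝ × ℝ} {b m : ℝ} (hz : z ∈ P) (hw : w ∈ P)
    (hzl : z.2 = b + m * z.1) (hwl : w.2 = b + m * w.1) (h : ∀ z ∈ P, b + m * z.1 ≤ z.2)
    (hzx : z.1 ≤ x) (hxw : x ≤ w.1) : lowerHull P x = b + m * x := by
  have h1 := (convex_convexHull ℝ P).segment_subset (subset_convexHull ℝ P hz)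
    (subset_convexHull ℝ P hw)
  have h2 : x ∈ segment ℝ z.1 w.1 := by
    rw [segment_eq_Icc (hzx.trans hxw)]
    exact ⟨hzx, hxw⟩
  obtain ⟨r, t, hr, ht, hrt, rfl⟩ := h2
  have h3 : b + m * (r • z.1 + t • w.1) ∈ hullFiber P (r • z.1 + t • w.1) := by
    refine h1 ⟨r, t, hr, ht, hrt, Prod.ext rfl ?_⟩
    simp only [Prod.snd_add, Prod.smul_snd, smul_eq_mul, hzl, hwl]
    linear_combination b * hrt
  exact IsLeast.csInf_eq ⟨h3, mem_lowerBounds_hullFiber h⟩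

end LowerHull

/-! ### Lower convex hulls of sequences -/

section Sequences

/-- The points `(n, y n)` for `n ∈ S`. -/
def seqPoints (S : Set ℕ) (y : ℕ → ℝ) : Set (ℝ × ℝ) := (fun n : ℕ => ((n : ℝ), y n)) '' S

variable {S : Set ℕ} {y y' : ℕ → ℝ} {x : ℝ}

theorem mem_seqPoints {n : ℕ} (hn : n ∈ S) : ((n : ℝ), y n) ∈ seqPoints S y := ⟨n, hn, rfl⟩

theorem lowerHull_Ici {c : ℕ} (hc : c ∈ S) {m : ℝ}
    (h : ∀ n ∈ S, y c + m * ((n : ℝ) - c) ≤ y n) (hx : c ≤ x) :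
    lowerHull (seqPoints (S ∩ Set.Ici c) y) x = lowerHull (seqPoints S y) x := by
  rw [← lowerHull_inter (mem_seqPoints hc) one_ne_zero (m := m)
    (by rintro _ ⟨n, hn, rfl⟩; exact h n hn)
    (by simpa using hx)]
  congr 1
  ext z
  constructor
  · rintro ⟨n, ⟨hn, hcn⟩, rfl⟩
    exact ⟨mem_seqPoints hn, by simpa using hcn⟩
  · rintro ⟨⟨n, hn, rfl⟩, hcn⟩
    exact mem_seqPoints ⟨hn, by simpa using hcn⟩

theorem lowerHull_Iic {c : ℕ} (hc : c ∈ S) {m : ℝ}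
    (h : ∀ n ∈ S, y c + m * ((n : ℝ) - c) ≤ y n) (hx : x ≤ c) :
    lowerHull (seqPoints (S ∩ Set.Iic c) y) x = lowerHull (seqPoints S y) x := by
  rw [← lowerHull_inter (mem_seqPoints hc) (neg_ne_zero.2 one_ne_zero) (m := m)
    (by rintro _ ⟨n, hn, rfl⟩; exact h n hn) (by simpa using hx)]
  congr 1
  ext z
  constructor
  · rintro ⟨n, ⟨hn, hcn⟩, rfl⟩
    exact ⟨mem_seqPoints hn, by simpa using hcn⟩
  · rintro ⟨⟨n, hn, rfl⟩, hcn⟩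
    exact mem_seqPoints ⟨hn, by simpa using hcn⟩

theorem bddBelow_hullFiber (hy : ∀ n, 0 ≤ y n) : BddBelow (hullFiber (seqPoints S y) x) := by
  refine ⟨0 + 0 * x, mem_lowerBounds_hullFiber ?_⟩
  rintro _ ⟨n, -, rfl⟩
  simpa using hy n

theorem lowerHull_seqPoints_mono (h0 : 0 ∈ S) (hy0 : y 0 = 0) (hy : ∀ n, 0 ≤ y n) {x' : ℝ}
    (hx : 0 ≤ x) (hxx : x ≤ x') {n : ℕ} (hn : n ∈ S) (hxn : x' ≤ n) :
    lowerHull (seqPoints S y) x ≤ lowerHull (seqPoints S y) x' := by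
  refine lowerHull_mono ?_ ?_ hx hxx
    (hullFiber_nonempty (mem_seqPoints h0) (mem_seqPoints hn) (by simpa using hx.trans hxx) hxn)
  · simpa [hy0] using mem_seqPoints (y := y) h0
  · rintro _ ⟨n, -, rfl⟩
    exact hy n

/-- If the sequence is, from a vertex `c` of its lower convex hull on, a shear of another one, then
so is its lower convex hull. -/
theorem lowerHull_add {c : ℕ} (hc : c ∈ S) {m : ℝ} (h : ∀ n ∈ S, y c + m * ((n : ℝ) - c) ≤ y n)
    (hS : ∀ l, c + l ∈ S) (hy' : ∀ n, 0 ≤ y' n) (hyy : ∀ l, y (c + l) = y c + l * m + y' l)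
    (hx : 0 ≤ x) :
    lowerHull (seqPoints S y) (c + x) = lowerHull (seqPoints Set.univ y') x + (m * x + y c) := by
  rw [← lowerHull_Ici hc h (by linarith), add_comm (c : ℝ) x]
  have hne : (hullFiber (seqPoints Set.univ y') x).Nonempty := by
    obtain ⟨n, hn⟩ := exists_nat_ge x
    exact hullFiber_nonempty (mem_seqPoints (Set.mem_univ 0)) (mem_seqPoints (Set.mem_univ n))
      (by simpa using hx) hn
  rw [← lowerHull_image one_ne_zero hne (bddBelow_hullFiber hy') (β := c), one_mul]
  congr 1
  ext z
  constructor
  · rintro ⟨n, ⟨hn, hcn⟩, rfl⟩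
    obtain ⟨l, rfl⟩ := Nat.exists_eq_add_of_le hcn
    refine ⟨_, mem_seqPoints (Set.mem_univ l), Prod.ext ?_ ?_⟩
    · push_cast
      ring
    · simp only [hyy]
      ring
  · rintro ⟨_, ⟨l, -, rfl⟩, rfl⟩
    refine ⟨c + l, ⟨hS l, by simp⟩, Prod.ext ?_ ?_⟩
    · push_cast
      ring
    · simp only [hyy]
      ring

/-- If a sequence on `[D - j, D - i]` is a shear of the reflection of another one on `[i, j]`, then
so is its lower convex hull. -/
theorem lowerHull_reflect {D i j : ℕ} (hij : i ≤ j) (hj : j ≤ D) {m K : ℝ} (hy : ∀ n, 0 ≤ y n)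
    (hyy : ∀ n, n ≤ j → y' (D - n) = y n - n * m + K) (hx : i ≤ x) (hxj : x ≤ j) :
    lowerHull (seqPoints (Set.Icc (D - j) (D - i)) y') (D - x) =
      lowerHull (seqPoints (Set.Icc i j) y) x + (-m * x + K) := by
  have hne : (hullFiber (seqPoints (Set.Icc i j) y) x).Nonempty :=
    hullFiber_nonempty (mem_seqPoints ⟨le_rfl, hij⟩) (mem_seqPoints ⟨hij, le_rfl⟩) hx hxj
  rw [← lowerHull_image (neg_ne_zero.2 one_ne_zero) hne (bddBelow_hullFiber hy) (β := D),
    show (D : ℝ) - x = -1 * x + D by ring]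
  congr 1
  ext z
  constructor
  · rintro ⟨n, ⟨hn1, hn2⟩, rfl⟩
    refine ⟨_, mem_seqPoints (n := D - n) ⟨by omega, by omega⟩, Prod.ext ?_ ?_⟩
    · push_cast [show n ≤ D by omega]
      ring
    · have := hyy (D - n) (by omega)
      rw [show D - (D - n) = n by omega] at this
      simp only [this]
      ring
  · rintro ⟨_, ⟨n, ⟨hn1, hn2⟩, rfl⟩, rfl⟩
    refine ⟨D - n, ⟨by omega, by omega⟩, Prod.ext ?_ ?_⟩
    · push_cast [show n ≤ D by omega]
      ring
    · simp only [hyy n hn2]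
      ring

end Sequences

/-! ### Newton polygons of the ghost series -/

section GhostSeries

variable {p : ℕ} [Fact p.Prime] {O : Type*} [CommRing O] [IsDomain O] [IsDiscreteValuationRing O]
  [Algebra ℤ_[p] O] [Module.Finite ℤ_[p] O] [FaithfulSMul ℤ_[p] O]
  {H : Type*} [AddCommGroup H] [Module O H]
  [Module (IwasawaAlgebra p O)ᵐᵒᵖ H] [IsScalarTower O (IwasawaAlgebra p O)ᵐᵒᵖ H]
  [Module.Finite (IwasawaAlgebra p O)ᵐᵒᵖ H] [Module.Projective (IwasawaAlgebra p O)ᵐᵒᵖ H]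
  {a : ℕ}

theorem modEq_kEps_iff (s k : ℤ) :
    k ≡ kEps p a s [ZMOD ((p : ℤ) - 1)] ↔ ((p : ℤ) - 1) ∣ k - 2 - a - 2 * s := by
  have h : kEps p a s ≡ 2 + (a + 2 * s) [ZMOD ((p : ℤ) - 1)] :=
    (Int.mod_modEq _ _).add_left 2
  rw [show k - 2 - a - 2 * s = k - (2 + (a + 2 * s)) by ring]
  exact ⟨fun h1 => (h1.trans h).symm.dvd, fun h1 => (Int.modEq_of_dvd h1).symm.trans h.symm⟩

theorem dvd_res_sub (m : ℤ) : ((p : ℤ) - 1) ∣ res p m - m :=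
  (Int.mod_modEq m _).symm.dvd

theorem IsPrimitiveOfType.dIw_eq (hH : IsPrimitiveOfType p O H a) (ha1 : 1 ≤ a) (ha2 : a + 4 ≤ p)
    (N : ℕ) (s v : ℤ) (h : ((p : ℤ) - 1) ∣ N - s + v - a) :
    dIw O H (N + 2) (prodChar (omega p O (-s)) (omega p O v)) = degCount p a s (N + 1) := by
  classical
  rw [degCount_succ_eq_card, (hH.finrank_forms ha1 (by omega) (N + 2) s).1 v (by simpa using h),
    Nat.add_sub_cancel]

theorem IsPrimitiveOfType.dUr_eq (hH : IsPrimitiveOfType p O H a) (ha1 : 1 ≤ a) (ha2 : a + 4 ≤ p)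
    (N : ℕ) (s : ℤ) (h : ((p : ℤ) - 1) ∣ N - a - 2 * s) :
    dUr O H (N + 2) (omega p O (-s)) = urCount p a s N := by
  rw [urCount, (hH.finrank_forms ha1 (by omega) (N + 2) s).2 (by simpa using h) (N + 1) (by omega),
    Nat.add_sub_cancel]

theorem IsPrimitiveOfType.ghostMult_eq (hH : IsPrimitiveOfType p O H a) (ha1 : 1 ≤ a)
    (ha2 : a + 4 ≤ p) (N : ℕ) (s : ℤ) (h : ((p : ℤ) - 1) ∣ N - a - 2 * s) (n : ℕ) :
    ghostMult p O H s n (N + 2) = latticeMult p a s n N := by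
  rw [ghostMult, hH.dUr_eq ha1 ha2 N s h, hH.dIw_eq ha1 ha2 N s (-s)
    (by rwa [show (N : ℤ) - s + -s - a = N - a - 2 * s by ring]), latticeMult]

theorem latticeMult_eq_zero_iff {s : ℤ} {n N : ℕ} : latticeMult p a s n N = 0 ↔
    n ≤ urCount p a s N ∨ degCount p a s (N + 1) - urCount p a s N ≤ n := by
  rw [latticeMult]
  split_ifs <;> omega

open Classical in
/-- The product that defines a coefficient of the ghost series is finite: a weight `N + 2` does not
contribute once `N` is at least the threshold of the `n`-th degree. -/
theorem IsPrimitiveOfType.exists_ghostCoeff_eq (hH : IsPrimitiveOfType p O H a) (ha1 : 1 ≤ a)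
    (ha2 : a + 4 ≤ p) (s : ℤ) (n : ℕ) :
    ∃ t : Finset ℕ, (∀ N ∈ t, ((p : ℤ) - 1) ∣ N - a - 2 * s) ∧
      (∀ N : ℕ, ((p : ℤ) - 1) ∣ N - a - 2 * s → N ∉ t → latticeMult p a s n N = 0) ∧
      ghostCoeff p O H a s n =
        ∏ N ∈ t, (X - C (weightPoint p (N + 2))) ^ latticeMult p a s n N := by
  obtain ⟨K, hK⟩ : ∃ K : ℕ, threshold p a s (degSeq p a s n) ≤ K := ⟨_, Int.self_le_toNat _⟩
  set t := (Finset.range K).filter fun N : ℕ => ((p : ℤ) - 1) ∣ N - a - 2 * s with ht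
  have hzero : ∀ N : ℕ, ((p : ℤ) - 1) ∣ N - a - 2 * s → N ∉ t → latticeMult p a s n N = 0 :=
    fun N hN hNt => by
    have h1 : K ≤ N := by
      by_contra! h
      exact hNt (Finset.mem_filter.2 ⟨Finset.mem_range.2 h, hN⟩)
    have h2 := intMult_eq_zero (p := p) (a := a) (s := s) (n := n) (N := N) (by omega) (by omega)
      (hK.trans (by exact_mod_cast h1))
    rw [intMult, if_pos (by positivity), Int.toNat_natCast] at h2
    exact_mod_cast h2
  refine ⟨t, fun N hN => (Finset.mem_filter.1 hN).2, hzero, ?_⟩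
  have h1 : ghostCoeff p O H a s n =
      ∏ᶠ k ∈ {k : ℕ | 2 ≤ k ∧ (k : ℤ) ≡ kEps p a s [ZMOD ((p : ℤ) - 1)]},
        (X - C (weightPoint p k)) ^ ghostMult p O H s n k := rfl
  rw [h1, finprod_mem_eq_prod_of_inter_mulSupport_eq (t := t.map (addRightEmbedding 2)),
    Finset.prod_map]
  · refine Finset.prod_congr rfl fun N hN => ?_
    rw [addRightEmbedding_apply, hH.ghostMult_eq ha1 ha2 N s (Finset.mem_filter.1 hN).2]
    push_cast
    rfl
  · ext k
    refine and_congr_left fun hk => ?_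
    simp only [Set.mem_ofPred_eq, Finset.mem_coe, Finset.mem_map, addRightEmbedding_apply,
      modEq_kEps_iff]
    constructor
    · rintro ⟨h2, h3⟩
      obtain ⟨N, rfl⟩ := Nat.exists_eq_add_of_le' h2
      push_cast at h3
      rw [add_sub_cancel_right] at h3
      refine ⟨N, ?_, rfl⟩
      by_contra h4
      refine hk ?_
      simp only [hH.ghostMult_eq ha1 ha2 N s h3, hzero N h3 h4, pow_zero]
    · rintro ⟨N, hN, rfl⟩
      refine ⟨by omega, ?_⟩
      push_cast
      rw [add_sub_cancel_right]
      exact (Finset.mem_filter.1 hN).2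

open Classical in
variable (p a) in
/-- The order of vanishing of the `n`-th coefficient of the ghost series at the weight `N₀ + 2`. -/
def vanishingOrder (s : ℤ) (n : ℕ) (N₀ : ℤ) : ℕ :=
  if 0 ≤ N₀ ∧ ((p : ℤ) - 1) ∣ N₀ - a - 2 * s then latticeMult p a s n N₀.toNat else 0

theorem valuation_prod_pow {ι : Type*} (t : Finset ι) (f : ι → ℚ_[p]) (m : ι → ℕ)
    (hf : ∀ i ∈ t, f i ≠ 0) :
    (∏ i ∈ t, f i ^ m i).valuation = ∑ i ∈ t, (m i : ℤ) * (f i).valuation := by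
  classical
  induction t using Finset.induction_on with
  | empty => simp
  | insert i t hi ih =>
    have h1 : ∀ j ∈ t, f j ≠ 0 := fun j hj => hf j (Finset.mem_insert_of_mem hj)
    rw [Finset.prod_insert hi, Finset.sum_insert hi, Padic.valuation_mul
      (pow_ne_zero _ (hf i (Finset.mem_insert_self i t)))
      (Finset.prod_ne_zero_iff.2 fun j hj => pow_ne_zero _ (h1 j hj)), ih h1, Padic.valuation_pow]

theorem ghostVal_eq_sum {s N₀ : ℤ} {n : ℕ} {t : Finset ℕ}
    (ht : ∀ N ∈ t, ((p : ℤ) - 1) ∣ N - a - 2 * s)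
    (ht' : ∀ N : ℕ, ((p : ℤ) - 1) ∣ N - a - 2 * s → N ∉ t → latticeMult p a s n N = 0) :
    ghostVal p a s N₀ n = ∑ N ∈ t.filter fun N : ℕ => (N : ℤ) ≠ N₀,
      (latticeMult p a s n N : ℤ) * (1 + padicValInt p (N - N₀)) := by
  have hd : ∀ N : ℤ, ((p : ℤ) - 1) ∣ N - N₀ - (a + 2 * s - N₀) ↔ ((p : ℤ) - 1) ∣ N - a - 2 * s :=
    fun N => by rw [show N - N₀ - (a + 2 * s - N₀) = N - a - 2 * s by ring]
  rw [ghostVal, finsum_eq_sum_of_support_subset (s := t.image fun N : ℕ => (N : ℤ) - N₀),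
    Finset.sum_image (by intro N _ M _ h; simpa using h), Finset.sum_filter]
  · refine Finset.sum_congr rfl fun N hN => ?_
    have h1 : (((p : ℤ) - 1) ∣ (N : ℤ) - N₀ - (a + 2 * s - N₀) ∧ (N : ℤ) - N₀ ≠ 0) ↔
        (N : ℤ) ≠ N₀ := by
      rw [hd, sub_ne_zero]
      exact and_iff_right (ht N hN)
    rw [if_congr h1 rfl rfl, sub_add_cancel, intMult,
      if_pos (show (0 : ℤ) ≤ N by positivity), Int.toNat_natCast]
  · intro x hx
    rw [Function.mem_support] at hx
    obtain ⟨h1, -⟩ := of_not_not fun h => hx (if_neg h)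
    have h2 : intMult p a s n (x + N₀) ≠ 0 := fun h => hx (by simp [h])
    have h3 : 0 ≤ x + N₀ := by
      by_contra h
      exact h2 (if_neg h)
    obtain ⟨N, hN⟩ := Int.eq_ofNat_of_zero_le h3
    obtain rfl : x = N - N₀ := by linarith
    rw [hd] at h1
    rw [Finset.coe_image]
    refine ⟨N, Finset.mem_coe.2 ?_, rfl⟩
    by_contra h4
    refine h2 ?_
    rw [intMult, if_pos h3, hN, Int.toNat_natCast, ht' N h1 h4]
    rfl

/-- Splitting off the zero at the weight `N₀ + 2` from a coefficient of the ghost series leaves a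
polynomial `f` whose value there has valuation `ghostVal`. -/
theorem IsPrimitiveOfType.exists_ghostCoeff_eq_mul (hH : IsPrimitiveOfType p O H a) (hp : 5 ≤ p)
    (ha1 : 1 ≤ a) (ha2 : a + 4 ≤ p) (s N₀ : ℤ) (n : ℕ) :
    ∃ f : ℚ_[p][X], f.eval (weightPoint p (N₀ + 2)) ≠ 0 ∧
      (f.eval (weightPoint p (N₀ + 2))).valuation = ghostVal p a s N₀ n ∧
      ghostCoeff p O H a s n =
        (X - C (weightPoint p (N₀ + 2))) ^ vanishingOrder p a s n N₀ * f := by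
  obtain ⟨t, ht, ht', e⟩ := hH.exists_ghostCoeff_eq ha1 ha2 s n
  have hne : ∀ N ∈ t.filter fun N : ℕ => (N : ℤ) ≠ N₀,
      weightPoint p (N₀ + 2) - weightPoint p (N + 2) ≠ 0 := fun N hN =>
    weightPoint_sub_ne_zero (by omega) fun h => (Finset.mem_filter.1 hN).2 (by linarith)
  refine ⟨∏ N ∈ t.filter fun N : ℕ => (N : ℤ) ≠ N₀,
    (X - C (weightPoint p (N + 2))) ^ latticeMult p a s n N, ?_, ?_, ?_⟩
  · simp only [eval_prod, eval_pow, eval_sub, eval_X, eval_C]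
    exact Finset.prod_ne_zero_iff.2 fun N hN => pow_ne_zero _ (hne N hN)
  · simp only [eval_prod, eval_pow, eval_sub, eval_X, eval_C]
    rw [valuation_prod_pow _ _ _ hne, ghostVal_eq_sum ht ht']
    refine Finset.sum_congr rfl fun N hN => ?_
    rw [valuation_weightPoint_sub (by omega) fun h => (Finset.mem_filter.1 hN).2 (by linarith),
      show N₀ + 2 - ((N : ℤ) + 2) = -(N - N₀) by ring, padicValInt, Int.natAbs_neg]
    rfl
  · rw [e, ← Finset.prod_filter_mul_prod_filter_not t fun N : ℕ => (N : ℤ) ≠ N₀, mul_comm]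
    congr 1
    simp only [not_not]
    rw [vanishingOrder]
    split_ifs with h
    · obtain ⟨h0, h1⟩ := h
      obtain ⟨N, rfl⟩ := Int.eq_ofNat_of_zero_le h0
      rw [Int.toNat_natCast]
      simp only [Nat.cast_inj]
      rw [Finset.filter_eq']
      split_ifs with h2
      · rw [Finset.prod_singleton]
      · rw [ht' N h1 h2, pow_zero, Finset.prod_empty]
    · refine Finset.prod_eq_one fun N hN => absurd ?_ h
      obtain ⟨h1, rfl⟩ := Finset.mem_filter.1 hN
      exact ⟨by positivity, ht N h1⟩

theorem IsPrimitiveOfType.newtonPoints_ghostSeries (hH : IsPrimitiveOfType p O H a) (hp : 5 ≤ p)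
    (ha1 : 1 ≤ a) (ha2 : a + 4 ≤ p) (s N₀ : ℤ) :
    newtonPoints (ghostSeries p O H a s (weightPoint p (N₀ + 2))) =
      seqPoints {n | vanishingOrder p a s n N₀ = 0} fun n => (ghostVal p a s N₀ n : ℝ) := by
  have key : ∀ n, (PowerSeries.coeff n (ghostSeries p O H a s (weightPoint p (N₀ + 2))) ≠ 0 ↔
      vanishingOrder p a s n N₀ = 0) ∧ (vanishingOrder p a s n N₀ = 0 →
      (PowerSeries.coeff n (ghostSeries p O H a s (weightPoint p (N₀ + 2)))).valuation =
        ghostVal p a s N₀ n) := fun n => by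
    obtain ⟨f, hf, hfv, e⟩ := hH.exists_ghostCoeff_eq_mul hp ha1 ha2 s N₀ n
    rw [ghostSeries, PowerSeries.coeff_mk, e, eval_mul, eval_pow, eval_sub, eval_X, eval_C,
      sub_self]
    refine ⟨⟨fun h => ?_, fun h => ?_⟩, fun h => ?_⟩
    · by_contra h0
      exact h (by rw [zero_pow h0, zero_mul])
    · rwa [h, pow_zero, one_mul]
    · rw [h, pow_zero, one_mul, hfv]
  ext z
  constructor
  · rintro ⟨n, hn, rfl⟩
    have h := (key n).1.1 hn
    refine ⟨n, h, ?_⟩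
    rw [(key n).2 h]
  · rintro ⟨n, hn, rfl⟩
    refine ⟨n, (key n).1.2 hn, ?_⟩
    rw [(key n).2 hn]

variable (p a) in
/-- The Newton polygon of the ghost series at the weight `N₀ + 2`, in terms of numbers of degrees.
-/
def ghostHull (s N₀ : ℤ) (x : ℝ) : ℝ :=
  lowerHull (seqPoints {n | vanishingOrder p a s n N₀ = 0} fun n => (ghostVal p a s N₀ n : ℝ)) x

theorem IsPrimitiveOfType.ghostSlope_eq (hH : IsPrimitiveOfType p O H a) (hp : 5 ≤ p)
    (ha1 : 1 ≤ a) (ha2 : a + 4 ≤ p) (s : ℤ) {N₀ k : ℤ} (hk : k = N₀ + 2) (n : ℕ) :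
    ghostSlope p O H a s k n = ghostHull p a s N₀ n - ghostHull p a s N₀ (n - 1) := by
  unfold ghostHull
  rw [hk, ← hH.newtonPoints_ghostSeries hp ha1 ha2 s N₀]
  rfl

theorem IsPrimitiveOfType.ghostCoeffHat_eval (hH : IsPrimitiveOfType p O H a) (hp : 5 ≤ p)
    (ha1 : 1 ≤ a) (ha2 : a + 4 ≤ p) {s : ℤ} {N : ℕ} (hN : ((p : ℤ) - 1) ∣ N - a - 2 * s) (n : ℕ) :
    (ghostCoeffHat p O H a s n (N + 2)).eval (weightPoint p (N + 2 : ℕ)) ≠ 0 ∧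
      ((ghostCoeffHat p O H a s n (N + 2)).eval (weightPoint p (N + 2 : ℕ))).valuation =
        ghostVal p a s N n := by
  obtain ⟨f, hf, hfv, e⟩ := hH.exists_ghostCoeff_eq_mul hp ha1 ha2 s N n
  have h1 : vanishingOrder p a s n N = ghostMult p O H s n (N + 2) := by
    rw [hH.ghostMult_eq ha1 ha2 N s hN, vanishingOrder, if_pos ⟨by positivity, hN⟩,
      Int.toNat_natCast]
  have h2 : ghostCoeffHat p O H a s n (N + 2) = f := by
    rw [ghostCoeffHat, e, h1]
    push_cast
    exact mul_divByMonic_cancel_left _ ((monic_X_sub_C _).pow _)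
  rw [h2]
  push_cast
  exact ⟨hf, hfv⟩

end GhostSeries

/-! ### Supporting lines -/

section Supporting

variable {p : ℕ} [Fact p.Prime] {a s : ℤ}

/-- A line of slope `N + 1` supports the points from below at the number of degrees up to `N`. -/
theorem le_ghostVal_degCount (ha1 : 1 ≤ a) (ha2 : a + 4 ≤ p) (N n : ℕ) :
    ghostVal p a s N (degCount p a s (N + 1)) + (N + 1) * (n - degCount p a s (N + 1)) ≤
      ghostVal p a s N n := by
  rcases le_total n (degCount p a s (N + 1)) with h | h
  · have hs : ((p : ℤ) - 1) ∣ (N - a - s) - (N - a - s) := by simp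
    have hs' : ((p : ℤ) - 1) ∣ s - (N - a - (N - a - s)) := by simp
    have hD := degCount_reflect hs
    have h1 := ghostVal_reflect_le ha1 ha2 hs' (n := degCount p a s (N + 1) - n)
      (by rw [hD]; omega)
    rw [hD, Nat.sub_sub_self h, Nat.cast_sub h] at h1
    have h2 := ghostVal_nonneg (p := p) (a := a) (s := N - a - s) N (degCount p a s (N + 1) - n)
    linarith
  · obtain ⟨l, rfl⟩ := Nat.exists_eq_add_of_le h
    have h1 := ghostVal_theta (s := s) (s' := s - 1 - N) ha1 ha2 (N := N) (by simp) l
    have h2 := ghostVal_nonneg (p := p) (a := a) (s := s - 1 - N) (-N - 2) l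
    push_cast
    linarith

/-- The point at `urCount N` lies below the lines of slope `N / 2` through the points before it. -/
theorem two_mul_ghostVal_urCount_le (ha1 : 1 ≤ a) (ha2 : a + 4 ≤ p) {N : ℕ}
    (hN : ((p : ℤ) - 1) ∣ N - a - 2 * s) {m : ℕ} (hm : m ≤ urCount p a s N) :
    2 * ghostVal p a s N (urCount p a s N) ≤
      2 * ghostVal p a s N m + (urCount p a s N - m) * N := by
  induction hm using Nat.decreasingInduction with
  | self => simp
  | of_succ m hm ih =>
    have := two_mul_ghostVal_step_le ha1 ha2 hN hm
    push_cast at ih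
    linarith

/-- The segment across the range in which the ghost series vanishes at the weight `N + 2` has slope
`N / 2`, by the ghost duality. -/
theorem two_mul_ghostVal_sub_urCount (ha1 : 1 ≤ a) (ha2 : a + 4 ≤ p) {N : ℕ}
    (hN : ((p : ℤ) - 1) ∣ N - a - 2 * s) :
    2 * ghostVal p a s N (degCount p a s (N + 1) - urCount p a s N) =
      2 * ghostVal p a s N (urCount p a s N) +
        N * (degCount p a s (N + 1) - 2 * urCount p a s N) := by
  obtain ⟨c, hc⟩ := even_degCount ha1 ha2 hN
  have hu := two_mul_urCount_le ha1 ha2 hN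
  have h := ghostVal_duality ha1 ha2 (c := c) (h := c - urCount p a s N) hN (by omega) (by omega)
  rw [show c + (c - urCount p a s N) = degCount p a s (N + 1) - urCount p a s N by omega,
    show c - (c - urCount p a s N) = urCount p a s N by omega, Nat.cast_sub (by omega)] at h
  rw [hc] at h ⊢
  push_cast
  linarith

/-- A line of slope `N / 2` supports the points outside of the range in which the ghost series
vanishes at the weight `N + 2`, and passes through the two points at the ends of that range. -/
theorem le_two_mul_ghostVal (ha1 : 1 ≤ a) (ha2 : a + 4 ≤ p) {N : ℕ}
    (hN : ((p : ℤ) - 1) ∣ N - a - 2 * s) {n : ℕ}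
    (hn : n ≤ urCount p a s N ∨ degCount p a s (N + 1) - urCount p a s N ≤ n) :
    2 * ghostVal p a s N (urCount p a s N) + N * (n - urCount p a s N) ≤
      2 * ghostVal p a s N n := by
  have hu := two_mul_urCount_le ha1 ha2 hN
  -- the points at `D - m` with `m ≤ u`
  have key : ∀ m ≤ urCount p a s N, 2 * ghostVal p a s N (urCount p a s N) +
      N * (degCount p a s (N + 1) - m - urCount p a s N) ≤
        2 * ghostVal p a s N (degCount p a s (N + 1) - m) := fun m hm => by
    have h1 := two_mul_ghostVal_urCount_le ha1 ha2 hN hm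
    have h2 := two_mul_ghostVal_sub_urCount ha1 ha2 hN
    have h3 := ghostVal_reflect_self ha1 ha2 hN hm
    have h4 := ghostVal_reflect_self ha1 ha2 hN le_rfl
    have h5 : (m : ℤ) ≤ urCount p a s N := by exact_mod_cast hm
    linarith
  rcases hn with hn | hn
  · have := two_mul_ghostVal_urCount_le ha1 ha2 hN hn
    linarith
  rcases le_total n (degCount p a s (N + 1)) with h | h
  · have h1 := key (degCount p a s (N + 1) - n) (by omega)
    rw [Nat.sub_sub_self h, Nat.cast_sub h] at h1
    linarith
  · have h1 := key 0 (by positivity)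
    have h2 := le_ghostVal_degCount (s := s) ha1 ha2 N n
    have h3 : (0 : ℤ) ≤ ((n : ℤ) - degCount p a s (N + 1)) * (N + 2) :=
      mul_nonneg (by omega) (by positivity)
    rw [Nat.sub_zero] at h1
    push_cast at h1
    linarith

end Supporting

/-! ### The slopes of the ghost series -/

section Slopes

variable {p : ℕ} [Fact p.Prime] {O : Type*} [CommRing O] [IsDomain O] [IsDiscreteValuationRing O]
  [Algebra ℤ_[p] O] [Module.Finite ℤ_[p] O] [FaithfulSMul ℤ_[p] O]
  {H : Type*} [AddCommGroup H] [Module O H]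
  [Module (IwasawaAlgebra p O)ᵐᵒᵖ H] [IsScalarTower O (IwasawaAlgebra p O)ᵐᵒᵖ H]
  [Module.Finite (IwasawaAlgebra p O)ᵐᵒᵖ H] [Module.Projective (IwasawaAlgebra p O)ᵐᵒᵖ H]
  {a : ℕ}

theorem vanishingOrder_eq_zero_iff {s : ℤ} {n N : ℕ} (hN : ((p : ℤ) - 1) ∣ N - a - 2 * s) :
    vanishingOrder p a s n N = 0 ↔
      n ≤ urCount p a s N ∨ degCount p a s (N + 1) - urCount p a s N ≤ n := by
  rw [vanishingOrder, if_pos ⟨by positivity, hN⟩, Int.toNat_natCast, latticeMult_eq_zero_iff]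

theorem vanishingOrder_of_not_dvd {s N₀ : ℤ} (n : ℕ) (hN : ¬ ((p : ℤ) - 1) ∣ N₀ - a - 2 * s) :
    vanishingOrder p a s n N₀ = 0 := if_neg fun h => hN h.2

theorem vanishingOrder_of_neg {s N₀ : ℤ} (n : ℕ) (hN : N₀ < 0) : vanishingOrder p a s n N₀ = 0 :=
  if_neg fun h => absurd h.1 (not_le.2 hN)

theorem vanishingOrder_of_degCount_le {s : ℤ} {n N : ℕ} (h : degCount p a s (N + 1) ≤ n) :
    vanishingOrder p a s n N = 0 := by
  by_cases hN : ((p : ℤ) - 1) ∣ N - a - 2 * s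
  · exact (vanishingOrder_eq_zero_iff hN).2 (Or.inr (by omega))
  · exact vanishingOrder_of_not_dvd n hN

theorem vanishingOrder_zero (s N₀ : ℤ) : vanishingOrder p a s 0 N₀ = 0 := by
  rw [vanishingOrder]
  split_ifs
  · exact latticeMult_eq_zero_iff.2 (Or.inl (Nat.zero_le _))
  · rfl

theorem ghostHull_mono (s N₀ : ℤ) {x x' : ℝ} (hx : 0 ≤ x) (hxx : x ≤ x') :
    ghostHull p a s N₀ x ≤ ghostHull p a s N₀ x' := by
  obtain ⟨n, hn⟩ := exists_nat_ge x'
  obtain ⟨m, hm, hnm⟩ : ∃ m, vanishingOrder p a s m N₀ = 0 ∧ n ≤ m := by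
    rcases lt_or_ge N₀ 0 with h | h
    · exact ⟨n, vanishingOrder_of_neg n h, le_rfl⟩
    · obtain ⟨N, rfl⟩ := Int.eq_ofNat_of_zero_le h
      exact ⟨_, vanishingOrder_of_degCount_le (le_max_left (degCount p a s (N + 1)) n),
        le_max_right _ n⟩
  unfold ghostHull
  have h0 : 0 ∈ {n | vanishingOrder p a s n N₀ = 0} := vanishingOrder_zero s N₀
  have hm' : m ∈ {n | vanishingOrder p a s n N₀ = 0} := hm
  have hmn : (n : ℝ) ≤ m := by exact_mod_cast hnm
  refine lowerHull_seqPoints_mono h0 ?_ (fun n => ?_) hx hxx hm' (hn.trans hmn)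
  · simp [ghostVal_zero]
  · exact_mod_cast ghostVal_nonneg N₀ n

theorem IsPrimitiveOfType.ghostSlope_nonneg (hH : IsPrimitiveOfType p O H a) (hp : 5 ≤ p)
    (ha1 : 1 ≤ a) (ha2 : a + 4 ≤ p) (s k : ℤ) {n : ℕ} (hn : 1 ≤ n) :
    0 ≤ ghostSlope p O H a s k n := by
  rw [hH.ghostSlope_eq hp ha1 ha2 s (show k = k - 2 + 2 by ring), sub_nonneg]
  have hn' : (1 : ℝ) ≤ n := by exact_mod_cast hn
  exact ghostHull_mono s (k - 2) (by linarith) (by linarith)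

theorem le_ghostVal_degCount_real (ha1 : 1 ≤ a) (ha2 : a + 4 ≤ p) (s : ℤ) (N n : ℕ) :
    (ghostVal p a s N (degCount p a s (N + 1)) : ℝ) +
      ((N : ℝ) + 1) * ((n : ℝ) - degCount p a s (N + 1)) ≤ ghostVal p a s N n := by
  exact_mod_cast le_ghostVal_degCount (p := p) (a := a) (s := s) (by omega) (by omega) N n

/-- From its vertex at `degCount (N + 1)` on, the Newton polygon is a shear of the one for `s - 1 -
N` at the weight `-N`. -/
theorem ghostHull_theta (ha1 : 1 ≤ a) (ha2 : a + 4 ≤ p) {s s' : ℤ} {N : ℕ}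
    (h : ((p : ℤ) - 1) ∣ s' - (s - 1 - N)) {x : ℝ} (hx : 0 ≤ x) :
    ghostHull p a s N (degCount p a s (N + 1) + x) = ghostHull p a s' (-N - 2) x +
      ((N + 1) * x + ghostVal p a s N (degCount p a s (N + 1))) := by
  have hS : {n | vanishingOrder p a s' n (-N - 2) = 0} = Set.univ :=
    Set.eq_univ_of_forall fun n => vanishingOrder_of_neg n (by omega)
  have hD : ∀ l, degCount p a s (N + 1) + l ∈ {n | vanishingOrder p a s n N = 0} := fun l =>
    vanishingOrder_of_degCount_le (Nat.le_add_right _ _)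
  unfold ghostHull
  rw [hS]
  refine lowerHull_add (hD 0) (fun n _ => le_ghostVal_degCount_real ha1 ha2 s N n) hD
    (fun n => ?_) (fun l => ?_) hx
  · exact_mod_cast ghostVal_nonneg _ n
  · exact_mod_cast ghostVal_theta (by omega) (by omega) h l

theorem ghostHull_eq_Icc (ha1 : 1 ≤ a) (ha2 : a + 4 ≤ p) {s : ℤ} {N : ℕ}
    (hN : ¬ ((p : ℤ) - 1) ∣ N - a - 2 * s) {x : ℝ} (hx : x ≤ degCount p a s (N + 1)) :
    ghostHull p a s N x = lowerHull (seqPoints (Set.Icc 0 (degCount p a s (N + 1)))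
      fun n => (ghostVal p a s N n : ℝ)) x := by
  unfold ghostHull
  have hD : degCount p a s (N + 1) ∈ {n | vanishingOrder p a s n N = 0} :=
    vanishingOrder_of_degCount_le le_rfl
  rw [← lowerHull_Iic hD (fun n _ => le_ghostVal_degCount_real ha1 ha2 s N n) hx]
  congr 2
  ext n
  simp [vanishingOrder_of_not_dvd n hN]

/-- Up to the vertex at `degCount (N + 1)`, the Newton polygons for `s` and `N - a - s` are shears
of the reflections of each other. -/
theorem ghostHull_reflect (ha1 : 1 ≤ a) (ha2 : a + 4 ≤ p) {s s' : ℤ} {N : ℕ}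
    (h : ((p : ℤ) - 1) ∣ s' - (N - a - s)) (hN : ¬ ((p : ℤ) - 1) ∣ N - a - 2 * s) {x : ℝ}
    (hx : 0 ≤ x) (hx' : x ≤ degCount p a s (N + 1)) :
    ghostHull p a s' N (degCount p a s (N + 1) - x) = ghostHull p a s N x +
      (-(N + 1) * x + ghostVal p a s' N (degCount p a s (N + 1))) := by
  have hN' : ¬ ((p : ℤ) - 1) ∣ N - a - 2 * s' := fun h1 => hN <| by
    have := dvd_add (h.mul_right 2) h1
    rwa [show (s' - (N - a - s)) * 2 + (N - a - 2 * s') = -(N - a - 2 * s) by ring, dvd_neg] at this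
  have hD := degCount_reflect (a := a) h
  rw [ghostHull_eq_Icc ha1 ha2 hN hx', ghostHull_eq_Icc ha1 ha2 hN' (by rw [hD]; linarith), hD]
  have key := lowerHull_reflect (D := degCount p a s (N + 1)) (i := 0)
    (j := degCount p a s (N + 1)) (y := fun n => (ghostVal p a s N n : ℝ))
    (y' := fun n => (ghostVal p a s' N n : ℝ)) (m := (N : ℝ) + 1)
    (K := ghostVal p a s' N (degCount p a s (N + 1))) (x := x) (Nat.zero_le _) le_rfl
    (fun n => by exact_mod_cast ghostVal_nonneg _ n) (fun n hn => by
      have := ghostVal_reflect (by omega) (by omega) h hN hn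
      rify at this
      linarith) (by simpa using hx) hx'
  simpa only [Nat.sub_self, Nat.sub_zero] using key

theorem le_ghostVal_real (ha1 : 1 ≤ a) (ha2 : a + 4 ≤ p) {s : ℤ} {N : ℕ}
    (hN : ((p : ℤ) - 1) ∣ N - a - 2 * s) {n : ℕ} (hn : vanishingOrder p a s n N = 0) :
    (ghostVal p a s N (urCount p a s N) : ℝ) + (N : ℝ) / 2 * ((n : ℝ) - urCount p a s N) ≤
      ghostVal p a s N n := by
  have := le_two_mul_ghostVal (by omega) (by omega) hN ((vanishingOrder_eq_zero_iff hN).1 hn)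
  rify at this
  linarith

theorem ghostVal_sub_urCount_real (ha1 : 1 ≤ a) (ha2 : a + 4 ≤ p) {s : ℤ} {N : ℕ}
    (hN : ((p : ℤ) - 1) ∣ N - a - 2 * s) :
    (ghostVal p a s N (degCount p a s (N + 1) - urCount p a s N) : ℝ) =
      ghostVal p a s N (urCount p a s N) +
        (N : ℝ) / 2 * ((degCount p a s (N + 1) - urCount p a s N : ℕ) - urCount p a s N) := by
  have := two_mul_ghostVal_sub_urCount (by omega) (by omega) hN
  have hu := two_mul_urCount_le (by omega) (by omega) hN
  rify at this
  rw [Nat.cast_sub (by omega)]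
  linarith

/-- In the congruence class of the weights of the ghost series, the parts of the Newton polygon over
`[0, u]` and `[D - u, D]`, where `u = urCount N` and `D = degCount (N + 1)`, correspond under a
shear of a reflection. -/
theorem ghostHull_reflect_self (ha1 : 1 ≤ a) (ha2 : a + 4 ≤ p) {s : ℤ} {N : ℕ}
    (hN : ((p : ℤ) - 1) ∣ N - a - 2 * s) {x : ℝ} (hx : 0 ≤ x) (hx' : x ≤ urCount p a s N) :
    ghostHull p a s N (degCount p a s (N + 1) - x) = ghostHull p a s N x +
      (-(N + 1) * x + ghostVal p a s N (degCount p a s (N + 1))) := by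
  have hu := two_mul_urCount_le (by omega) (by omega) hN
  set S := {n | vanishingOrder p a s n N = 0} with hS
  have hmem : ∀ n, n ∈ S ↔ n ≤ urCount p a s N ∨ degCount p a s (N + 1) - urCount p a s N ≤ n :=
    fun n => vanishingOrder_eq_zero_iff hN
  have hlow : ∀ n ∈ S, _ := fun n (hn : vanishingOrder p a s n N = 0) =>
    le_ghostVal_real ha1 ha2 hN hn
  have hmid := ghostVal_sub_urCount_real ha1 ha2 hN
  have hDu : ((degCount p a s (N + 1) - urCount p a s N : ℕ) : ℝ) =
      degCount p a s (N + 1) - urCount p a s N := Nat.cast_sub (by omega)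
  have key := lowerHull_reflect (D := degCount p a s (N + 1)) (i := 0) (j := urCount p a s N)
    (y := fun n => (ghostVal p a s N n : ℝ)) (y' := fun n => (ghostVal p a s N n : ℝ))
    (m := (N : ℝ) + 1) (K := ghostVal p a s N (degCount p a s (N + 1))) (x := x) (Nat.zero_le _)
    (by omega) (fun n => by exact_mod_cast ghostVal_nonneg _ n) (fun n hn => by
      have := ghostVal_reflect_self (by omega) (by omega) hN hn
      rify at this
      linarith) (by simpa using hx) hx'
  unfold ghostHull
  have hlow' : ∀ n ∈ S, (ghostVal p a s N (degCount p a s (N + 1) - urCount p a s N) : ℝ) +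
      (N : ℝ) / 2 * ((n : ℝ) - (degCount p a s (N + 1) - urCount p a s N : ℕ)) ≤
        ghostVal p a s N n := fun n hn => by
    have := hlow n hn
    rw [hmid]
    linarith
  have hD : degCount p a s (N + 1) ∈
      S ∩ Set.Ici (degCount p a s (N + 1) - urCount p a s N) :=
    ⟨(hmem _).2 (Or.inr (by omega)), Set.mem_Ici.2 (by omega)⟩
  rw [← hS, ← lowerHull_Iic ((hmem _).2 (Or.inl le_rfl)) hlow hx',
    ← lowerHull_Ici ((hmem _).2 (Or.inr le_rfl)) hlow' (by rw [hDu]; linarith),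
    ← lowerHull_Iic hD (fun n _ => le_ghostVal_degCount_real ha1 ha2 s N n) (by linarith)]
  convert key using 4
  · ext n
    simp only [Set.mem_inter_iff, hmem, Set.mem_Ici, Set.mem_Iic, Set.mem_Icc]
    omega
  · ext n
    simp only [Set.mem_inter_iff, hmem, Set.mem_Iic, Set.mem_Icc]
    omega

/-- In the congruence class of the weights of the ghost series, the Newton polygon is a line of
slope `N / 2` over the range in which the ghost series vanishes. -/
theorem ghostHull_eq_line (ha1 : 1 ≤ a) (ha2 : a + 4 ≤ p) {s : ℤ} {N : ℕ}
    (hN : ((p : ℤ) - 1) ∣ N - a - 2 * s) {x : ℝ} (hx : urCount p a s N ≤ x)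
    (hx' : x ≤ (degCount p a s (N + 1) - urCount p a s N : ℕ)) :
    ghostHull p a s N x = ghostVal p a s N (urCount p a s N) -
      (N : ℝ) / 2 * urCount p a s N + (N : ℝ) / 2 * x := by
  have hu : urCount p a s N ∈ {n | vanishingOrder p a s n N = 0} :=
    (vanishingOrder_eq_zero_iff hN).2 (Or.inl le_rfl)
  have hDu : degCount p a s (N + 1) - urCount p a s N ∈ {n | vanishingOrder p a s n N = 0} :=
    (vanishingOrder_eq_zero_iff hN).2 (Or.inr le_rfl)
  unfold ghostHull
  refine lowerHull_eq_of_mem_line (mem_seqPoints hu) (mem_seqPoints hDu) ?_ ?_ ?_ hx hx'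
  · dsimp only
    ring
  · dsimp only
    rw [ghostVal_sub_urCount_real ha1 ha2 hN]
    ring
  · rintro _ ⟨n, hn, rfl⟩
    have := le_ghostVal_real ha1 ha2 hN hn
    dsimp only
    linarith


theorem omega_add (m n : ℤ) : omega p O (m + n) = omega p O m * omega p O n := by
  unfold omega
  exact zpow_add (G := (ZMod p)ˣ →* Oˣ) _ m n

theorem prodChar_mul_prodChar_one (χ₁ χ₂ χ : (ZMod p)ˣ →* Oˣ) :
    prodChar χ₁ χ₂ * prodChar 1 χ = prodChar χ₁ (χ₂ * χ) := by
  ext x : 1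
  simp [mul_assoc]

theorem IsPrimitiveOfType.dIw_mul_eq (hH : IsPrimitiveOfType p O H a) (ha1 : 1 ≤ a)
    (ha2 : a + 4 ≤ p) (N : ℕ) (s : ℤ) :
    dIw O H (N + 2) (prodChar (omega p O (-s)) (omega p O (a + s)) *
      prodChar 1 (omega p O (2 - (N + 2 : ℕ)))) = degCount p a s (N + 1) := by
  rw [prodChar_mul_prodChar_one, ← omega_add]
  refine hH.dIw_eq ha1 ha2 N s _ ?_
  push_cast
  rw [show (N : ℤ) - s + (a + s + (2 - (N + 2))) - a = 0 by ring]
  exact dvd_zero _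

theorem IsPrimitiveOfType.ghostSlope_theta (hH : IsPrimitiveOfType p O H a) (hp : 5 ≤ p)
    (ha1 : 1 ≤ a) (ha2 : a + 4 ≤ p) {s s' : ℤ} {N l : ℕ} (h : ((p : ℤ) - 1) ∣ s' - (s - 1 - N))
    (hl : 1 ≤ l) :
    ghostSlope p O H a s (N + 2 : ℕ) (degCount p a s (N + 1) + l) =
      N + 1 + ghostSlope p O H a s' (2 - (N + 2 : ℕ)) l := by
  have hl' : (1 : ℝ) ≤ l := by exact_mod_cast hl
  rw [hH.ghostSlope_eq hp ha1 ha2 s (N₀ := N) (by push_cast; ring),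
    hH.ghostSlope_eq hp ha1 ha2 s' (N₀ := -N - 2) (by push_cast; ring), Nat.cast_add,
    add_sub_assoc, ghostHull_theta ha1 ha2 h (by linarith), ghostHull_theta ha1 ha2 h (by linarith)]
  ring

theorem IsPrimitiveOfType.ghostSlope_atkinLehner (hH : IsPrimitiveOfType p O H a) (hp : 5 ≤ p)
    (ha1 : 1 ≤ a) (ha2 : a + 4 ≤ p) {s s' : ℤ} {N l : ℕ} (h : ((p : ℤ) - 1) ∣ s' - (N - a - s))
    (hN : ¬ ((p : ℤ) - 1) ∣ N - a - 2 * s) (hl : 1 ≤ l) (hld : l ≤ degCount p a s (N + 1)) :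
    ghostSlope p O H a s (N + 2 : ℕ) l +
      ghostSlope p O H a s' (N + 2 : ℕ) (degCount p a s (N + 1) - l + 1) = N + 1 := by
  have hl' : (1 : ℝ) ≤ l := by exact_mod_cast hl
  have hld' : (l : ℝ) ≤ degCount p a s (N + 1) := by exact_mod_cast hld
  have h1 := ghostHull_reflect ha1 ha2 h hN (x := l) (by linarith) hld'
  have h2 := ghostHull_reflect ha1 ha2 h hN (x := l - 1) (by linarith) (by linarith)
  rw [← sub_add] at h2
  rw [hH.ghostSlope_eq hp ha1 ha2 s (N₀ := N) (by push_cast; ring),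
    hH.ghostSlope_eq hp ha1 ha2 s' (N₀ := N) (by push_cast; ring), Nat.cast_add, Nat.cast_sub hld,
    Nat.cast_one, add_sub_cancel_right, h1, h2]
  ring

theorem IsPrimitiveOfType.ghostSlope_stabilization (hH : IsPrimitiveOfType p O H a) (hp : 5 ≤ p)
    (ha1 : 1 ≤ a) (ha2 : a + 4 ≤ p) {s : ℤ} {N l : ℕ} (hN : ((p : ℤ) - 1) ∣ N - a - 2 * s)
    (hl : 1 ≤ l) (hlu : l ≤ urCount p a s N) :
    ghostSlope p O H a s (N + 2 : ℕ) l +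
      ghostSlope p O H a s (N + 2 : ℕ) (degCount p a s (N + 1) - l + 1) = N + 1 := by
  have hu := two_mul_urCount_le (by omega) (by omega) hN
  have hl' : (1 : ℝ) ≤ l := by exact_mod_cast hl
  have hlu' : (l : ℝ) ≤ urCount p a s N := by exact_mod_cast hlu
  have h1 := ghostHull_reflect_self ha1 ha2 hN (x := l) (by linarith) hlu'
  have h2 := ghostHull_reflect_self ha1 ha2 hN (x := l - 1) (by linarith) (by linarith)
  rw [← sub_add] at h2
  rw [hH.ghostSlope_eq hp ha1 ha2 s (N₀ := N) (by push_cast; ring),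
    hH.ghostSlope_eq hp ha1 ha2 s (N₀ := N) (by push_cast; ring), Nat.cast_add,
    Nat.cast_sub (by omega : l ≤ degCount p a s (N + 1)),
    Nat.cast_one, add_sub_cancel_right, h1, h2]
  ring

theorem IsPrimitiveOfType.ghostSlope_eq_half (hH : IsPrimitiveOfType p O H a) (hp : 5 ≤ p)
    (ha1 : 1 ≤ a) (ha2 : a + 4 ≤ p) {s : ℤ} {N n : ℕ} (hN : ((p : ℤ) - 1) ∣ N - a - 2 * s)
    (hn : urCount p a s N + 1 ≤ n) (hn' : n ≤ degCount p a s (N + 1) - urCount p a s N) :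
    ghostSlope p O H a s (N + 2 : ℕ) n = (N : ℝ) / 2 := by
  have h1 : (urCount p a s N : ℝ) + 1 ≤ n := by exact_mod_cast hn
  have h2 : (n : ℝ) ≤ (degCount p a s (N + 1) - urCount p a s N : ℕ) := by exact_mod_cast hn'
  rw [hH.ghostSlope_eq hp ha1 ha2 s (N₀ := N) (by push_cast; ring),
    ghostHull_eq_line ha1 ha2 hN (by linarith) h2,
    ghostHull_eq_line ha1 ha2 hN (by linarith) (by linarith)]
  ring

end Slopes
end Ghost

theorem propositionP (p : ℕ) [Fact p.Prime] (hp : 5 ≤ p)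
    (O : Type*) [CommRing O] [IsDomain O] [IsDiscreteValuationRing O]
    [Algebra ℤ_[p] O] [Module.Finite ℤ_[p] O] [FaithfulSMul ℤ_[p] O]
    (H : Type*) [AddCommGroup H] [Module O H]
    [Module (Ghost.IwasawaAlgebra p O)ᵐᵒᵖ H] [IsScalarTower O (Ghost.IwasawaAlgebra p O)ᵐᵒᵖ H]
    [Module.Finite (Ghost.IwasawaAlgebra p O)ᵐᵒᵖ H]
    [Module.Projective (Ghost.IwasawaAlgebra p O)ᵐᵒᵖ H]
    (a : ℕ) (ha1 : 1 ≤ a) (ha2 : a + 4 ≤ p) (hH : Ghost.IsPrimitiveOfType p O H a)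
    (s : ℕ) (hs : s ≤ p - 2) (k0 : ℕ) (hk0 : 2 ≤ k0) :
    let d : ℕ := Ghost.dIw O H k0
      (Ghost.prodChar (Ghost.omega p O (-(s : ℤ))) (Ghost.omega p O ((a : ℤ) + s)) *
        Ghost.prodChar 1 (Ghost.omega p O (2 - (k0 : ℤ))))
    let dIw : ℕ := Ghost.dIw O H k0
      (Ghost.prodChar (Ghost.omega p O (-(s : ℤ))) (Ghost.omega p O (-(s : ℤ))))
    let dUr : ℕ := Ghost.dUr O H k0 (Ghost.omega p O (-(s : ℤ)))
    let dNew : ℤ := Ghost.dNew O H k0 (Ghost.omega p O (-(s : ℤ)))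
    let s' : ℤ := Ghost.res p ((s : ℤ) + 1 - k0)
    let s'' : ℤ := Ghost.res p ((k0 : ℤ) - 2 - a - s)
    -- compatibility with theta maps
    (∀ ℓ : ℕ, 1 ≤ ℓ →
      Ghost.ghostSlope p O H a s k0 (d + ℓ) =
        ((k0 : ℝ) - 1) + Ghost.ghostSlope p O H a s' (2 - (k0 : ℤ)) ℓ ∧
      (k0 : ℝ) - 1 ≤ Ghost.ghostSlope p O H a s k0 (d + ℓ)) ∧
    -- compatibility with Atkin-Lehner involutions
    (¬ (k0 : ℤ) ≡ Ghost.kEps p a s [ZMOD ((p : ℤ) - 1)] →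
      ∀ ℓ : ℕ, 1 ≤ ℓ → ℓ ≤ d →
        Ghost.ghostSlope p O H a s k0 ℓ + Ghost.ghostSlope p O H a s'' k0 (d - ℓ + 1) =
          (k0 : ℝ) - 1 ∧
        Ghost.ghostSlope p O H a s k0 ℓ ≤ (k0 : ℝ) - 1) ∧
    -- compatibility with p-stabilizations
    ((k0 : ℤ) ≡ Ghost.kEps p a s [ZMOD ((p : ℤ) - 1)] →
      ∀ ℓ : ℕ, 1 ≤ ℓ → ℓ ≤ dUr →
        Ghost.ghostSlope p O H a s k0 ℓ + Ghost.ghostSlope p O H a s k0 (d - ℓ + 1) =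
          (k0 : ℝ) - 1 ∧
        Ghost.ghostSlope p O H a s k0 ℓ ≤ (k0 : ℝ) - 1) ∧
    -- ghost duality
    ((k0 : ℤ) ≡ Ghost.kEps p a s [ZMOD ((p : ℤ) - 1)] →
      (∀ ℓ : ℕ, (ℓ : ℚ) ≤ (dNew : ℚ) / 2 - 1 →
        (Ghost.ghostCoeffHat p O H a s (dIw - dUr - ℓ) k0).eval (Ghost.weightPoint p k0) ≠ 0 ∧
        (Ghost.ghostCoeffHat p O H a s (dUr + ℓ) k0).eval (Ghost.weightPoint p k0) ≠ 0 ∧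
        (((Ghost.ghostCoeffHat p O H a s (dIw - dUr - ℓ) k0).eval
            (Ghost.weightPoint p k0)).valuation : ℚ) -
          (((Ghost.ghostCoeffHat p O H a s (dUr + ℓ) k0).eval
            (Ghost.weightPoint p k0)).valuation : ℚ) =
          ((k0 : ℚ) - 2) * ((dNew : ℚ) / 2 - ℓ)) ∧
      ∀ n : ℕ, dUr + 1 ≤ n → n ≤ dIw - dUr →
        Ghost.ghostSlope p O H a s k0 n = ((k0 : ℝ) - 2) / 2) := by
  intro d dIw dUr dNew s' s''
  obtain ⟨N, rfl⟩ := Nat.exists_eq_add_of_le' hk0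
  have hd : d = Ghost.degCount p a s (N + 1) := hH.dIw_mul_eq ha1 ha2 N s
  have hs' : ((p : ℤ) - 1) ∣ s' - (s - 1 - N) := by
    rw [show (s : ℤ) - 1 - N = s + 1 - (N + 2 : ℕ) by push_cast; ring]
    exact Ghost.dvd_res_sub _
  have hs'' : ((p : ℤ) - 1) ∣ s'' - (N - a - s) := by
    rw [show (N : ℤ) - a - s = (N + 2 : ℕ) - 2 - a - s by push_cast; ring]
    exact Ghost.dvd_res_sub _
  have hk : ((N + 2 : ℕ) : ℤ) ≡ Ghost.kEps p a s [ZMOD ((p : ℤ) - 1)] ↔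
      ((p : ℤ) - 1) ∣ N - a - 2 * s := by
    rw [Ghost.modEq_kEps_iff]
    push_cast
    rw [add_sub_cancel_right]
  have hw : ((N + 2 : ℕ) : ℝ) - 1 = N + 1 := by push_cast; ring
  have hw2 : ((N + 2 : ℕ) : ℝ) - 2 = N := by push_cast; ring
  have hw3 : ((N + 2 : ℕ) : ℚ) - 2 = N := by push_cast; ring
  rw [hk, hw, hw2, hw3, hd]
  refine ⟨fun l hl => ?_, fun hN l hl hld => ?_, fun hN l hl hlu => ?_, fun hN => ?_⟩
  · have h1 := hH.ghostSlope_theta hp ha1 ha2 hs' hl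
    have h2 := hH.ghostSlope_nonneg hp ha1 ha2 s' (2 - (N + 2 : ℕ)) hl
    exact ⟨h1, by linarith⟩
  · have h1 := hH.ghostSlope_atkinLehner hp ha1 ha2 hs'' hN hl hld
    have h2 := hH.ghostSlope_nonneg hp ha1 ha2 s'' (N + 2 : ℕ)
      (n := Ghost.degCount p a s (N + 1) - l + 1) (by omega)
    exact ⟨h1, by linarith⟩
  · have hdUr : dUr = Ghost.urCount p a s N := hH.dUr_eq ha1 ha2 N s hN
    have h1 := hH.ghostSlope_stabilization hp ha1 ha2 hN hl (hdUr ▸ hlu)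
    have h2 := hH.ghostSlope_nonneg hp ha1 ha2 s (N + 2 : ℕ)
      (n := Ghost.degCount p a s (N + 1) - l + 1) (by omega)
    exact ⟨h1, by linarith⟩
  · have hdUr : dUr = Ghost.urCount p a s N := hH.dUr_eq ha1 ha2 N s hN
    have hdIw : dIw = Ghost.degCount p a s (N + 1) := hH.dIw_eq ha1 ha2 N s _
      (by rwa [show (N : ℤ) - s + -s - a = N - a - 2 * s by ring])
    have hdNew : dNew = (dIw : ℤ) - 2 * dUr := rfl
    have hu := Ghost.two_mul_urCount_le (p := p) (a := a) (s := s) (by omega) (by omega) hN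
    obtain ⟨c, hc⟩ := Ghost.even_degCount (p := p) (a := a) (s := s) (by omega) (by omega) hN
    rw [hdNew, hdIw, hdUr]
    refine ⟨fun l hl => ?_, fun n hn hn' => hH.ghostSlope_eq_half hp ha1 ha2 hN hn hn'⟩
    have hl' : l + Ghost.urCount p a s N + 1 ≤ c := by
      rw [hc] at hl
      push_cast at hl
      have : (l : ℚ) + Ghost.urCount p a s N + 1 ≤ c := by linarith
      exact_mod_cast this
    have h1 := hH.ghostCoeffHat_eval hp ha1 ha2 hN
      (Ghost.degCount p a s (N + 1) - Ghost.urCount p a s N - l)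
    have h2 := hH.ghostCoeffHat_eval hp ha1 ha2 hN (Ghost.urCount p a s N + l)
    have h3 := Ghost.ghostVal_duality (p := p) (a := a) (s := s) (N := N) (c := c)
      (h := c - Ghost.urCount p a s N - l) (by omega) (by omega) hN (by omega) (by omega)
    refine ⟨h1.1, h2.1, ?_⟩
    rw [h1.2, h2.2]
    rw [show c + (c - Ghost.urCount p a s N - l) =
        Ghost.degCount p a s (N + 1) - Ghost.urCount p a s N - l by omega,
      show c - (c - Ghost.urCount p a s N - l) = Ghost.urCount p a s N + l by omega,
      Nat.cast_sub (by omega), Nat.cast_sub (by omega)] at h3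
    rw [hc] at h3 ⊢
    qify at h3
    push_cast at h3 ⊢
    linarith

end
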